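/- Let $p$ be a prime number, let $f\ge 1$ be an integer, put $q=p^f$, and let $\mathbb{F}_q$ be a field with $q$ elements. Let $\mathbb{Z}[1/p]$ be regarded as a trivial module over the finite group $SL_2(\mathbb{F}_q)$. Then for every integer $k\ge 1$ there is an isomorphism of abelian groups $$H_k(SL_2(\mathbb{F}_q),\mathbb{Z}[1/p])\cong\begin{cases}\mathbb{Z}/(q^2-1), & k\equiv 3 \pmod 4,\\ 0, & \text{otherwise,}\end{cases}$$ where $H_k$ denotes group homology. -/

import Mathlib

set_option linter.unusedSectionVars false

open scoped TensorProduct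

open CategoryTheory CategoryTheory.Limits

universe u

/-! Write `G` for the group and `I` for its augmentation ideal. The sequence `0 → I ⊗ A → Fun(G, A)
→ A → 0` has relatively projective middle term, so tensoring with `I` shifts Tate cohomology by one
degree. Hence `H_n(G, A)`, for `n ≥ 1`, is the group of invariants modulo norms of `I^{⊗(n+1)} ⊗ A`
(`nonempty_groupHomology_addEquiv_tateZero`). The core of the proof is that this has period four
once `p` is invertible on `A`: there is an invariant `ζ` in `I^{⊗4}` such that `a ↦ ζ ⊗ a` is
bijective on invariants modulo norms (`isPeriodic_SL_fin_two`).

Such a `ζ` is recognised one prime `l ≠ p` at a time. If the restriction of `I^{⊗4}` to a Sylow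
subgroup `S` is stably trivial, an invariant `ζ` generates at `l` as soon as it is not a norm from a
subgroup `C ≤ S` of order `l` (`StablyEquiv.exists_section_of_notMem_range`), and the local
generators assemble (`TateIso.of_local`). To find `ζ`, a generator over `S` is transferred to `G`;
modulo norms from `C`, the result is controlled by the fixed points of `C` on `G ⧸ S`
(`relNm_notMem_range`).

For odd `l` the Sylow subgroup is cyclic, so already `I^{⊗2}` is stably trivial on it. Conjugation
can only fix or invert the elements of `C`, since it preserves traces, so it changes the class of a
generator by a sign modulo `l`, and the sign disappears in the tensor square.

For `l = 2` the element `-1` is central, so fusion is harmless. Over the quadratic extension `K` a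
Sylow subgroup preserves a pair of lines. Their nonzero vectors, with multiplication by a generator
of `Kˣ` as rotation, form two circles, whose join is a three-sphere with a free cellular action. Its
cellular chain complex gives `I^{⊗4}` stably trivial (`Join.stablyEquiv`).

By periodicity it remains to compute four groups for `M = ℤ[1/p]`: `M / |G|M`, which is `ℤ/(q² -
1)`; the torsion killed by `|G|`; `Gᵃᵇ ⊗ M`; and `Hom(G, M)`. The last three vanish
(`IsPeriodic.groupHomology_trivial`). -/

namespace Representation

/-! ### Equivariant maps, norms and traces over a finite group. -/

noncomputable section

attribute [local instance] Fintype.ofFinite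

variable {k G V W X V' W' : Type*} [CommRing k] [Group G]
  [AddCommMonoid V] [Module k V] [AddCommMonoid W] [Module k W] [AddCommMonoid X] [Module k X]
  [AddCommMonoid V'] [Module k V'] [AddCommMonoid W'] [Module k W']
  (ρ : Representation k G V) (σ : Representation k G W) (τ : Representation k G X)
  (ρ' : Representation k G V') (σ' : Representation k G W')

/-- A linear map commutes with the group actions. -/
def IsEquivariant {k G V W : Type*} [CommRing k] [Group G] [AddCommMonoid V] [Module k V]
    [AddCommMonoid W] [Module k W] (ρ : Representation k G V) (σ : Representation k G W)
    (f : V →ₗ[k] W) : Prop := ∀ g v, f (ρ g v) = σ g (f v)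

variable {ρ σ τ ρ' σ'}

theorem IsEquivariant.id : IsEquivariant ρ ρ LinearMap.id := fun _ _ => rfl

theorem IsEquivariant.comp {f : W →ₗ[k] X} {g : V →ₗ[k] W} (hf : IsEquivariant σ τ f)
    (hg : IsEquivariant ρ σ g) : IsEquivariant ρ τ (f ∘ₗ g) := fun a v => by
  simp [hg a v, hf a]

theorem IsEquivariant.smul {f : V →ₗ[k] W} (hf : IsEquivariant ρ σ f) (r : k) :
    IsEquivariant ρ σ (r • f) := fun a v => by
  simp [hf a v]

theorem IsEquivariant.symm {e : V ≃ₗ[k] W} (he : IsEquivariant ρ σ e.toLinearMap) :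
    IsEquivariant σ ρ e.symm.toLinearMap := fun g w => by
  apply e.injective
  have := he g (e.symm w)
  simp at this
  simp [this]

theorem IsEquivariant.map {f : V →ₗ[k] W} {f' : V' →ₗ[k] W'} (hf : IsEquivariant ρ σ f)
    (hf' : IsEquivariant ρ' σ' f') :
    IsEquivariant (ρ.tprod ρ') (σ.tprod σ') (TensorProduct.map f f') := fun g v => by
  simp only [tprod_apply]
  induction v with
  | zero => simp
  | tmul x y => simp [hf g x, hf' g y]
  | add x y hx hy => simp only [map_add, hx, hy]

theorem IsEquivariant.comp_hom {H : Type*} [Group H] {f : V →ₗ[k] W} (hf : IsEquivariant ρ σ f)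
    (φ : H →* G) : IsEquivariant (ρ.comp φ) (σ.comp φ) f := fun g v => hf (φ g) v

variable [Finite G]

/-- The sum of all conjugates of a linear map under a finite group. -/
def tr {k G V W : Type*} [CommRing k] [Group G] [Finite G] [AddCommMonoid V] [Module k V]
    [AddCommMonoid W] [Module k W] (ρ : Representation k G V) (σ : Representation k G W) (b : V →ₗ[k] W) : V →ₗ[k] W := ∑ g, σ g ∘ₗ b ∘ₗ ρ g⁻¹

/-- The sum of all translates of a vector under a finite group. -/
def nm {k G V : Type*} [CommRing k] [Group G] [Finite G] [AddCommMonoid V] [Module k V]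
    (ρ : Representation k G V) (v : V) : V := ∑ g, ρ g v

theorem tr_apply (b : V →ₗ[k] W) (v : V) : tr ρ σ b v = ∑ g, σ g (b (ρ g⁻¹ v)) := by
  simp [tr, LinearMap.sum_apply]

theorem apply_nm (g : G) (v : V) : ρ g (nm ρ v) = nm ρ v := by
  simp only [nm, map_sum]
  exact Fintype.sum_equiv (Equiv.mulLeft g) _ _ fun x => by simp

theorem nm_apply (g : G) (v : V) : nm ρ (ρ g v) = nm ρ v := by
  simp only [nm]
  exact Fintype.sum_equiv (Equiv.mulRight g) _ _ fun x => by simp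

theorem nm_add (v w : V) : nm ρ (v + w) = nm ρ v + nm ρ w := by
  simp [nm, Finset.sum_add_distrib]

theorem nm_smul (r : k) (v : V) : nm ρ (r • v) = r • nm ρ v := by
  simp [nm, Finset.smul_sum]

theorem nm_of_invariant {v : V} (hv : ∀ g, ρ g v = v) : nm ρ v = (Nat.card G : k) • v := by
  simp [nm, hv, Nat.card_eq_fintype_card, Nat.cast_smul_eq_nsmul]

theorem IsEquivariant.map_nm {f : V →ₗ[k] W} (hf : IsEquivariant ρ σ f) (v : V) :
    f (nm ρ v) = nm σ (f v) := by
  simp [nm, hf _ v]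

theorem tr_apply_of_invariant (b : V →ₗ[k] W) {v : V} (hv : ∀ g, ρ g v = v) :
    tr ρ σ b v = nm σ (b v) := by
  simp [tr_apply, hv, nm]

theorem isEquivariant_tr (b : V →ₗ[k] W) : IsEquivariant ρ σ (tr ρ σ b) := fun g v => by
  simp only [tr_apply, map_sum]
  refine Fintype.sum_equiv (Equiv.mulLeft g⁻¹) _ _ fun x => ?_
  simp only [Equiv.coe_mulLeft, ← Module.End.mul_apply, ← map_mul]
  simp

theorem tr_add (b c : V →ₗ[k] W) : tr ρ σ (b + c) = tr ρ σ b + tr ρ σ c := by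
  ext v; simp [tr_apply, Finset.sum_add_distrib]

theorem tr_smul (r : k) (b : V →ₗ[k] W) : tr ρ σ (r • b) = r • tr ρ σ b := by
  ext v; simp [tr_apply, Finset.smul_sum]

theorem IsEquivariant.comp_tr {f : W →ₗ[k] X} (hf : IsEquivariant σ τ f) (b : V →ₗ[k] W) :
    f ∘ₗ tr ρ σ b = tr ρ τ (f ∘ₗ b) := by
  ext v; simp [tr_apply, hf _ _]

theorem IsEquivariant.tr_comp {f : V →ₗ[k] W} (hf : IsEquivariant ρ σ f) (b : W →ₗ[k] X) :
    tr σ τ b ∘ₗ f = tr ρ τ (b ∘ₗ f) := by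
  ext v; simp [tr_apply, hf _ _]

theorem tr_map_left (b : V →ₗ[k] W) {f : V' →ₗ[k] W'} (hf : IsEquivariant ρ' σ' f) :
    TensorProduct.map (tr ρ σ b) f = tr (ρ.tprod ρ') (σ.tprod σ') (TensorProduct.map b f) := by
  ext v v'
  simp [tr_apply, TensorProduct.sum_tmul, hf _ v']

theorem tr_map_right {f : V →ₗ[k] W} (hf : IsEquivariant ρ σ f) (b : V' →ₗ[k] W') :
    TensorProduct.map f (tr ρ' σ' b) = tr (ρ.tprod ρ') (σ.tprod σ') (TensorProduct.map f b) := by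
  ext v v'
  simp [tr_apply, TensorProduct.tmul_sum, hf _ v]

theorem nm_tmul_left (v : V) {w : W} (hw : ∀ g, σ g w = w) :
    nm (ρ.tprod σ) (v ⊗ₜ w) = nm ρ v ⊗ₜ[k] w := by
  simp [nm, hw, TensorProduct.sum_tmul]

theorem nm_tmul_right {v : V} (hv : ∀ g, ρ g v = v) (w : W) :
    nm (ρ.tprod σ) (v ⊗ₜ w) = v ⊗ₜ[k] nm σ w := by
  simp [nm, hv, TensorProduct.tmul_sum]

/-- Sums over a group can be computed along the right cosets of a subgroup. -/
theorem sum_eq_sum_cosets {H : Type*} [Group H] [Finite H] {φ : H →* G}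
    (hφ : Function.Injective φ) {A : Type*} [AddCommMonoid A] (F : G → A) :
    ∑ g, F g = ∑ q : G ⧸ φ.range, ∑ h, F (φ h * q.out⁻¹) := by
  have hq (q : G ⧸ φ.range) (h : H) : ((φ h * q.out⁻¹)⁻¹ : G) = (q : G ⧸ φ.range) := by
    rw [mul_inv_rev, inv_inv, ← map_inv, QuotientGroup.mk_mul_of_mem _ (φ.mem_range.2 ⟨h⁻¹, rfl⟩)]
    exact QuotientGroup.out_eq' q
  rw [← Fintype.sum_prod_type']
  refine (Fintype.sum_bijective (fun x : (G ⧸ φ.range) × H => φ x.2 * x.1.out⁻¹)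
    ⟨fun ⟨q, h⟩ ⟨q', h'⟩ e => ?_, fun g => ?_⟩ _ _ fun x => rfl).symm
  · obtain rfl : q = q' := by rw [← hq q h, ← hq q' h']; exact congr((($e)⁻¹ : G))
    simpa [hφ.eq_iff] using e
  · obtain ⟨h, hh⟩ := QuotientGroup.eq.1 (QuotientGroup.out_eq' ((g⁻¹ : G) : G ⧸ φ.range))
    exact ⟨(((g⁻¹ : G) : G ⧸ φ.range), h⁻¹), by simp [hh]⟩

/-- The witness adds up the translates of `v` by coset representatives, so a norm from a group is
also a norm from any subgroup. The next lemma does the same for traces. -/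
theorem exists_nm_eq_nm_comp {H : Type*} [Group H] [Finite H] {φ : H →* G}
    (hφ : Function.Injective φ) (v : V) : ∃ v', nm ρ v = nm (ρ.comp φ) v' := by
  refine ⟨∑ q : G ⧸ φ.range, ρ q.out⁻¹ v, ?_⟩
  rw [nm, sum_eq_sum_cosets hφ, Finset.sum_comm]
  simp [nm]

theorem exists_tr_eq_tr_comp {H : Type*} [Group H] [Finite H] {φ : H →* G}
    (hφ : Function.Injective φ) (b : V →ₗ[k] W) :
    ∃ b', tr ρ σ b = tr (ρ.comp φ) (σ.comp φ) b' := by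
  refine ⟨∑ q : G ⧸ φ.range, σ q.out⁻¹ ∘ₗ b ∘ₗ ρ q.out, ?_⟩
  rw [tr, sum_eq_sum_cosets hφ, Finset.sum_comm]
  ext v
  simp [tr_apply, LinearMap.sum_apply]

/-! ### Stable equivalence: isomorphism modulo traces. -/

/-- Two representations of a finite group are stably equivalent if they are isomorphic up to
linear maps that are traces. -/
def StablyEquiv {k G V W : Type*} [CommRing k] [Group G] [Finite G] [AddCommMonoid V] [Module k V]
    [AddCommMonoid W] [Module k W] (ρ : Representation k G V) (σ : Representation k G W) : Prop :=
  ∃ (f : V →ₗ[k] W) (g : W →ₗ[k] V) (a : V →ₗ[k] V) (b : W →ₗ[k] W),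
    IsEquivariant ρ σ f ∧ IsEquivariant σ ρ g ∧
      g ∘ₗ f = LinearMap.id + tr ρ ρ a ∧ f ∘ₗ g = LinearMap.id + tr σ σ b

theorem StablyEquiv.symm (h : StablyEquiv ρ σ) : StablyEquiv σ ρ := by
  obtain ⟨f, g, a, b, hf, hg, hgf, hfg⟩ := h
  exact ⟨g, f, b, a, hg, hf, hfg, hgf⟩

theorem StablyEquiv.of_equiv (e : V ≃ₗ[k] W) (he : IsEquivariant ρ σ e.toLinearMap) :
    StablyEquiv ρ σ :=
  ⟨e, e.symm, 0, 0, he, he.symm, by ext; simp [tr_apply], by ext; simp [tr_apply]⟩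

theorem StablyEquiv.refl : StablyEquiv ρ ρ :=
  .of_equiv (LinearEquiv.refl k V) fun _ _ => rfl

/-- Traces form an ideal: a trace composed with equivariant maps on either side is again a trace. -/
theorem StablyEquiv.trans (h : StablyEquiv ρ σ) (h' : StablyEquiv σ τ) : StablyEquiv ρ τ := by
  obtain ⟨f, g, a, b, hf, hg, hgf, hfg⟩ := h
  obtain ⟨f', g', a', b', hf', hg', hgf', hfg'⟩ := h'
  refine ⟨f' ∘ₗ f, g ∘ₗ g', a + g ∘ₗ a' ∘ₗ f, b' + f' ∘ₗ b ∘ₗ g', hf'.comp hf, hg.comp hg', ?_, ?_⟩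
  · rw [LinearMap.comp_assoc, ← LinearMap.comp_assoc f, hgf', LinearMap.add_comp,
      LinearMap.comp_add, LinearMap.id_comp, hgf, tr_add, hf.tr_comp, hg.comp_tr, add_assoc]
  · rw [LinearMap.comp_assoc, ← LinearMap.comp_assoc g', hfg, LinearMap.add_comp,
      LinearMap.comp_add, LinearMap.id_comp, hfg', tr_add, hg'.tr_comp, hf'.comp_tr, add_assoc]

theorem StablyEquiv.tprod_left (h : StablyEquiv ρ σ) :
    StablyEquiv (τ.tprod ρ) (τ.tprod σ) := by
  obtain ⟨f, g, a, b, hf, hg, hgf, hfg⟩ := h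
  refine ⟨TensorProduct.map .id f, TensorProduct.map .id g, TensorProduct.map .id a,
    TensorProduct.map .id b, IsEquivariant.id.map hf, IsEquivariant.id.map hg, ?_, ?_⟩
  · rw [← TensorProduct.map_comp, hgf, LinearMap.comp_id, TensorProduct.map_add_right,
      tr_map_right (.id (ρ := τ))]
    simp
  · rw [← TensorProduct.map_comp, hfg, LinearMap.comp_id, TensorProduct.map_add_right,
      tr_map_right (.id (ρ := τ))]
    simp

theorem StablyEquiv.comp {H : Type*} [Group H] [Finite H] {φ : H →* G}
    (hφ : Function.Injective φ) (h : StablyEquiv ρ σ) :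
    StablyEquiv (ρ.comp φ) (σ.comp φ) := by
  obtain ⟨f, g, a, b, hf, hg, hgf, hfg⟩ := h
  obtain ⟨a', ha'⟩ := exists_tr_eq_tr_comp (ρ := ρ) (σ := ρ) hφ a
  obtain ⟨b', hb'⟩ := exists_tr_eq_tr_comp (ρ := σ) (σ := σ) hφ b
  exact ⟨f, g, a', b', hf.comp_hom φ, hg.comp_hom φ, ha' ▸ hgf, hb' ▸ hfg⟩

/-! ### Schanuel's lemma up to stable equivalence. -/

section AddCommGroup

variable {k G V W X V' W' X' : Type*} [CommRing k] [Group G]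
  [AddCommGroup V] [Module k V] [AddCommGroup W] [Module k W] [AddCommGroup X] [Module k X]
  [AddCommGroup V'] [Module k V'] [AddCommGroup W'] [Module k W'] [AddCommGroup X'] [Module k X']
  {ρ : Representation k G V} {σ : Representation k G W} {τ : Representation k G X}
  {ρ' : Representation k G V'} {σ' : Representation k G W'} {τ' : Representation k G X'}

theorem IsEquivariant.sub {f g : V →ₗ[k] W} (hf : IsEquivariant ρ σ f)
    (hg : IsEquivariant ρ σ g) : IsEquivariant ρ σ (f - g) := fun a v => by
  simp [hf a v, hg a v]

variable [Finite G]

theorem nm_sub (v w : V) : nm ρ (v - w) = nm ρ v - nm ρ w := by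
  simp [nm]

theorem tr_sub (b c : V →ₗ[k] W) : tr ρ σ (b - c) = tr ρ σ b - tr ρ σ c := by
  ext v; simp [tr_apply]

/-- The endomorphism induced on the kernel of a short exact sequence whose middle term is
relatively projective is `1` plus a trace as soon as the one on the cokernel is. -/
theorem exists_eq_id_add_tr {i : V →ₗ[k] W} {π : W →ₗ[k] X} (hi : Function.Injective i)
    (hπ : Function.Surjective π) (hex : LinearMap.range i = LinearMap.ker π)
    (ei : IsEquivariant ρ σ i) (eπ : IsEquivariant σ τ π) [Module.Projective k W]
    {θ : W →ₗ[k] W} (hθ : tr σ σ θ = LinearMap.id)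
    {hV : V →ₗ[k] V} {hW : W →ₗ[k] W} {hX : X →ₗ[k] X} (eW : IsEquivariant σ σ hW)
    (h₁ : i ∘ₗ hV = hW ∘ₗ i) (h₂ : π ∘ₗ hW = hX ∘ₗ π)
    {b : X →ₗ[k] X} (hb : hX = LinearMap.id + tr τ τ b) :
    ∃ a, hV = LinearMap.id + tr ρ ρ a := by
  have hpi : ∀ v, π (i v) = 0 := fun v => by
    have : i v ∈ LinearMap.ker π := hex ▸ LinearMap.mem_range_self i v
    simpa using this
  obtain ⟨b', hb'⟩ := Module.projective_lifting_property π (b ∘ₗ π) hπ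
  let e := LinearEquiv.ofInjective i hi
  have key : ∀ f : W →ₗ[k] W, (∀ v, π (f v) = 0) → ∃ f' : W →ₗ[k] V, i ∘ₗ f' = f := fun f hf =>
    ⟨e.symm.toLinearMap ∘ₗ f.codRestrict _ (fun v => by rw [hex]; exact hf v), by
      ext v
      simp only [LinearMap.coe_comp, Function.comp_apply]
      exact congrArg Subtype.val (e.apply_symm_apply _)⟩
  have key2 : ∀ f : V →ₗ[k] W, (∀ v, π (f v) = 0) → ∃ f' : V →ₗ[k] V, i ∘ₗ f' = f := fun f hf =>
    ⟨e.symm.toLinearMap ∘ₗ f.codRestrict _ (fun v => by rw [hex]; exact hf v), by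
      ext v
      simp only [LinearMap.coe_comp, Function.comp_apply]
      exact congrArg Subtype.val (e.apply_symm_apply _)⟩
  have hb'' : ∀ v, π (b' v) = b (π v) := fun v => congr($hb' v)
  -- Subtracting the trace of a lift of `b` kills the image in `X`, so the remainder is an
  -- equivariant map into `V`.
  obtain ⟨c, hc⟩ := key (hW - LinearMap.id - tr σ σ b') fun v => by
    have h3 : π (tr σ σ b' v) = tr τ τ b (π v) := by
      have := congr($(eπ.comp_tr (ρ := σ) b') v)
      rw [hb', ← eπ.tr_comp] at this
      exact this
    have h4 : π (hW v) = hX (π v) := congr($h₂ v)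
    simp [h3, h4, hb]
  obtain ⟨a₁, ha₁⟩ := key2 (b' ∘ₗ i) fun v => by simp [hb'', hpi]
  have ec : IsEquivariant σ ρ c := fun g v => hi <| by
    have e1 : IsEquivariant σ σ (i ∘ₗ c) := by
      rw [hc]
      exact (eW.sub .id).sub (isEquivariant_tr _)
    rw [ei]
    exact e1 g v
  -- `hV - 1` is the trace of `a₁` plus the equivariant map `c ∘ i`; inserting `tr θ = id` in the
  -- middle turns `c ∘ i` into the trace of `c ∘ θ ∘ i`.
  refine ⟨a₁ + c ∘ₗ θ ∘ₗ i, ?_⟩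
  have : i ∘ₗ hV = i ∘ₗ (LinearMap.id + tr ρ ρ (a₁ + c ∘ₗ θ ∘ₗ i)) := by
    rw [tr_add, LinearMap.comp_add, LinearMap.comp_add, ei.comp_tr, ha₁, ← ec.comp_tr,
      ← ei.tr_comp, ← ei.tr_comp, hθ, LinearMap.id_comp, ← LinearMap.comp_assoc, hc, h₁]
    ext v
    simp
  ext v
  exact hi congr($this v)

/-- Projectivity over `k` gives a linear lift `g`. The trace of `g ∘ θ` is equivariant, and it still
lifts because `tr θ = id`. -/
theorem exists_lift {i' : V' →ₗ[k] W'} {i : V →ₗ[k] W} {π : W →ₗ[k] X} {π' : W' →ₗ[k] X'}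
    (hi' : Function.Injective i')
    (hπ' : Function.Surjective π') (hex : LinearMap.range i = LinearMap.ker π)
    (hex' : LinearMap.range i' = LinearMap.ker π')
    (ei : IsEquivariant ρ σ i) (eπ : IsEquivariant σ τ π)
    (ei' : IsEquivariant ρ' σ' i') (eπ' : IsEquivariant σ' τ' π') [Module.Projective k W]
    {θ : W →ₗ[k] W} (hθ : tr σ σ θ = LinearMap.id)
    {f : X →ₗ[k] X'} (ef : IsEquivariant τ τ' f) :
    ∃ (fV : V →ₗ[k] V') (fW : W →ₗ[k] W'), IsEquivariant ρ ρ' fV ∧ IsEquivariant σ σ' fW ∧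
      i' ∘ₗ fV = fW ∘ₗ i ∧ π' ∘ₗ fW = f ∘ₗ π := by
  obtain ⟨g, hg⟩ := Module.projective_lifting_property π' (f ∘ₗ π) hπ'
  have h2 : π' ∘ₗ tr σ σ' (g ∘ₗ θ) = f ∘ₗ π := by
    rw [eπ'.comp_tr, ← LinearMap.comp_assoc, hg, ← (ef.comp eπ).comp_tr, hθ, LinearMap.comp_id]
  let e := LinearEquiv.ofInjective i' hi'
  have hmem : ∀ v, tr σ σ' (g ∘ₗ θ) (i v) ∈ LinearMap.range i' := fun v => by
    rw [hex', LinearMap.mem_ker]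
    have h3 : i v ∈ LinearMap.ker π := hex ▸ LinearMap.mem_range_self i v
    have h4 := congr($h2 (i v))
    simp only [LinearMap.coe_comp, Function.comp_apply] at h4
    rw [h4, LinearMap.mem_ker.1 h3, map_zero]
  have h1 : i' ∘ₗ (e.symm.toLinearMap ∘ₗ (tr σ σ' (g ∘ₗ θ) ∘ₗ i).codRestrict _ hmem) =
      tr σ σ' (g ∘ₗ θ) ∘ₗ i := by
    ext v
    simp only [LinearMap.coe_comp, Function.comp_apply]
    exact congrArg Subtype.val (e.apply_symm_apply _)
  refine ⟨_, tr σ σ' (g ∘ₗ θ), fun a v => hi' ?_, isEquivariant_tr _, h1, h2⟩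
  have e1 : IsEquivariant ρ σ' (tr σ σ' (g ∘ₗ θ) ∘ₗ i) := (isEquivariant_tr _).comp ei
  rw [← h1] at e1
  rw [ei']
  exact e1 a v

/-- A stable form of Schanuel's lemma. -/
theorem StablyEquiv.of_shortExact (h : StablyEquiv τ τ')
    {i : V →ₗ[k] W} {π : W →ₗ[k] X} (hi : Function.Injective i)
    (hπ : Function.Surjective π) (hex : LinearMap.range i = LinearMap.ker π)
    (ei : IsEquivariant ρ σ i) (eπ : IsEquivariant σ τ π) [Module.Projective k W]
    {θ : W →ₗ[k] W} (hθ : tr σ σ θ = LinearMap.id)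
    {i' : V' →ₗ[k] W'} {π' : W' →ₗ[k] X'} (hi' : Function.Injective i')
    (hπ' : Function.Surjective π') (hex' : LinearMap.range i' = LinearMap.ker π')
    (ei' : IsEquivariant ρ' σ' i') (eπ' : IsEquivariant σ' τ' π') [Module.Projective k W']
    {θ' : W' →ₗ[k] W'} (hθ' : tr σ' σ' θ' = LinearMap.id) : StablyEquiv ρ ρ' := by
  obtain ⟨f, g, a, b, hf, hg, hgf, hfg⟩ := h
  obtain ⟨fV, fW, efV, efW, hf1, hf2⟩ := exists_lift hi' hπ' hex hex' ei eπ ei' eπ' hθ hf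
  obtain ⟨gV, gW, egV, egW, hg1, hg2⟩ := exists_lift hi hπ hex' hex ei' eπ' ei eπ hθ' hg
  obtain ⟨a', ha'⟩ := exists_eq_id_add_tr (hV := gV ∘ₗ fV) hi hπ hex ei eπ hθ (egW.comp efW)
    (by rw [← LinearMap.comp_assoc, hg1, LinearMap.comp_assoc, hf1, LinearMap.comp_assoc])
    (by rw [← LinearMap.comp_assoc, hg2, LinearMap.comp_assoc, hf2, LinearMap.comp_assoc]) hgf
  obtain ⟨b', hb'⟩ := exists_eq_id_add_tr (hV := fV ∘ₗ gV) hi' hπ' hex' ei' eπ' hθ' (efW.comp egW)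
    (by rw [← LinearMap.comp_assoc, hf1, LinearMap.comp_assoc, hg1, LinearMap.comp_assoc])
    (by rw [← LinearMap.comp_assoc, hf2, LinearMap.comp_assoc, hg2, LinearMap.comp_assoc]) hfg
  exact ⟨fV, gV, a', b', efV, egV, ha', hb'⟩

end AddCommGroup

-- The weight is the indicator function of a set of orbit representatives: on a free orbit exactly
-- one translate meets it. Multiplication by such a weight is the standard source of maps `θ` with
-- `tr θ = id`.
open scoped Classical in
theorem exists_weight (k : Type*) [CommRing k] (H B : Type*) [Group H] [Finite H] [MulAction H B] :
    ∃ c : B → k, ∀ b, (∀ h : H, h • b = b → h = 1) → ∑ h : H, c (h⁻¹ • b) = 1 := by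
  let r : B → B := fun b => (Quotient.mk (MulAction.orbitRel H B) b).out
  refine ⟨fun b => if b = r b then 1 else 0, fun b hb => ?_⟩
  have hr : ∀ h : H, r (h⁻¹ • b) = r b := fun h =>
    congrArg Quotient.out (Quotient.sound (MulAction.mem_orbit b h⁻¹))
  obtain ⟨h₀, hh₀⟩ : ∃ h : H, h • b = r b :=
    Quotient.exact (s := MulAction.orbitRel H B) (Quotient.out_eq _)
  rw [Finset.sum_eq_single h₀⁻¹]
  · have hrr := hr h₀⁻¹
    rw [inv_inv, hh₀] at hrr
    simp [hh₀, hrr]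
  · intro h _ hne
    refine if_neg fun heq => ?_
    rw [hr, ← hh₀, ← inv_smul_eq_iff, smul_smul] at heq
    have := hb _ heq
    apply hne
    rw [mul_eq_one_iff_eq_inv, inv_eq_iff_eq_inv, inv_inv] at this
    rw [this, inv_inv]
  · simp

/-! ### Function representations and the augmentation ideal. -/

variable {k G V W X : Type*} [CommRing k] [Group G]
  [AddCommGroup V] [Module k V] [AddCommGroup W] [Module k W]
  (ρ : Representation k G V) (σ : Representation k G W)

/-- The representation on functions from a `G`-set to a representation. -/
def funRep (B : Type*) [MulAction G B] : Representation k G (B → V) where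
  toFun g := { toFun := fun f x => ρ g (f (g⁻¹ • x))
               map_add' := fun _ _ => by ext; simp
               map_smul' := fun _ _ => by ext; simp }
  map_one' := by ext; simp
  map_mul' g h := by
    ext f x
    simp [mul_smul]

@[simp] theorem funRep_apply (B : Type*) [MulAction G B] (g : G) (f : B → V) (x : B) :
    funRep ρ B g f x = ρ g (f (g⁻¹ • x)) := rfl

/-- `H` acts freely on `G` by translation through the injection `φ`, so multiplication by a weight
for this action serves as `θ`. -/
theorem tr_funRep_comp [Finite G] {H : Type*} [Group H] [Finite H] {φ : H →* G}
    (hφ : Function.Injective φ) : ∃ θ : (G → V) →ₗ[k] (G → V),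
      tr ((funRep ρ G).comp φ) ((funRep ρ G).comp φ) θ = LinearMap.id := by
  let _ := MulAction.compHom G φ
  obtain ⟨c, hc⟩ := exists_weight k H G
  refine ⟨LinearMap.pi fun x => c x • LinearMap.proj x, ?_⟩
  refine LinearMap.ext fun f => funext fun x => ?_
  have h1 : ∀ h : H, h • x = φ h * x := fun h => rfl
  have h2 := hc x fun h hh => hφ (by simpa [h1] using hh)
  have h3 : ∀ h : H, h⁻¹ • x = (φ h)⁻¹ * x := fun h => by rw [← map_inv]; rfl
  simp only [h3] at h2
  rw [tr_apply, Finset.sum_apply, LinearMap.id_apply, ← one_smul k (f x), ← h2, Finset.sum_smul]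
  exact Finset.sum_congr rfl fun h _ => by simp

variable (k G) in
/-- The functions on a finite group with vanishing sum. -/
def aug [Finite G] : Submodule k (G → k) := LinearMap.ker (∑ g, LinearMap.proj g)

theorem mem_aug [Finite G] {f : G → k} : f ∈ aug k G ↔ ∑ g, f g = 0 := by
  simp [aug, LinearMap.sum_apply]

variable (k G) in
/-- The augmentation ideal of a finite group as a representation. -/
def augRep [Finite G] : Representation k G (aug k G) :=
  ((funRep (trivial k G k) G).subrepresentation (aug k G) fun g f hf => by
    rw [Submodule.mem_comap, mem_aug]
    rw [mem_aug] at hf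
    simpa using (Equiv.sum_comp (Equiv.mulLeft g⁻¹) f).trans hf)

variable [Finite G]

theorem augRep_apply (g : G) (f : aug k G) (x : G) :
    (augRep k G g f : G → k) x = (f : G → k) (g⁻¹ * x) := rfl

section

variable {k B V : Type*} [CommRing k] [Finite B] [AddCommGroup V] [Module k V]

variable (k B V) in
/-- The sum of the values of a function. -/
def sumMap : (B → V) →ₗ[k] V := ∑ g, LinearMap.proj g

@[simp] theorem sumMap_apply (f : B → V) : sumMap k B V f = ∑ g, f g := by
  simp [sumMap, LinearMap.sum_apply]

theorem sumMap_surjective [Nonempty B] : Function.Surjective (sumMap k B V) := fun v => by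
  classical exact ⟨Pi.single (Classical.arbitrary B) v, by simp⟩

theorem isEquivariant_sumMap {G : Type*} [Group G] [MulAction G B] (ρ : Representation k G V) :
    IsEquivariant (funRep ρ B) ρ (sumMap k B V) := fun g f => by
  simpa [map_sum] using Equiv.sum_comp (MulAction.toPerm g⁻¹) fun x => ρ g (f x)

end

variable (k G V) in
/-- The natural embedding of the tensor product with the augmentation ideal. -/
def augEmb : aug k G ⊗[k] V →ₗ[k] (G → V) :=
  TensorProduct.lift
    { toFun := fun i => LinearMap.pi fun x => (i : G → k) x • LinearMap.id
      map_add' := fun _ _ => by ext; simp [add_smul]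
      map_smul' := fun _ _ => by ext; simp [mul_smul] }

@[simp] theorem augEmb_tmul (i : aug k G) (v : V) (x : G) :
    augEmb k G V (i ⊗ₜ v) x = (i : G → k) x • v := rfl

theorem isEquivariant_augEmb :
    IsEquivariant (tprod (augRep k G) ρ) (funRep ρ G) (augEmb k G V) := fun g v => by
  ext x
  induction v with
  | zero => simp
  | tmul i v => simp [augRep_apply]
  | add x y hx hy => simp_all

open scoped Classical in
variable (k G V) in
/-- A linear left inverse of `augEmb`. -/
def augProj : (G → V) →ₗ[k] aug k G ⊗[k] V :=
  ∑ x, TensorProduct.mk k _ V ⟨Pi.single x 1 - Pi.single 1 1, by simp [mem_aug]⟩ ∘ₗ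
    LinearMap.proj x

/-- An element of the augmentation ideal is the combination of the functions `δ_x - δ_1` with its
own values as coefficients; the `δ_1` terms cancel because the values sum to zero. -/
theorem augProj_augEmb (v : aug k G ⊗[k] V) : augProj k G V (augEmb k G V v) = v := by
  classical
  induction v with
  | zero => simp
  | tmul i v =>
    simp only [augProj, LinearMap.sum_apply, LinearMap.coe_comp, Function.comp_apply,
      LinearMap.proj_apply, augEmb_tmul, TensorProduct.mk_apply, ← TensorProduct.smul_tmul]
    rw [← TensorProduct.sum_tmul]
    congr 1
    ext y
    have := mem_aug.1 i.2
    simp [Finset.sum_apply, Pi.single_apply, mul_sub, Finset.sum_sub_distrib, this]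
  | add x y hx hy => simp_all

theorem augEmb_augProj {f : G → V} (hf : ∑ g, f g = 0) : augEmb k G V (augProj k G V f) = f := by
  classical
  ext y
  simp [augProj, LinearMap.sum_apply, Finset.sum_apply, Pi.single_apply, sub_smul,
    Finset.sum_sub_distrib, hf, ite_smul]

theorem augEmb_injective : Function.Injective (augEmb k G V) :=
  Function.LeftInverse.injective augProj_augEmb

theorem range_augEmb : LinearMap.range (augEmb k G V) = LinearMap.ker (sumMap k G V) := by
  ext f
  rw [LinearMap.mem_ker, sumMap_apply]
  refine ⟨?_, fun hf => ⟨_, augEmb_augProj hf⟩⟩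
  rintro ⟨v, rfl⟩
  induction v with
  | zero => simp
  | tmul i v => simp [← Finset.sum_smul, mem_aug.1 i.2]
  | add x y hx hy => simp_all [Finset.sum_add_distrib]

theorem projective_aug : Module.Projective k (aug k G) := by
  refine Module.Projective.of_split (P := aug k G) (M := G → k)
    (augEmb k G k ∘ₗ (_root_.TensorProduct.rid k (aug k G)).symm.toLinearMap)
    ((_root_.TensorProduct.rid k (aug k G)).toLinearMap ∘ₗ augProj k G k) ?_
  ext1 i
  simp [augProj_augEmb]

instance : Module.Projective k (aug k G) := projective_aug

instance {ι : Type*} [Finite ι] [Module.Projective k V] : Module.Projective k (ι → V) := by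
  classical
  exact .of_equiv (DFinsupp.linearEquivFunOnFintype (R := k) (M := fun _ : ι => V))

/-! ### Difference operators of a permutation transitive on fibres. -/

section Difference

variable {k Y : Type*} [CommRing k] [Finite Y] (σ : Equiv.Perm Y)

variable (k) in
/-- The difference operator of a permutation, on functions. -/
def diffMap : (Y → k) →ₗ[k] (Y → k) := LinearMap.funLeft k k σ.symm - LinearMap.id

@[simp] theorem diffMap_apply (f : Y → k) (x : Y) : diffMap k σ f x = f (σ.symm x) - f x := rfl

/-- Each `δ_{σⁿ y} - δ_y` telescopes into differences, and on a fibre where the values of `f` sum to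
zero, `f` is a combination of functions `δ_x - δ_{x₀}` with `x` and `x₀` in that fibre. -/
theorem exists_diffMap_eq {β : Type*} {π : Y → β}
    (hσ : ∀ x y, π x = π y → ∃ n : ℕ, (σ ^ n) x = y) (b : β) {f : Y → k}
    (hf : ∀ [DecidableEq β], ∑ x with π x = b, f x = 0) :
    ∃ h : Y → k, ∀ x, π x = b → diffMap k σ h x = f x := by
  classical
  have h1 : ∀ (n : ℕ) (y : Y), Pi.single ((σ ^ n) y) 1 - Pi.single y 1 ∈
      LinearMap.range (diffMap k σ) := by
    intro n
    induction n with
    | zero => simp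
    | succ n ih =>
      intro y
      have h2 : Pi.single ((σ ^ (n + 1)) y) 1 - Pi.single ((σ ^ n) y) 1 ∈
          LinearMap.range (diffMap k σ) := by
        refine ⟨Pi.single ((σ ^ n) y) 1, ?_⟩
        ext x
        simp [Pi.single_apply, pow_succ', Equiv.symm_apply_eq]
      convert add_mem h2 (ih y) using 1
      abel
  by_cases hb : ∃ x₀, π x₀ = b
  · obtain ⟨x₀, hx₀⟩ := hb
    have h3 : (∑ x with π x = b, f x • (Pi.single x 1 - Pi.single x₀ 1 : Y → k)) ∈
        LinearMap.range (diffMap k σ) := by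
      refine sum_mem fun x hx => Submodule.smul_mem _ _ ?_
      obtain ⟨n, rfl⟩ := hσ x₀ x (by simp_all)
      exact h1 n x₀
    obtain ⟨h, hh⟩ := h3
    refine ⟨h, fun x hx => ?_⟩
    have h0 : ∑ x with π x = b, f x = 0 := hf
    rw [hh]
    simp [Finset.sum_apply, mul_sub, Finset.sum_sub_distrib, h0,
      Pi.single_apply, hx]
  · exact ⟨0, fun x hx => absurd ⟨x, hx⟩ hb⟩

theorem eq_of_diffMap_eq_zero {β : Type*} {π : Y → β}
    (hσ : ∀ x y, π x = π y → ∃ n : ℕ, (σ ^ n) x = y) {b : β} (hπ : ∀ x, π (σ x) = π x) {h : Y → k}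
    (hh : ∀ x, π x = b → diffMap k σ h x = 0) {x y : Y} (hx : π x = b) (hy : π y = b) :
    h x = h y := by
  obtain ⟨n, rfl⟩ := hσ x y (hx.trans hy.symm)
  clear hy
  induction n with
  | zero => simp
  | succ n ih =>
    have h1 : ∀ m : ℕ, π ((σ ^ m) x) = b := fun m => by
      induction m with
      | zero => simpa
      | succ m ih => rw [pow_succ', Equiv.Perm.mul_apply, hπ, ih]
    have h2 := hh _ (h1 (n + 1))
    rw [ih]
    simpa [pow_succ', sub_eq_zero] using h2

end Difference

/-! ### Stable periodicity from exact complexes. -/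

variable {k G V W X : Type*} [CommRing k] [Group G] [Finite G]
  [AddCommGroup V] [Module k V] [AddCommGroup W] [Module k W] [AddCommGroup X] [Module k X]

/-- Schanuel's lemma compares the given cover of `X` with the standard cover of `V` by functions on
`G`, whose kernel is `aug k G ⊗ V`. Each step of a resolution over `H` thus costs one factor of the
augmentation ideal of `G`. -/
theorem StablyEquiv.augRep_tprod {H U P X : Type*} [Group H] [Finite H] {φ : H →* G}
    (hφ : Function.Injective φ) {ρ : Representation k G V} [Module.Projective k V]
    [AddCommGroup U] [Module k U] [AddCommGroup P] [Module k P] [AddCommGroup X] [Module k X]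
    {υ : Representation k H U} {σ : Representation k H P} {τ : Representation k H X}
    (h : StablyEquiv τ (ρ.comp φ)) {i : U →ₗ[k] P} {π : P →ₗ[k] X} (hi : Function.Injective i)
    (hπ : Function.Surjective π) (hex : LinearMap.range i = LinearMap.ker π)
    (ei : IsEquivariant υ σ i) (eπ : IsEquivariant σ τ π) [Module.Projective k P]
    {θ : P →ₗ[k] P} (hθ : tr σ σ θ = LinearMap.id) :
    StablyEquiv υ ((tprod (augRep k G) ρ).comp φ) := by
  obtain ⟨θ', hθ'⟩ := tr_funRep_comp ρ hφ
  exact h.of_shortExact (V' := aug k G ⊗[k] V) hi hπ hex ei eπ hθ augEmb_injective sumMap_surjective range_augEmb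
    ((isEquivariant_augEmb ρ).comp_hom φ) ((isEquivariant_sumMap ρ).comp_hom φ) hθ'

/-- The kernel of an equivariant map as a representation. -/
def kerRep {ρ : Representation k G V} {σ : Representation k G W} {f : V →ₗ[k] W}
    (hf : IsEquivariant ρ σ f) : Representation k G (LinearMap.ker f) :=
  ρ.subrepresentation (LinearMap.ker f) fun g v hv => by
    rw [Submodule.mem_comap, LinearMap.mem_ker, hf, LinearMap.mem_ker.1 hv, map_zero]

theorem isEquivariant_kerRep {ρ : Representation k G V} {σ : Representation k G W} {f : V →ₗ[k] W}
    (hf : IsEquivariant ρ σ f) : IsEquivariant (kerRep hf) ρ (LinearMap.ker f).subtype :=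
  fun _ _ => rfl

theorem isEquivariant_codRestrict {ρ : Representation k G V} {σ : Representation k G W}
    {τ : Representation k G X} {f : V →ₗ[k] W}
    (hf : IsEquivariant ρ σ f) {f' : X →ₗ[k] V} (hf' : IsEquivariant τ ρ f')
    (h : ∀ x, f' x ∈ LinearMap.ker f) :
    IsEquivariant τ (kerRep hf) (f'.codRestrict _ h) :=
  fun g x => Subtype.ext (hf' g x)

theorem surjective_codRestrict {f : V →ₗ[k] W} {f' : X →ₗ[k] V}
    (hex : LinearMap.range f' = LinearMap.ker f) (h : ∀ x, f' x ∈ LinearMap.ker f) :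
    Function.Surjective (f'.codRestrict _ h) := fun ⟨v, hv⟩ => by
  obtain ⟨x, rfl⟩ := hex.symm ▸ hv
  exact ⟨x, rfl⟩

/-- A finite cyclic group is stably two-periodic. -/
theorem stablyEquiv_of_isCyclic {H : Type*} [Group H] [Finite H] [IsCyclic H] {φ : H →* G}
    (hφ : Function.Injective φ) :
    StablyEquiv (trivial k H k)
      ((tprod (augRep k G) (tprod (augRep k G) (trivial k G k))).comp φ) := by
  have hid : Function.Injective (MonoidHom.id H) := Function.injective_id
  obtain ⟨θ, hθ⟩ := tr_funRep_comp (trivial k H k) hid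
  obtain ⟨s, hs⟩ := IsCyclic.exists_generator (α := H)
  let P := funRep (trivial k H k) H
  have e₀ : IsEquivariant P (trivial k H k) (sumMap k H k) := isEquivariant_sumMap _
  have h₁ : StablyEquiv (kerRep e₀) ((tprod (augRep k G) (trivial k G k)).comp φ) :=
    (StablyEquiv.refl (ρ := trivial k H k)).augRep_tprod (θ := θ) hφ
      (ρ := trivial k G k) (LinearMap.ker _).injective_subtype
      sumMap_surjective (Submodule.range_subtype _) (isEquivariant_kerRep e₀) e₀ hθ
  -- The difference operator of translation by a generator is the middle map of `0 → k → k[H] → k[H]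
  -- → k → 0`.
  let σ : Equiv.Perm H := Equiv.mulLeft s
  have hσn : ∀ (n : ℕ) x, (σ ^ n) x = s ^ n * x := fun n x => by
    induction n with
    | zero => simp
    | succ n ih => rw [pow_succ', Equiv.Perm.mul_apply, ih, pow_succ', mul_assoc]; rfl
  have hσ : ∀ x y : H, () = () → ∃ n : ℕ, (σ ^ n) x = y := fun x y _ => by
    obtain ⟨n, hn⟩ := (mem_powers_iff_mem_zpowers.2 (hs (y * x⁻¹)) : _)
    exact ⟨n, by rw [hσn]; simp only at hn; rw [hn]; simp⟩
  have ed : IsEquivariant P P (diffMap k σ) := fun g f => by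
    ext x
    have h2 : g⁻¹ * (s⁻¹ * x) = s⁻¹ * (g⁻¹ * x) := by
      rw [← mul_assoc, mul_comm' g⁻¹, mul_assoc]
    simp [P, σ, h2]
  have hmem : ∀ f, diffMap k σ f ∈ LinearMap.ker (sumMap k H k) := fun f => by
    simpa [sub_eq_zero] using Equiv.sum_comp σ.symm f
  have hex : LinearMap.range (diffMap k σ) = LinearMap.ker (sumMap k H k) := by
    refine le_antisymm ?_ fun f hf => ?_
    · rintro _ ⟨f, rfl⟩
      exact hmem f
    · obtain ⟨h, hh⟩ := exists_diffMap_eq (π := fun _ : H => ()) σ hσ () (f := f)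
        (by simpa using hf)
      exact ⟨h, funext fun x => hh x rfl⟩
  let c : k →ₗ[k] (H → k) := LinearMap.pi fun _ => LinearMap.id
  refine h₁.augRep_tprod (V := aug k G ⊗[k] k) (θ := θ) (υ := trivial k H k) hφ (i := c) (fun a b hab => congrFun hab 1)
    (surjective_codRestrict hex hmem) ?_ (fun _ _ => rfl) (isEquivariant_codRestrict e₀ ed hmem) hθ
  rw [LinearMap.ker_codRestrict]
  refine le_antisymm ?_ fun f hf => ⟨f 1, funext fun x => ?_⟩
  · rintro _ ⟨f, rfl⟩
    ext
    simp [c]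
  · exact eq_of_diffMap_eq_zero (π := fun _ : H => ()) σ hσ (b := ()) (fun _ => rfl)
      (fun x _ => congrFun (LinearMap.mem_ker.1 hf) x) rfl rfl

/-- A finite group with an exact complex of relatively projective representations starting and
ending in the trivial representation is stably four-periodic. -/
theorem stablyEquiv_of_exact {H : Type*} [Group H] [Finite H] {φ : H →* G}
    (hφ : Function.Injective φ) {P₀ P₁ P₂ P₃ : Type*} [AddCommGroup P₀] [Module k P₀]
    [AddCommGroup P₁] [Module k P₁] [AddCommGroup P₂] [Module k P₂] [AddCommGroup P₃] [Module k P₃]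
    [Module.Projective k P₀] [Module.Projective k P₁] [Module.Projective k P₂]
    [Module.Projective k P₃]
    {σ₀ : Representation k H P₀} {σ₁ : Representation k H P₁} {σ₂ : Representation k H P₂}
    {σ₃ : Representation k H P₃} {d₀ : P₀ →ₗ[k] k} {d₁ : P₁ →ₗ[k] P₀} {d₂ : P₂ →ₗ[k] P₁}
    {d₃ : P₃ →ₗ[k] P₂} {d₄ : k →ₗ[k] P₃} (e₀ : IsEquivariant σ₀ (trivial k H k) d₀)
    (e₁ : IsEquivariant σ₁ σ₀ d₁) (e₂ : IsEquivariant σ₂ σ₁ d₂) (e₃ : IsEquivariant σ₃ σ₂ d₃)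
    (e₄ : IsEquivariant (trivial k H k) σ₃ d₄)
    (x₀ : Function.Surjective d₀) (x₁ : LinearMap.range d₁ = LinearMap.ker d₀)
    (x₂ : LinearMap.range d₂ = LinearMap.ker d₁) (x₃ : LinearMap.range d₃ = LinearMap.ker d₂)
    (x₄ : LinearMap.range d₄ = LinearMap.ker d₃) (x₅ : Function.Injective d₄)
    (t₀ : ∃ θ, tr σ₀ σ₀ θ = LinearMap.id) (t₁ : ∃ θ, tr σ₁ σ₁ θ = LinearMap.id)
    (t₂ : ∃ θ, tr σ₂ σ₂ θ = LinearMap.id) (t₃ : ∃ θ, tr σ₃ σ₃ θ = LinearMap.id) :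
    StablyEquiv (trivial k H k)
      ((tprod (augRep k G) (tprod (augRep k G) (tprod (augRep k G) (tprod (augRep k G)
        (trivial k G k))))).comp φ) := by
  obtain ⟨θ₀, hθ₀⟩ := t₀
  obtain ⟨θ₁, hθ₁⟩ := t₁
  obtain ⟨θ₂, hθ₂⟩ := t₂
  obtain ⟨θ₃, hθ₃⟩ := t₃
  have m₁ : ∀ x, d₁ x ∈ LinearMap.ker d₀ := fun x => x₁ ▸ LinearMap.mem_range_self d₁ x
  have m₂ : ∀ x, d₂ x ∈ LinearMap.ker d₁ := fun x => x₂ ▸ LinearMap.mem_range_self d₂ x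
  have m₃ : ∀ x, d₃ x ∈ LinearMap.ker d₂ := fun x => x₃ ▸ LinearMap.mem_range_self d₃ x
  -- The complex is cut at its kernels, one Schanuel step per piece; the last kernel is the trivial
  -- representation through `d₄`.
  have s₁ := (StablyEquiv.refl (ρ := trivial k H k)).augRep_tprod (θ := θ₀) hφ
    (ρ := trivial k G k) (LinearMap.ker _).injective_subtype x₀ (Submodule.range_subtype _)
    (isEquivariant_kerRep e₀) e₀ hθ₀
  have s₂ := s₁.augRep_tprod (V := aug k G ⊗[k] k) (θ := θ₁) hφ (LinearMap.ker _).injective_subtype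
    (surjective_codRestrict x₁ m₁)
    (by rw [Submodule.range_subtype, LinearMap.ker_codRestrict]) (isEquivariant_kerRep e₁)
    (isEquivariant_codRestrict e₀ e₁ m₁) hθ₁
  have s₃ := s₂.augRep_tprod (V := aug k G ⊗[k] (aug k G ⊗[k] k)) (θ := θ₂) hφ (LinearMap.ker _).injective_subtype
    (surjective_codRestrict x₂ m₂)
    (by rw [Submodule.range_subtype, LinearMap.ker_codRestrict]) (isEquivariant_kerRep e₂)
    (isEquivariant_codRestrict e₁ e₂ m₂) hθ₂
  exact s₃.augRep_tprod (V := aug k G ⊗[k] (aug k G ⊗[k] (aug k G ⊗[k] k))) (θ := θ₃) hφ x₅ (surjective_codRestrict x₃ m₃)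
    (by rw [x₄, LinearMap.ker_codRestrict]) e₄ (isEquivariant_codRestrict e₂ e₃ m₃) hθ₃

/-! ### Cellular chains of the join of two circles; `alt` and `sym` record the orientation signs of
vertex-vertex and edge-edge cells. -/

namespace Join

section Exactness

variable {k Y : Type*} [CommRing k] [Finite Y] {π : Y → Bool} {σ : Equiv.Perm Y}

theorem sum_diffMap (hπ : ∀ x, π (σ x) = π x) (h : Y → k) (b : Bool) :
    ∑ x with π x = b, diffMap k σ h x = 0 := by
  have : ∑ x with π x = b, h (σ.symm x) = ∑ x with π x = b, h x := by
    rw [Finset.sum_filter, Finset.sum_filter, ← Equiv.sum_comp σ]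
    simp [hπ]
  simp [this]

variable (k π) in
/-- Functions on pairs of points in different fibres. -/
def cross : Submodule k (Y × Y → k) where
  carrier := {u | ∀ x y, π x = π y → u (x, y) = 0}
  add_mem' ha hb x y h := by simp [ha x y h, hb x y h]
  zero_mem' := by simp
  smul_mem' c u h x y hxy := by simp [h x y hxy]

variable (k π) in
/-- Symmetric functions on pairs of points in different fibres. -/
def sym : Submodule k (Y × Y → k) where
  carrier := {u | u ∈ cross k π ∧ ∀ x y, u (y, x) = u (x, y)}
  add_mem' ha hb := ⟨add_mem ha.1 hb.1, fun x y => by simp [ha.2 x y, hb.2 x y]⟩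
  zero_mem' := ⟨zero_mem _, by simp⟩
  smul_mem' c u h := ⟨Submodule.smul_mem _ _ h.1, fun x y => by simp [h.2 x y]⟩

variable (k π) in
/-- Antisymmetric functions on pairs of points in different fibres. -/
def alt : Submodule k (Y × Y → k) where
  carrier := {u | u ∈ cross k π ∧ ∀ x y, u (y, x) = - u (x, y)}
  add_mem' ha hb := ⟨add_mem ha.1 hb.1, fun x y => by simp [ha.2 x y, hb.2 x y]; ring⟩
  zero_mem' := ⟨zero_mem _, by simp⟩
  smul_mem' c u h := ⟨Submodule.smul_mem _ _ h.1, fun x y => by simp [h.2 x y]⟩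

/-- Summation over the second variable. -/
def sumRight (k Y : Type*) [CommRing k] [Finite Y] : (Y × Y → k) →ₗ[k] (Y → k) :=
  LinearMap.pi fun x => ∑ y, LinearMap.proj (x, y)

@[simp] theorem sumRight_apply (u : Y × Y → k) (x : Y) : sumRight k Y u x = ∑ y, u (x, y) := by
  simp [sumRight, LinearMap.sum_apply]

variable (k σ) in
/-- The difference operator in the first variable. -/
def diffLeft : (Y × Y → k) →ₗ[k] (Y × Y → k) := diffMap k (σ.prodCongr 1)

@[simp] theorem diffLeft_apply (u : Y × Y → k) (x y : Y) :
    diffLeft k σ u (x, y) = u (σ.symm x, y) - u (x, y) := rfl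

variable (k σ) in
/-- The difference operator in the second variable. -/
def diffRight : (Y × Y → k) →ₗ[k] (Y × Y → k) := diffMap k (Equiv.prodCongr 1 σ)

@[simp] theorem diffRight_apply (u : Y × Y → k) (x y : Y) :
    diffRight k σ u (x, y) = u (x, σ.symm y) - u (x, y) := rfl

/-- Exchange of the two variables. -/
def swapMap (k Y : Type*) [CommRing k] : (Y × Y → k) →ₗ[k] (Y × Y → k) := LinearMap.funLeft k k Prod.swap

@[simp] theorem swapMap_apply (u : Y × Y → k) (x y : Y) : swapMap k Y u (x, y) = u (y, x) := rfl

theorem symm_fibre (hπ : ∀ x, π (σ x) = π x) (x : Y) : π (σ.symm x) = π x := by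
  rw [← hπ, _root_.Equiv.apply_symm_apply]

theorem diffLeft_mem (hπ : ∀ x, π (σ x) = π x) {u : Y × Y → k} (hu : u ∈ cross k π) :
    diffLeft k σ u ∈ cross k π := fun x y h => by
  simp [hu x y h, hu (σ.symm x) y (by rw [symm_fibre hπ, h])]

theorem diffRight_mem (hπ : ∀ x, π (σ x) = π x) {u : Y × Y → k} (hu : u ∈ cross k π) :
    diffRight k σ u ∈ cross k π := fun x y h => by
  simp [hu x y h, hu x (σ.symm y) (by rw [symm_fibre hπ, h])]

/-- The boundary from three-cells to two-cells. -/
def d₃ (k : Type*) [CommRing k] (hπ : ∀ x, π (σ x) = π x) : sym k π →ₗ[k] cross k π :=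
  (diffRight k σ ∘ₗ (sym k π).subtype).codRestrict _ fun u => diffRight_mem hπ u.2.1

/-- The boundary from two-cells to one-cells. -/
def d₂ (k : Type*) [CommRing k] (hπ : ∀ x, π (σ x) = π x) : cross k π →ₗ[k] (Y → k) × alt k π :=
  (sumRight k Y ∘ₗ (cross k π).subtype).prod
    (((diffLeft k σ - swapMap k Y ∘ₗ diffLeft k σ) ∘ₗ (cross k π).subtype).codRestrict _ fun u =>
      ⟨sub_mem (diffLeft_mem hπ u.2) fun x y h => diffLeft_mem hπ u.2 y x h.symm,
        fun x y => by simp⟩)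

variable (k π σ) in
/-- The boundary from one-cells to zero-cells. -/
def d₁ : (Y → k) × alt k π →ₗ[k] (Y → k) :=
  (diffMap k σ).coprod (-(sumRight k Y ∘ₗ (alt k π).subtype))

theorem d₃_apply (hπ : ∀ x, π (σ x) = π x) (u : sym k π) (x y : Y) :
    (d₃ k hπ u : Y × Y → k) (x, y) = u.1 (x, σ.symm y) - u.1 (x, y) := rfl

theorem d₂_apply_fst (hπ : ∀ x, π (σ x) = π x) (u : cross k π) (x : Y) :
    (d₂ k hπ u).1 x = ∑ y, u.1 (x, y) := by simp [d₂]

theorem d₂_apply_snd (hπ : ∀ x, π (σ x) = π x) (u : cross k π) (x y : Y) :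
    (d₂ k hπ u).2.1 (x, y) =
      (u.1 (σ.symm x, y) - u.1 (x, y)) - (u.1 (σ.symm y, x) - u.1 (y, x)) := rfl

theorem d₁_apply (p : (Y → k) × alt k π) (x : Y) :
    d₁ k π σ p x = p.1 (σ.symm x) - p.1 x - ∑ y, p.2.1 (x, y) := by
  simp [d₁, sub_eq_add_neg]

variable (hπ : ∀ x, π (σ x) = π x) (hσ : ∀ x y, π x = π y → ∃ n : ℕ, (σ ^ n) x = y)

/-- Every function with the right vanishing fibre sums is a difference. -/
theorem exists_diff (hσ : ∀ x y, π x = π y → ∃ n : ℕ, (σ ^ n) x = y) (b : Bool) {f : Y → k}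
    (hf : ∑ x with π x = b, f x = 0) :
    ∃ h : Y → k, ∀ x, π x = b → h (σ.symm x) - h x = f x :=
  exists_diffMap_eq σ hσ b (by intro _; convert hf)

theorem sum_filter_cross {u : Y × Y → k} (hu : u ∈ cross k π) {x : Y} {b : Bool} (hx : π x = !b) :
    ∑ y with π y = b, u (x, y) = ∑ y, u (x, y) := by
  rw [Finset.sum_filter]
  refine Finset.sum_congr rfl fun y _ => ?_
  split_ifs with h
  · rfl
  · exact (hu x y (by rw [hx]; revert h; cases π y <;> cases b <;> simp)).symm

-- Exactness at the vertices `Y`. The edge labelled `x` of a circle runs from `x` to `σ x`, so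
-- circle edges account for functions with zero sum on each circle; one joining edge `x₀ y₀` moves
-- mass between the circles.
include hπ hσ in
theorem range_d₁ [IsDomain k] [CharZero k] {x₀ y₀ : Y} (hx₀ : π x₀ = true) (hy₀ : π y₀ = false) :
    LinearMap.range (d₁ k π σ) = LinearMap.ker (sumMap k Y k) := by
  classical
  refine le_antisymm ?_ fun f hf => ?_
  · rintro _ ⟨⟨a, κ⟩, rfl⟩
    rw [LinearMap.mem_ker, sumMap_apply]
    simp only [d₁_apply, Finset.sum_sub_distrib]
    have h1 : ∑ x, ∑ y, κ.1 (x, y) = 0 := by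
      have : ∑ x, ∑ y, κ.1 (x, y) = -∑ x, ∑ y, κ.1 (x, y) := by
        conv_lhs => rw [Finset.sum_comm]
        rw [← Finset.sum_neg_distrib]
        refine Finset.sum_congr rfl fun x _ => ?_
        rw [← Finset.sum_neg_distrib]
        exact Finset.sum_congr rfl fun y _ => κ.2.2 x y
      exact self_eq_neg.1 this
    rw [h1, Equiv.sum_comp σ.symm a]
    simp
  · rw [LinearMap.mem_ker, sumMap_apply] at hf
    -- `e` is the multiple of `δ_{x₀} - δ_{y₀}` for which `f + e` has zero sum on both circles.
    let c : k := -∑ x with π x = true, f x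
    let e : Y → k := fun x => c * ((Pi.single x₀ 1 : Y → k) x - (Pi.single y₀ 1 : Y → k) x)
    have hne : x₀ ≠ y₀ := fun h => by simp [h, hy₀] at hx₀
    have hsplit : ∑ x, f x = ∑ x with π x = true, f x + ∑ x with π x = false, f x := by
      rw [← Finset.sum_filter_add_sum_filter_not Finset.univ (fun x => π x = true)]
      simp
    have h1 : ∑ x with π x = true, (f x + e x) = 0 := by
      simp [e, c, Finset.sum_add_distrib, ← Finset.mul_sum, Finset.sum_sub_distrib,
        Pi.single_apply, hx₀, hy₀]
    have h2 : ∑ x with π x = false, (f x + e x) = 0 := by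
      simp [e, c, Finset.sum_add_distrib, ← Finset.mul_sum, Finset.sum_sub_distrib,
        Pi.single_apply, hx₀, hy₀]
      grind
    obtain ⟨a₁, ha₁⟩ := exists_diff hσ _ h1
    obtain ⟨a₂, ha₂⟩ := exists_diff hσ _ h2
    refine ⟨(fun x => if π x then a₁ x else a₂ x, ⟨fun p => c *
      ((Pi.single (x₀, y₀) 1 : Y × Y → k) p - (Pi.single (y₀, x₀) 1 : Y × Y → k) p),
        fun x y h => ?_, fun x y => ?_⟩), funext fun x => ?_⟩
    · have h3 : (x, y) ≠ (x₀, y₀) := fun h' => by simp_all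
      have h4 : (x, y) ≠ (y₀, x₀) := fun h' => by simp_all
      simp [h3, h4]
    · simp only [Pi.single_apply, Prod.mk.injEq]
      rw [if_congr (and_comm (a := y = x₀)) rfl rfl, if_congr (and_comm (a := y = y₀)) rfl rfl]
      ring
    · have h5 : ∑ y, c * ((Pi.single (x₀, y₀) 1 : Y × Y → k) (x, y) -
          (Pi.single (y₀, x₀) 1 : Y × Y → k) (x, y)) = e x := by
        rw [← Finset.mul_sum, Finset.sum_sub_distrib]
        simp only [e, Pi.single_apply, Prod.mk.injEq, ite_and]
        simp
      rw [d₁_apply, h5]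
      simp only [symm_fibre hπ]
      cases hx : π x
      · simp [ha₂ x hx]
      · simp [ha₁ x hx]

include hπ hσ in
theorem range_d₂ {x₀ y₀ : Y} (hx₀ : π x₀ = true) (hy₀ : π y₀ = false) :
    LinearMap.range (d₂ k hπ) = LinearMap.ker (d₁ k π σ) := by
  classical
  refine le_antisymm ?_ ?_
  · rintro _ ⟨u, rfl⟩
    rw [LinearMap.mem_ker]
    ext x
    rw [d₁_apply]
    simp only [d₂_apply_fst, d₂_apply_snd, Finset.sum_sub_distrib]
    rw [Equiv.sum_comp σ.symm (fun y => u.1 (y, x))]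
    simp
  · rintro ⟨a, κ⟩ hf
    have hf : ∀ x, ∑ y, κ.1 (x, y) = a (σ.symm x) - a x := fun x => by
      have := congrFun (LinearMap.mem_ker.1 hf) x
      rw [d₁_apply] at this
      simp only [Pi.zero_apply] at this
      grind
    -- `o x` is the base point of the opposite circle. Placing `a x` on the cell `(x, o x)` gives a
    -- 2-chain `u₁` with the prescribed circle component `a`.
    let o : Y → Y := fun x => if π x then y₀ else x₀
    have ho : ∀ x, o (σ.symm x) = o x := fun x => by simp [o, symm_fibre hπ]
    let u₁ : Y × Y → k := fun p => if p.2 = o p.1 then a p.1 else 0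
    have hu₁ : u₁ ∈ cross k π := fun x y h => by
      refine if_neg fun (h' : y = o x) => ?_
      rw [h'] at h
      cases hx : π x <;> simp [o, hx, hx₀, hy₀] at h
    have hs₁ : ∀ x, ∑ y, u₁ (x, y) = a x := fun x => by simp [u₁]
    let κ' : alt k π := κ - (d₂ k hπ ⟨u₁, hu₁⟩).2
    have hκ' : ∀ x y, κ'.1 (x, y) = κ.1 (x, y) -
      ((u₁ (σ.symm x, y) - u₁ (x, y)) - (u₁ (σ.symm y, x) - u₁ (y, x))) := fun x y => rfl
    have hr : ∀ x, ∑ y, κ'.1 (x, y) = 0 := fun x => by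
      simp only [hκ', Finset.sum_sub_distrib, hf, hs₁]
      rw [Equiv.sum_comp σ.symm (fun y => u₁ (y, x))]
      simp
    have hh : ∀ y, ∃ h : Y → k, π y = false → ∀ x, π x = true →
        h (σ.symm x) - h x = κ'.1 (x, y) := fun y => by
      by_cases hy : π y = false
      · have h0 : ∑ x with π x = true, κ'.1 (x, y) = 0 := by
          have h1 := (sum_filter_cross κ'.2.1 (b := true) hy).trans (hr y)
          rw [← neg_eq_zero, ← Finset.sum_neg_distrib, ← h1]
          exact Finset.sum_congr rfl fun x _ => (κ'.2.2 x y).symm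
        obtain ⟨h, hh⟩ := exists_diff hσ _ h0
        exact ⟨h, fun _ => hh⟩
      · exact ⟨0, fun h => absurd h hy⟩
    choose h hh using hh
    -- `h y` solves the difference equation in the first variable only up to a constant. Normalising
    -- at `x₀` makes the row sums vanish at `x₀`, hence everywhere, so `u₂` does not disturb the
    -- circle component.
    let u₂ : Y × Y → k := fun p =>
      if π p.1 = true ∧ π p.2 = false then h p.2 p.1 - h p.2 x₀ else 0
    have hu₂ : u₂ ∈ cross k π := fun x y hxy => if_neg fun (h' : π x = true ∧ π y = false) => by
      simp [h'.1, h'.2] at hxy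
    have hd₂ : ∀ x y, u₂ (σ.symm x, y) - u₂ (x, y) =
        if π x = true ∧ π y = false then κ'.1 (x, y) else 0 := fun x y => by
      simp only [u₂, symm_fibre hπ]
      split_ifs with hxy
      · rw [← hh y hxy.2 x hxy.1]; ring
      · exact sub_zero 0
    have hs₂ : ∀ x, ∑ y, u₂ (x, y) = 0 := fun x => by
      cases hx : π x
      · exact Finset.sum_eq_zero fun y _ => if_neg (by simp [hx])
      · rw [eq_of_diffMap_eq_zero σ hσ (b := true) hπ (h := fun x => ∑ y, u₂ (x, y))
          (fun x hx => ?_) hx hx₀]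
        · exact Finset.sum_eq_zero fun y _ => by simp [u₂]
        · rw [diffMap_apply, ← Finset.sum_sub_distrib]
          simp only [hd₂, hx, true_and]
          rw [← Finset.sum_filter, sum_filter_cross κ'.2.1 (by simpa using hx), hr]
    refine ⟨⟨u₁ + u₂, add_mem hu₁ hu₂⟩, Prod.ext (funext fun x => ?_)
      (Subtype.ext (funext fun ⟨x, y⟩ => ?_))⟩
    · rw [d₂_apply_fst]
      simp [Finset.sum_add_distrib, hs₁, hs₂]
    · rw [d₂_apply_snd]
      have e1 := hd₂ x y
      have e2 := hd₂ y x
      have e3 := hκ' x y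
      have e4 := κ'.2.2 x y
      have e5 := κ'.2.1 x y
      simp only [Pi.add_apply]
      cases hx : π x <;> cases hy : π y <;> simp [hx, hy] at e1 e2 e5 <;> grind

include hπ hσ in
theorem range_d₃ {y₀ : Y} (hy₀ : π y₀ = false) :
    LinearMap.range (d₃ k hπ) = LinearMap.ker (d₂ k hπ) := by
  classical
  refine le_antisymm ?_ ?_
  · rintro _ ⟨u, rfl⟩
    rw [LinearMap.mem_ker]
    refine Prod.ext (funext fun x => ?_) (Subtype.ext (funext fun ⟨x, y⟩ => ?_))
    · rw [d₂_apply_fst]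
      simp only [d₃_apply, Finset.sum_sub_distrib]
      rw [Equiv.sum_comp σ.symm (fun y => u.1 (x, y))]
      simp
    · rw [d₂_apply_snd]
      simp only [d₃_apply, u.2.2 x, u.2.2 (σ.symm x)]
      simp
      ring
  · intro u hf
    have hs : ∀ x, ∑ y, u.1 (x, y) = 0 := fun x => by
      have := congrArg (fun p => p.1 x) (LinearMap.mem_ker.1 hf)
      simpa [d₂_apply_fst] using this
    have hd : ∀ x y, u.1 (σ.symm x, y) - u.1 (x, y) = u.1 (σ.symm y, x) - u.1 (y, x) :=
      fun x y => by
        have := congrArg (fun p => p.2.1 (x, y)) (LinearMap.mem_ker.1 hf)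
        simp only [d₂_apply_snd] at this
        simp at this
        grind
    have hh : ∀ x, ∃ h : Y → k, π x = true → ∀ y, π y = false →
        h (σ.symm y) - h y = u.1 (x, y) := fun x => by
      by_cases hx : π x = true
      · obtain ⟨h, hh⟩ := exists_diff hσ false
          ((sum_filter_cross u.2 (b := false) hx).trans (hs x))
        exact ⟨h, fun _ => hh⟩
      · exact ⟨0, fun h => absurd h hx⟩
    choose h hh using hh
    -- The antidifference `h x` of `u (x, ·)` need not account for the values `u (y, x)`. The cycle
    -- condition makes the error `φ y x` independent of `y`, so it can be removed by adding to `h x`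
    -- a function `ψ` of `x` alone.
    let φ : Y → Y → k := fun y x => u.1 (y, x) - (h (σ.symm x) y - h x y)
    have hφ : ∀ x y, π x = true → π y = false → φ y x = φ y₀ x := fun x y hx hy => by
      refine eq_of_diffMap_eq_zero σ hσ (b := false) hπ (h := fun y => φ y x) (fun y hy => ?_) hy hy₀
      have e1 := hh x hx y hy
      have e2 := hh (σ.symm x) (by rw [symm_fibre hπ, hx]) y hy
      have e3 := hd x y
      simp only [diffMap_apply, φ]
      grind
    have hs2 : ∑ x with π x = true, φ y₀ x = 0 := by
      have := sum_diffMap hπ (fun x => h x y₀) true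
      simp only [diffMap_apply] at this
      simp only [φ]
      rw [Finset.sum_sub_distrib, this, sum_filter_cross u.2 (by simpa using hy₀), hs, sub_zero]
    obtain ⟨ψ, hψ⟩ := exists_diff hσ _ hs2
    let g : Y × Y → k := fun p =>
      if π p.1 = true ∧ π p.2 = false then h p.1 p.2 + ψ p.1
      else if π p.2 = true ∧ π p.1 = false then h p.2 p.1 + ψ p.2 else 0
    refine ⟨⟨g, fun x y hxy => ?_, fun x y => ?_⟩, Subtype.ext (funext fun ⟨x, y⟩ => ?_)⟩
    · cases hx : π x <;> simp [g, ← hxy, hx]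
    · cases hx : π x <;> cases hy : π y <;> simp [g, hx, hy]
    · rw [d₃_apply]
      simp only [g, symm_fibre hπ]
      cases hx : π x <;> cases hy : π y
      · simp [u.2 x y (by rw [hx, hy])]
      · have e1 := hψ y hy
        have e2 := hφ y x hy hx
        simp only [φ] at e1 e2
        simp
        grind
      · have e1 := hh x hx y hy
        simp
        grind
      · simp [u.2 x y (by rw [hx, hy])]

variable (k π) in
/-- The constant functions on pairs of points in different fibres. -/
def d₄ : k →ₗ[k] sym k π :=
  LinearMap.toSpanSingleton k _ ⟨fun p => if π p.1 = π p.2 then 0 else 1,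
    fun x y h => if_pos h, fun x y => by simp [eq_comm]⟩

theorem d₄_apply (r : k) (x y : Y) :
    (d₄ k π r).1 (x, y) = if π x = π y then 0 else r := by simp [d₄]

theorem d₄_injective {x₀ y₀ : Y} (hx₀ : π x₀ = true) (hy₀ : π y₀ = false) :
    Function.Injective (d₄ k π) := fun r s h => by
  have := congrArg (fun u => u.1 (x₀, y₀)) h
  simpa [d₄_apply, hx₀, hy₀] using this

-- The top homology of the sphere is spanned by the fundamental cycle: a cycle is constant in the
-- second variable along each circle, and by symmetry also in the first.
include hσ in
theorem range_d₄ {x₀ y₀ : Y} (hx₀ : π x₀ = true) (hy₀ : π y₀ = false) :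
    LinearMap.range (d₄ k π) = LinearMap.ker (d₃ k hπ) := by
  refine le_antisymm ?_ ?_
  · rintro _ ⟨r, rfl⟩
    rw [LinearMap.mem_ker]
    refine Subtype.ext (funext fun ⟨x, y⟩ => ?_)
    rw [d₃_apply]
    simp [d₄_apply, symm_fibre hπ]
  · intro u hf
    have hd : ∀ x y, u.1 (x, σ.symm y) - u.1 (x, y) = 0 := fun x y =>
      congrArg (fun v => v.1 (x, y)) (LinearMap.mem_ker.1 hf)
    have h1 : ∀ x y y', π y = π y' → u.1 (x, y) = u.1 (x, y') := fun x y y' h =>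
      eq_of_diffMap_eq_zero σ hσ (b := π y') hπ (h := fun y => u.1 (x, y))
        (fun y _ => hd x y) h rfl
    have h2 : ∀ x y, π x = true → π y = false → u.1 (x, y) = u.1 (x₀, y₀) := fun x y hx hy => by
      rw [h1 x y y₀ (by rw [hy, hy₀]), ← u.2.2, h1 y₀ x x₀ (by rw [hx, hx₀]), u.2.2]
    refine ⟨u.1 (x₀, y₀), Subtype.ext (funext fun ⟨x, y⟩ => ?_)⟩
    rw [d₄_apply]
    cases hx : π x <;> cases hy : π y
    · simp [u.2.1 x y (by rw [hx, hy])]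
    · simp [u.2.2 y x, h2 y x hy hx]
    · simp [h2 x y hx hy]
    · simp [u.2.1 x y (by rw [hx, hy])]

end Exactness

end Join

/-! ### Relative projectivity of the cellular chains for a free action. -/

/-- Multiplication by a weight shows that an invariant space of functions is relatively
projective. -/
theorem exists_tr_subrepresentation_eq_id {k S B : Type*} [CommRing k] [Group S] [Finite S]
    [MulAction S B] {M : Submodule k (B → k)}
    (hM : ∀ s, M ≤ M.comap (funRep (trivial k S k) B s)) (c : B → k)
    (hc : ∀ u ∈ M, (fun x => c x * u x) ∈ M)
    (hsum : ∀ u ∈ M, ∀ x, u x ≠ 0 → ∑ s : S, c (s⁻¹ • x) = 1) :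
    ∃ θ, tr ((funRep (trivial k S k) B).subrepresentation M hM)
      ((funRep (trivial k S k) B).subrepresentation M hM) θ = LinearMap.id := by
  let θ : M →ₗ[k] M := (LinearMap.pi (fun x => c x • LinearMap.proj x) ∘ₗ M.subtype).codRestrict M
    fun u => by exact hc u u.2
  refine ⟨θ, LinearMap.ext fun u => Subtype.ext (funext fun x => ?_)⟩
  have h1 : ∀ s, (((funRep (trivial k S k) B).subrepresentation M hM s
      (θ (((funRep (trivial k S k) B).subrepresentation M hM s⁻¹) u)) : M) : B → k) x =
        c (s⁻¹ • x) * u.1 x := fun s => by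
    change c (s⁻¹ • x) * u.1 (s⁻¹⁻¹ • s⁻¹ • x) = _
    simp
  rw [tr_apply, Submodule.coe_sum, Finset.sum_apply, Finset.sum_congr rfl fun s _ => h1 s,
    ← Finset.sum_mul]
  by_cases hx : u.1 x = 0
  · simp [hx]
  · rw [hsum u u.2 x hx]; simp

theorem exists_tr_funRep_eq_id (k : Type*) {S B : Type*} [CommRing k] [Group S] [Finite S]
    [MulAction S B] (hfree : ∀ (s : S) (x : B), s • x = x → s = 1) :
    ∃ θ, tr (funRep (trivial k S k) B) (funRep (trivial k S k) B) θ = LinearMap.id := by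
  obtain ⟨c, hc⟩ := exists_weight k S B
  refine ⟨LinearMap.pi fun x => c x • LinearMap.proj x, ?_⟩
  refine LinearMap.ext fun f => funext fun x => ?_
  have h2 := hc x fun s hs => hfree s x hs
  rw [tr_apply, Finset.sum_apply, LinearMap.id_apply, ← one_mul (f x), ← h2, Finset.sum_mul]
  exact Finset.sum_congr rfl fun h _ => by simp

theorem tr_prod {k S V W : Type*} [CommRing k] [Group S] [Finite S] [AddCommGroup V] [Module k V]
    [AddCommGroup W] [Module k W] {ρ : Representation k S V} {σ : Representation k S W}
    {θ : V →ₗ[k] V} {θ' : W →ₗ[k] W} (hθ : tr ρ ρ θ = LinearMap.id)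
    (hθ' : tr σ σ θ' = LinearMap.id) :
    tr (ρ.prod σ) (ρ.prod σ) (θ.prodMap θ') = LinearMap.id := by
  refine LinearMap.ext fun ⟨v, w⟩ => Prod.ext ?_ ?_
  · have := congr($hθ v)
    rw [tr_apply] at this
    simpa [tr_apply, Prod.fst_sum] using this
  · have := congr($hθ' w)
    rw [tr_apply] at this
    simpa [tr_apply, Prod.snd_sum] using this

namespace Join

variable {k S Y : Type*} [CommRing k] [Group S] [Finite S] [Finite Y] [MulAction S Y] {π : Y → Bool}
  {σ : Equiv.Perm Y}

theorem cross_le (k : Type*) [CommRing k] (hS : ∀ (s : S) x y, π x = π y → π (s • x) = π (s • y)) (s : S) :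
    cross k π ≤ (cross k π).comap (funRep (trivial k S k) (Y × Y) s) := fun _ hu x y h =>
  hu (s⁻¹ • x) (s⁻¹ • y) (hS s⁻¹ x y h)

theorem sym_le (k : Type*) [CommRing k] (hS : ∀ (s : S) x y, π x = π y → π (s • x) = π (s • y)) (s : S) :
    sym k π ≤ (sym k π).comap (funRep (trivial k S k) (Y × Y) s) := fun _ hu =>
  ⟨cross_le k hS s hu.1, fun x y => hu.2 (s⁻¹ • x) (s⁻¹ • y)⟩

theorem alt_le (k : Type*) [CommRing k] (hS : ∀ (s : S) x y, π x = π y → π (s • x) = π (s • y)) (s : S) :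
    alt k π ≤ (alt k π).comap (funRep (trivial k S k) (Y × Y) s) := fun _ hu =>
  ⟨cross_le k hS s hu.1, fun x y => hu.2 (s⁻¹ • x) (s⁻¹ • y)⟩

open scoped Pointwise in
/-- A symmetric weight on the pairs of points in different fibres. -/
theorem exists_pair_weight (k : Type*) [CommRing k] (hfree : ∀ (s : S) (x : Y), s • x = x → s = 1)
    (hswap : ∀ (s : S) (x y : Y), s • x = y → s • y = x → π x ≠ π y → s = 1) :
    ∃ c : Y × Y → k, (∀ x y, c (y, x) = c (x, y)) ∧
      ∀ x y, π x ≠ π y → ∑ s : S, c (s⁻¹ • (x, y)) = 1 := by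
  -- A weight on subsets, evaluated at `{x, y}`, is automatically symmetric. The two freeness
  -- hypotheses say that this set has trivial stabiliser when `x` and `y` lie on different circles.
  obtain ⟨c, hc⟩ := exists_weight k S (Set Y)
  refine ⟨fun p => c {p.1, p.2}, fun x y => congrArg c (Set.pair_comm y x), fun x y hxy => ?_⟩
  have := hc {x, y} fun s hs => by
    rw [Set.smul_set_insert, Set.smul_set_singleton, Set.pair_eq_pair_iff] at hs
    rcases hs with h | h
    · exact hfree s x h.1
    · exact hswap s x y h.1 h.2 hxy
  rw [← this]
  simp [Set.smul_set_insert, Set.smul_set_singleton]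

/-- A group acting on the join of two circles, freely on all cells, is stably four-periodic. -/
theorem stablyEquiv [IsDomain k] [CharZero k] [IsPrincipalIdealRing k] {G : Type*} [Group G] [Finite G] {φ : S →* G} (hφ : Function.Injective φ)
    (hπ : ∀ x, π (σ x) = π x) (hσ : ∀ x y, π x = π y → ∃ n : ℕ, (σ ^ n) x = y)
    (hσS : ∀ (s : S) y, σ (s • y) = s • σ y)
    (hS : ∀ (s : S) x y, π x = π y → π (s • x) = π (s • y))
    (hfree : ∀ (s : S) (x : Y), s • x = x → s = 1)
    (hswap : ∀ (s : S) (x y : Y), s • x = y → s • y = x → π x ≠ π y → s = 1)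
    {x₀ y₀ : Y} (hx₀ : π x₀ = true) (hy₀ : π y₀ = false) :
    StablyEquiv (trivial k S k)
      ((tprod (augRep k G) (tprod (augRep k G) (tprod (augRep k G) (tprod (augRep k G)
        (trivial k G k))))).comp φ) := by
  obtain ⟨c, hcs, hc⟩ := exists_pair_weight k hfree hswap
  obtain ⟨θ, hθ⟩ := exists_tr_funRep_eq_id k hfree
  have hcross : ∀ u ∈ cross k π, (fun p => c p * u p) ∈ cross k π := fun u hu x y h => by
    simp [hu x y h]
  have hsum : ∀ u ∈ cross k π, ∀ p, u p ≠ 0 → ∑ s : S, c (s⁻¹ • p) = 1 := fun u hu ⟨x, y⟩ h =>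
    hc x y fun h' => h (hu x y h')
  obtain ⟨θ₁, hθ₁⟩ := exists_tr_subrepresentation_eq_id (alt_le k hS) c
    (fun u hu => ⟨hcross u hu.1, fun x y => by simp [hcs x y, hu.2 x y]⟩)
    (fun u hu => hsum u hu.1)
  have hσsymm : ∀ (s : S) y, σ.symm (s • y) = s • σ.symm y := fun s y => by
    rw [Equiv.symm_apply_eq, hσS, _root_.Equiv.apply_symm_apply]
  have hsumRight : ∀ (s : S) (u : Y × Y → k) (x : Y),
      ∑ y, u (s⁻¹ • (x, y)) = ∑ y, u (s⁻¹ • x, y) := fun s u x =>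
    Equiv.sum_comp (MulAction.toPerm s⁻¹) fun y => u (s⁻¹ • x, y)
  have : Nonempty Y := ⟨x₀⟩
  refine stablyEquiv_of_exact hφ
    (σ₀ := funRep (trivial k S k) Y)
    (σ₁ := (funRep (trivial k S k) Y).prod
      ((funRep (trivial k S k) (Y × Y)).subrepresentation _ (alt_le k hS)))
    (σ₂ := (funRep (trivial k S k) (Y × Y)).subrepresentation _ (cross_le k hS))
    (σ₃ := (funRep (trivial k S k) (Y × Y)).subrepresentation _ (sym_le k hS))
    (isEquivariant_sumMap _) (d₁ := d₁ k π σ) ?_ (d₂ := d₂ k hπ) ?_ (d₃ := d₃ k hπ) ?_ (d₄ := d₄ k π) ?_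
    sumMap_surjective (range_d₁ hπ hσ hx₀ hy₀) (range_d₂ hπ hσ hx₀ hy₀) (range_d₃ hπ hσ hy₀)
    (range_d₄ hπ hσ hx₀ hy₀) (d₄_injective hx₀ hy₀) ⟨θ, hθ⟩ ⟨_, tr_prod hθ hθ₁⟩
    (exists_tr_subrepresentation_eq_id _ c hcross hsum)
    (exists_tr_subrepresentation_eq_id _ c
      (fun u hu => ⟨hcross u hu.1, fun x y => by simp [hcs x y, hu.2 x y]⟩)
      (fun u hu => hsum u hu.1))
  · rintro s ⟨a, κ⟩
    ext x
    rw [funRep_apply, trivial_apply, d₁_apply, d₁_apply]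
    change a (s⁻¹ • σ.symm x) - a (s⁻¹ • x) - ∑ y, κ.1 (s⁻¹ • (x, y)) = _
    rw [hsumRight, hσsymm]
  · rintro s u
    refine Prod.ext (funext fun x => ?_) (Subtype.ext (funext fun ⟨x, y⟩ => ?_))
    · rw [d₂_apply_fst]
      change ∑ y, u.1 (s⁻¹ • (x, y)) = (d₂ k hπ u).1 (s⁻¹ • x)
      rw [hsumRight, d₂_apply_fst]
    · rw [d₂_apply_snd]
      change (u.1 (s⁻¹ • σ.symm x, s⁻¹ • y) - u.1 (s⁻¹ • x, s⁻¹ • y)) -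
        (u.1 (s⁻¹ • σ.symm y, s⁻¹ • x) - u.1 (s⁻¹ • y, s⁻¹ • x)) =
          (d₂ k hπ u).2.1 (s⁻¹ • x, s⁻¹ • y)
      rw [d₂_apply_snd, hσsymm, hσsymm]
  · rintro s u
    refine Subtype.ext (funext fun ⟨x, y⟩ => ?_)
    rw [d₃_apply]
    change u.1 (s⁻¹ • x, s⁻¹ • σ.symm y) - u.1 (s⁻¹ • x, s⁻¹ • y) =
      (d₃ k hπ u).1 (s⁻¹ • x, s⁻¹ • y)
    rw [d₃_apply, hσsymm]
  · rintro s r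
    refine Subtype.ext (funext fun ⟨x, y⟩ => ?_)
    change _ = (d₄ k π r).1 (s⁻¹ • x, s⁻¹ • y)
    rw [d₄_apply, d₄_apply]
    have : π (s⁻¹ • x) = π (s⁻¹ • y) ↔ π x = π y :=
      ⟨fun h => by simpa using hS s _ _ h, hS s⁻¹ x y⟩
    simp [this]

end Join

/-! ### Elements that centralise a subgroup act stably trivially. -/

section Commuting

variable {k G V W : Type*} [CommRing k] [Group G] [Finite G]
  [AddCommMonoid V] [Module k V] [AddCommMonoid W] [Module k W]
  {ρ : Representation k G V} {σ : Representation k G W}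

theorem isEquivariant_of_commute {H : Type*} [Group H] {φ : H →* G} {g : G}
    (hg : ∀ h, Commute g (φ h)) : IsEquivariant (ρ.comp φ) (ρ.comp φ) (ρ g) := fun h v => by
  simp only [MonoidHom.coe_comp, Function.comp_apply, ← Module.End.mul_apply, ← map_mul, (hg h).eq]

/-- An element commuting with a subgroup acts as `1` plus a trace on the augmentation ideal. -/
theorem exists_augRep_eq_id_add_tr (k : Type*) [CommRing k] {H : Type*} [Group H] [Finite H]
    {φ : H →* G} (hφ : Function.Injective φ) {g : G} (hg : ∀ h, Commute g (φ h)) :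
    ∃ b, augRep k G g =
      LinearMap.id + tr ((augRep k G).comp φ) ((augRep k G).comp φ) b := by
  obtain ⟨θ, hθ⟩ := tr_funRep_comp (trivial k G k) hφ
  let P := funRep (trivial k G k) G
  -- `g - 1` sends every function into the augmentation ideal, so on the ideal it factors
  -- equivariantly through the relatively projective space of all functions.
  let d : (G → k) →ₗ[k] aug k G := (P g - LinearMap.id).codRestrict _ fun f => by
    rw [mem_aug]
    simpa [P, sub_eq_zero] using Equiv.sum_comp (Equiv.mulLeft g⁻¹) f
  have ed : IsEquivariant (P.comp φ) ((augRep k G).comp φ) d := fun h f =>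
    Subtype.ext (((isEquivariant_of_commute (ρ := P) hg).sub .id) h f)
  have ei : IsEquivariant ((augRep k G).comp φ) (P.comp φ) (aug k G).subtype := fun h f => rfl
  refine ⟨d ∘ₗ θ ∘ₗ (aug k G).subtype, ?_⟩
  rw [← ed.comp_tr, ← ei.tr_comp, hθ]
  ext f x
  simp [d, P, augRep_apply]

/-- Expand `(1 + tr b) ⊗ σ g` and then `1 ⊗ (1 + tr c)`. The first expansion yields a trace because
`σ g` is equivariant for a subgroup that `g` centralises. -/
theorem exists_tprod_eq_id_add_tr {H : Type*} [Group H] [Finite H]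
    {φ : H →* G} {g : G} (hg : ∀ h, Commute g (φ h))
    (hρ : ∃ b, ρ g = LinearMap.id + tr (ρ.comp φ) (ρ.comp φ) b)
    (hσ : ∃ b, σ g = LinearMap.id + tr (σ.comp φ) (σ.comp φ) b) :
    ∃ b, ρ.tprod σ g =
      LinearMap.id + tr ((ρ.tprod σ).comp φ) ((ρ.tprod σ).comp φ) b := by
  obtain ⟨b, hb⟩ := hρ
  obtain ⟨c, hc⟩ := hσ
  refine ⟨TensorProduct.map b (σ g) + TensorProduct.map LinearMap.id c, ?_⟩
  have e₁ := tr_map_left (ρ := ρ.comp φ) (σ := ρ.comp φ) b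
    (isEquivariant_of_commute (ρ := σ) (φ := φ) hg)
  have e₂ := tr_map_right (IsEquivariant.id (ρ := ρ.comp φ)) (ρ' := σ.comp φ) (σ' := σ.comp φ) c
  have e₃ : (ρ.tprod σ).comp φ = Representation.tprod (ρ.comp φ) (σ.comp φ) := rfl
  rw [e₃, tr_add, ← e₁, ← e₂, tprod_apply]
  nth_rw 1 [hb]
  rw [TensorProduct.map_add_left]
  nth_rw 1 [hc]
  rw [TensorProduct.map_add_right, TensorProduct.map_id]
  abel

end Commuting

/-! ### Transfer of invariant vectors, and invariant vectors that are not norms. -/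

section Cosets

variable {k G V W : Type*} [CommRing k] [Group G] [Finite G]
  [AddCommMonoid V] [Module k V] [AddCommMonoid W] [Module k W]
  (ρ : Representation k G V) {S : Subgroup G}

variable (S) in
/-- The sum of the translates of a vector by representatives of the cosets of a subgroup. -/
def relNm (v : V) : V := ∑ q : G ⧸ S, ρ q.out v

variable {ρ}

theorem apply_out {v : V} (hv : ∀ s ∈ S, ρ s v = v) (g : G) :
    ρ (g : G ⧸ S).out v = ρ g v := by
  obtain ⟨s, hs⟩ := QuotientGroup.mk_out_eq_mul S g
  rw [hs, map_mul, Module.End.mul_apply, hv _ s.2]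

theorem apply_relNm {v : V} (hv : ∀ s ∈ S, ρ s v = v) (g : G) :
    ρ g (relNm ρ S v) = relNm ρ S v := by
  simp only [relNm, map_sum]
  refine Fintype.sum_equiv (MulAction.toPerm g) _ _ fun q => ?_
  induction q using QuotientGroup.induction_on with
  | H x =>
    change _ = ρ ((g * x : G) : G ⧸ S).out v
    rw [apply_out hv, apply_out hv, map_mul, Module.End.mul_apply]

theorem relNm_nm (v : V) : relNm ρ S (nm (ρ.comp S.subtype) v) = nm ρ v := by
  have hv : ∀ s ∈ S, ρ s (nm (ρ.comp S.subtype) v) = nm (ρ.comp S.subtype) v := fun s hs =>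
    apply_nm (ρ := ρ.comp S.subtype) ⟨s, hs⟩ v
  have h := sum_eq_sum_cosets S.subtype_injective fun g => ρ g⁻¹ v
  rw [← Equiv.sum_comp (Equiv.inv G)] at h
  simp only [Equiv.inv_apply, inv_inv] at h
  change _ = ∑ g, ρ g v
  rw [h, relNm]
  have e : S.subtype.range = S := S.range_subtype
  refine Fintype.sum_equiv (Subgroup.quotientEquivOfEq e.symm) _ _ fun q => ?_
  have hq : ((Subgroup.quotientEquivOfEq e.symm q).out : G ⧸ S) = q := by
    induction q using QuotientGroup.induction_on with
    | H x =>
      have := QuotientGroup.out_eq' (Subgroup.quotientEquivOfEq e.symm (x : G ⧸ S))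
      exact congrArg (Subgroup.quotientEquivOfEq e) this
  nth_rw 1 [← hq]
  rw [apply_out hv]
  simp only [nm, map_sum]
  refine Fintype.sum_equiv (Equiv.inv S) _ _ fun s => ?_
  simp [mul_inv_rev, map_mul]

theorem relNm_of_invariant {v : V} (hv : ∀ g, ρ g v = v) : relNm ρ S v = (S.index : k) • v := by
  simp [relNm, hv, Subgroup.index, Nat.card_eq_fintype_card, Nat.cast_smul_eq_nsmul]

theorem relNm_add (v w : V) : relNm ρ S (v + w) = relNm ρ S v + relNm ρ S w := by
  simp [relNm, Finset.sum_add_distrib]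

end Cosets

variable {k G W : Type*} [CommRing k] [Group G] [Finite G] [AddCommMonoid W] [Module k W]

/-- The norm as a linear map. -/
def nmLin {k G V : Type*} [CommRing k] [Group G] [Finite G] [AddCommMonoid V] [Module k V]
    (ρ : Representation k G V) : V →ₗ[k] V := ∑ g, ρ g

theorem nmLin_apply {k G V : Type*} [CommRing k] [Group G] [Finite G] [AddCommMonoid V]
    [Module k V] (ρ : Representation k G V) (v : V) : nmLin ρ v = nm ρ v := by
  simp [nmLin, nm, LinearMap.sum_apply]

theorem nm_mem_range {k G V : Type*} [CommRing k] [Group G] [Finite G] [AddCommMonoid V]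
    [Module k V] (ρ : Representation k G V) (v : V) : nm ρ v ∈ LinearMap.range (nmLin ρ) :=
  ⟨v, nmLin_apply ρ v⟩

theorem nm_trivial {k G V : Type*} [CommRing k] [Group G] [Finite G] [AddCommMonoid V]
    [Module k V] (v : V) : nm (trivial k G V) v = (Nat.card G : k) • v :=
  nm_of_invariant fun _ => rfl

/-- Divisibility of natural numbers can be tested in a ring in which the divisor is prime. -/
theorem natCast_dvd_natCast_iff {l n : ℕ} [hl : Fact l.Prime] (hk : Prime (l : k)) :
    (l : k) ∣ n ↔ l ∣ n := by
  refine ⟨fun h => ?_, Nat.cast_dvd_cast⟩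
  by_contra hn
  have h1 := ((Nat.isCoprime_iff_coprime.2 ((Nat.Prime.coprime_iff_not_dvd hl.out).2 hn)).map
    (Int.castRingHom k))
  simp only [map_natCast] at h1
  exact hk.not_isUnit (h1.isUnit_of_dvd' dvd_rfl h)

/-- A vector invariant under a Sylow subgroup gives, under a fusion hypothesis, an invariant vector
that is not a norm from a subgroup of prime order. -/
theorem relNm_notMem_range {ω : Representation k G W} {S C : Subgroup G} {l : ℕ} [Fact l.Prime] (hl : Prime (l : k))
    (hC : Nat.card C = l) (hS : ¬ l ∣ S.index) {z : W}
    (hz : ∀ s ∈ S, ω s z = z) {e : W →ₗ[k] k}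
    (he : IsEquivariant (ω.comp C.subtype) (trivial k C k) e) (hez : ¬ (l : k) ∣ e z)
    (hfus : ∀ g, (∀ c ∈ C, g⁻¹ * c * g ∈ S) → ∃ y, ω g z = z + nm (ω.comp C.subtype) y) :
    relNm ω S z ∉ LinearMap.range (nmLin (ω.comp C.subtype)) := by
  classical
  let _ := Module.addCommMonoidToAddCommGroup k (M := W)
  set N := LinearMap.range (nmLin (ω.comp C.subtype)) with hN
  let v : G ⧸ S → W := fun q => ω q.out z
  have hv : ∀ (c : C) q, v (c • q) = ω c (v q) := fun c q => by
    induction q using QuotientGroup.induction_on with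
    | H x =>
      change ω ((c * x : G) : G ⧸ S).out z = ω c (ω (x : G ⧸ S).out z)
      rw [apply_out hz, apply_out hz, map_mul, Module.End.mul_apply]
  -- The fixed points of `C` on `G ⧸ S` number the index of `S` modulo `l`. By the fusion hypothesis
  -- each contributes `z` up to a norm; the remaining orbits are free and contribute norms.
  let T : Finset (G ⧸ S) := {q | ∀ c : C, c • q = q}
  have hT : S.index ≡ T.card [MOD l] := by
    have h1 := (IsPGroup.of_card (n := 1) (by simpa using hC) :
      IsPGroup l C).card_modEq_card_fixedPoints (G ⧸ S)
    have h2 : Nat.card (MulAction.fixedPoints C (G ⧸ S)) = T.card := by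
      rw [← Nat.card_eq_finsetCard]
      exact Nat.card_congr (Equiv.subtypeEquivRight fun q => by simp [T, MulAction.mem_fixedPoints])
    rw [h2] at h1
    exact h1
  have hfree : ∀ q ∉ T, ∀ c : C, c • q = q → c = 1 := fun q hq c hc => by
    have : Fact (Nat.card C).Prime := ⟨hC ▸ Fact.out⟩
    rcases (MulAction.stabilizer C q).eq_bot_or_eq_top_of_prime_card with h | h
    · have : c ∈ MulAction.stabilizer C q := hc
      simpa [h] using this
    · refine absurd ?_ hq
      simp only [T, Finset.mem_filter, Finset.mem_univ, true_and]
      intro c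
      have : c ∈ MulAction.stabilizer C q := by simp [h]
      exact this
  have h1 : ∑ q ∈ T, v q - (T.card : k) • z ∈ N := by
    have : ∑ q ∈ T, v q - (T.card : k) • z = ∑ q ∈ T, (v q - z) := by simp [Nat.cast_smul_eq_nsmul]
    rw [this]
    refine sum_mem fun q hq => ?_
    obtain ⟨y, hy⟩ := hfus q.out fun c hc => by
      have h2 : (⟨c, hc⟩ : C) • q = q := (Finset.mem_filter.1 hq).2 _
      rw [← QuotientGroup.out_eq' q] at h2
      have h3 := (QuotientGroup.eq.1 (h2 : ((c * q.out : G) : G ⧸ S) = q.out).symm)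
      rw [mul_assoc]
      exact h3
    have h0 : v q - z = nm (ω.comp C.subtype) y := by rw [sub_eq_iff_eq_add', ← hy]
    exact h0 ▸ nm_mem_range _ y
  have h2 : ∑ q with q ∉ T, v q ∈ N := by
    obtain ⟨c, hc⟩ := exists_weight k C (G ⧸ S)
    have hmT : ∀ (a : C) q, a • q ∉ T ↔ q ∉ T := by
      have key : ∀ (a : C) q, q ∈ T → a • q ∈ T := fun a q hq => by
        rw [(Finset.mem_filter.1 hq).2 a]; exact hq
      exact fun a q => not_congr ⟨fun h => by simpa using key a⁻¹ _ h, key a q⟩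
    refine ⟨∑ q with q ∉ T, c q • v q, ?_⟩
    rw [nmLin_apply, nm]
    simp only [map_sum, map_smul]
    have h3 : ∀ a : C, ∑ q with q ∉ T, c q • ω a (v q) = ∑ q with q ∉ T, c (a⁻¹ • q) • v q :=
      fun a => by
        rw [Finset.sum_filter, Finset.sum_filter]
        conv_rhs => rw [← Equiv.sum_comp (MulAction.toPerm a)]
        exact Finset.sum_congr rfl fun q _ => by simp only [MulAction.toPerm_apply, hmT, hv, inv_smul_smul]
    have h4 : ∀ a : C, ∑ q with q ∉ T, c q • (ω.comp C.subtype a) (v q) =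
      ∑ q with q ∉ T, c (a⁻¹ • q) • v q := h3
    simp only [h4]
    rw [Finset.sum_comm]
    refine Finset.sum_congr rfl fun q hq => ?_
    rw [← Finset.sum_smul, hc q (hfree q (Finset.mem_filter.1 hq).2), one_smul]
  intro h
  have h3 : relNm ω S z = ∑ q ∈ T, v q + ∑ q with q ∉ T, v q := by
    have h4 : relNm ω S z = ∑ q, v q := by
      rw [relNm]
      congr 1
      ext; simp
    rw [h4, ← Finset.sum_filter_add_sum_filter_not Finset.univ (fun q => q ∈ T)]
    simp
  -- If the transfer were a norm, so would be `T.card • z`. Applying `e` would give `l ∣ T.card`,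
  -- against the index being prime to `l`.
  have h4 : (T.card : k) • z ∈ N := by
    rw [h3] at h
    simpa using sub_mem ((Submodule.add_mem_iff_left N h2).1 h) h1
  obtain ⟨y, hy⟩ := h4
  have h5 := congrArg e hy
  rw [nmLin_apply, he.map_nm, nm_trivial, hC, map_smul, smul_eq_mul, smul_eq_mul] at h5
  have h6 : (l : k) ∣ (T.card : k) := (hl.dvd_or_dvd ⟨_, h5.symm⟩).resolve_right hez
  exact hS ((hT.dvd_iff dvd_rfl).2 ((natCast_dvd_natCast_iff hl).1 h6))

/-- Approximate sections of a stable equivalence with the trivial representation. -/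
theorem StablyEquiv.exists_section {S : Type*} [Group S] [Finite S]
    {ω : Representation k S W} (h : StablyEquiv (trivial k S k) ω) :
    ∃ (z : W) (e b : W →ₗ[k] _) (a : k), (∀ s, ω s z = z) ∧ IsEquivariant ω (trivial k S k) e ∧
      e z = 1 + Nat.card S * a ∧ ∀ w, e w • z = w + tr ω ω b w := by
  obtain ⟨f, e, a, b, hf, he, hef, hfe⟩ := h
  refine ⟨f 1, e, b, a 1, fun s => (hf s 1).symm, he, ?_, fun w => ?_⟩
  · have := congr($hef 1)
    rw [LinearMap.add_apply, tr_apply_of_invariant _ fun _ => rfl, nm_trivial] at this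
    simpa using this
  · rw [← map_smul, smul_eq_mul, mul_one]
    exact congr($hfe w)

section Assoc

variable {V X Y : Type*} [AddCommMonoid V] [Module k V] [AddCommMonoid X] [Module k X]
  [AddCommMonoid Y] [Module k Y] {ρ : Representation k G V} {σ : Representation k G X}
  {τ : Representation k G Y}

theorem isEquivariant_assoc : IsEquivariant ((ρ.tprod σ).tprod τ) (ρ.tprod (σ.tprod τ))
    (_root_.TensorProduct.assoc k V X Y).toLinearMap := fun g v => by
  refine congr($(TensorProduct.ext_threefold (g := (_root_.TensorProduct.assoc k V X Y).toLinearMap ∘ₗ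
    (ρ.tprod σ).tprod τ g) (h := (ρ.tprod (σ.tprod τ)) g ∘ₗ
      (_root_.TensorProduct.assoc k V X Y).toLinearMap) fun x y z => ?_) v)
  simp

theorem isEquivariant_rid : IsEquivariant (ρ.tprod (trivial k G k)) ρ
    (_root_.TensorProduct.rid k V).toLinearMap := fun g v => by
  induction v with
  | zero => simp
  | tmul x y => simp
  | add x y hx hy => simp_all

end Assoc

variable (k G) in
/-- The square of the augmentation ideal. -/
abbrev augSq : Representation k G (aug k G ⊗[k] aug k G) := (augRep k G).tprod (augRep k G)

variable (k G) in
/-- The fourth tensor power of the augmentation ideal. -/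
abbrev augFour : Representation k G ((aug k G ⊗[k] aug k G) ⊗[k] (aug k G ⊗[k] aug k G)) :=
  (augSq k G).tprod (augSq k G)

theorem stablyEquiv_augSq : StablyEquiv
    (tprod (augRep k G) (tprod (augRep k G) (trivial k G k))) (augSq k G) :=
  (StablyEquiv.of_equiv (_root_.TensorProduct.rid k (aug k G)) isEquivariant_rid).tprod_left

theorem stablyEquiv_augFour : StablyEquiv
    (tprod (augRep k G) (tprod (augRep k G)
      (tprod (augRep k G) (tprod (augRep k G) (trivial k G k))))) (augFour k G) := by
  have h₁ := (stablyEquiv_augSq (k := k) (G := G)).tprod_left (τ := augRep k G)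
  have h₂ := h₁.tprod_left (τ := augRep k G)
  refine h₂.trans ?_
  exact (StablyEquiv.of_equiv _
    (isEquivariant_assoc (ρ := augRep k G) (σ := augRep k G) (τ := augSq k G))).symm

theorem exists_apply_eq_id_add_tr {S C : Subgroup G} (h : C ≤ S) {V : Type*} [AddCommMonoid V] [Module k V]
    {ρ : Representation k G V} (b : V →ₗ[k] V) :
    ∃ b' : V →ₗ[k] V, tr (ρ.comp S.subtype) (ρ.comp S.subtype) b =
      tr (ρ.comp C.subtype) (ρ.comp C.subtype) b' :=
  exists_tr_eq_tr_comp (ρ := ρ.comp S.subtype) (σ := ρ.comp S.subtype)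
    (Subgroup.inclusion_injective h) b

theorem exists_augSq_eq_id_add_tr {C : Subgroup G} {g : G} (hg : ∀ c ∈ C, Commute g c) :
    ∃ b, augSq k G g = LinearMap.id + tr ((augSq k G).comp C.subtype) ((augSq k G).comp C.subtype) b := by
  have h := exists_augRep_eq_id_add_tr k C.subtype_injective fun c : C => hg c c.2
  exact exists_tprod_eq_id_add_tr (fun c => hg c c.2) h h

theorem not_dvd_one_add {S C : Subgroup G} {l : ℕ} [Fact l.Prime] (hl : Prime (l : k))
    (hC : Nat.card C = l) (hCS : C ≤ S) (a : k) : ¬ (l : k) ∣ 1 + Nat.card S * a := by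
  have h1 : (l : k) ∣ (Nat.card S : k) := Nat.cast_dvd_cast (hC ▸ Subgroup.card_dvd_of_le hCS)
  rw [dvd_add_left (h1.mul_right a)]
  exact hl.not_dvd_one

/-- An invariant non-norm, from a central subgroup. -/
theorem exists_notMem_range_of_commute {ω : Representation k G W} {S C : Subgroup G} {l : ℕ} [Fact l.Prime]
    (hl : Prime (l : k)) (hC : Nat.card C = l) (hCS : C ≤ S) (hS : ¬ l ∣ S.index)
    (hω : ∀ g, ∃ b, ω g = LinearMap.id + tr (ω.comp C.subtype) (ω.comp C.subtype) b)
    (h : StablyEquiv (trivial k S k) (ω.comp S.subtype)) :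
    ∃ ζ, (∀ g, ω g ζ = ζ) ∧ ζ ∉ LinearMap.range (nmLin (ω.comp C.subtype)) := by
  obtain ⟨z, e, b, a, hz, he, hez, -⟩ := h.exists_section
  have hz' : ∀ s ∈ S, ω s z = z := fun s hs => hz ⟨s, hs⟩
  refine ⟨relNm ω S z, apply_relNm hz', relNm_notMem_range hl hC hS hz'
    (fun c w => he ⟨c, hCS c.2⟩ w) (hez ▸ not_dvd_one_add hl hC hCS a) fun g _ => ?_⟩
  obtain ⟨b, hb⟩ := hω g
  rw [hb]
  exact ⟨b z, by
    rw [LinearMap.add_apply, LinearMap.id_apply,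
      tr_apply_of_invariant _ fun c : C => hz' c (hCS c.2)]⟩

/-- An invariant non-norm in a tensor square, from a subgroup on which its normalizer acts through a
group of order two. -/
theorem exists_notMem_range_of_normalizer {ω : Representation k G W} {S C : Subgroup G} {l : ℕ} [Fact l.Prime]
    (hl : Prime (l : k)) (hC : Nat.card C = l) (hCS : C ≤ S) (hS : ¬ l ∣ S.index)
    (hfus : ∀ g, (∀ c ∈ C, g⁻¹ * c * g ∈ S) →
      (∀ c ∈ C, g⁻¹ * c * g ∈ C) ∧ ∀ c ∈ C, Commute (g * g) c)
    (hω : ∀ g, (∀ c ∈ C, Commute g c) →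
      ∃ b, ω g = LinearMap.id + tr (ω.comp C.subtype) (ω.comp C.subtype) b)
    (h : StablyEquiv (trivial k S k) (ω.comp S.subtype)) :
    ∃ ζ, (∀ g, ω.tprod ω g ζ = ζ) ∧
      ζ ∉ LinearMap.range (nmLin ((ω.tprod ω).comp C.subtype)) := by
  obtain ⟨z, e, b, a, hz, he, hez, heb⟩ := h.exists_section
  obtain ⟨b', hb'⟩ := exists_apply_eq_id_add_tr (ρ := ω) hCS b
  have hz' : ∀ s ∈ S, ω s z = z := fun s hs => hz ⟨s, hs⟩
  have hzz : ∀ s ∈ S, ω.tprod ω s (z ⊗ₜ z) = z ⊗ₜ z := fun s hs => by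
    rw [tprod_apply, TensorProduct.map_tmul, hz' s hs]
  have heC : IsEquivariant (ω.comp C.subtype) (trivial k C k) e :=
    fun c w => he ⟨c, hCS c.2⟩ w
  have hez' : ¬ (l : k) ∣ e z := hez ▸ not_dvd_one_add hl hC hCS a
  let e₂ : W ⊗[k] W →ₗ[k] k := (_root_.TensorProduct.lid k k).toLinearMap ∘ₗ TensorProduct.map e e
  have he₂ : IsEquivariant ((ω.tprod ω).comp C.subtype) (trivial k C k) e₂ :=
    fun c w => by
      have h1 : ∀ x, e (ω c x) = e x := heC c
      induction w with
      | zero => simp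
      | tmul x y => simp [e₂, h1]
      | add x y hx hy => simp only [map_add, hx, hy]
  have hez₂ : ¬ (l : k) ∣ e₂ (z ⊗ₜ z) := by
    simpa [e₂] using fun h => hez' ((hl.dvd_or_dvd h).elim id id)
  refine ⟨relNm (ω.tprod ω) S (z ⊗ₜ z), apply_relNm hzz,
    relNm_notMem_range (W := W ⊗[k] W) (ω := ω.tprod ω) hl hC hS hzz he₂ hez₂ fun g hg => ?_⟩
  obtain ⟨hgC, hgg⟩ := hfus g hg
  have hinv : ∀ c : C, ω.comp C.subtype c (ω g z) = ω g z := fun c => by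
    have h1 := congrArg (ω g) (hz' _ (hCS (hgC c c.2)))
    rwa [← Module.End.mul_apply, ← map_mul, mul_assoc, mul_inv_cancel_left, map_mul] at h1
  -- `g` normalises `C`, so `g z` is again `C`-invariant, and the approximate section expresses it
  -- as a multiple of `z` modulo norms.
  obtain ⟨y, hy⟩ : ∃ y, ω g z = e (ω g z) • z + nm (ω.comp C.subtype) y := by
    refine ⟨(-1 : k) • b' (ω g z), ?_⟩
    rw [heb, hb', tr_apply_of_invariant _ hinv, nm_smul, add_assoc]
    nth_rw 1 [← one_smul k (nm _ (b' _))]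
    rw [← add_smul, add_neg_cancel, zero_smul, add_zero]
  set μ := e (ω g z) with hμ
  obtain ⟨y', hy'⟩ : ∃ y', ω g (nm (ω.comp C.subtype) y) = nm (ω.comp C.subtype) y' := by
    let κ : C → C := fun c => ⟨g⁻¹ * c * g, hgC c c.2⟩
    have hκ : Function.Bijective κ := Finite.injective_iff_bijective.1 fun c d hcd => by
      simpa [κ] using hcd
    refine ⟨ω g y, ?_⟩
    rw [nm, map_sum, ← Equiv.sum_comp (Equiv.ofBijective κ hκ)]
    refine Finset.sum_congr rfl fun c _ => ?_
    change ω g (ω (g⁻¹ * c * g) y) = ω c (ω g y)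
    rw [← Module.End.mul_apply, ← Module.End.mul_apply, ← map_mul, ← map_mul, mul_assoc,
      mul_inv_cancel_left]
  obtain ⟨c, hc⟩ := hω (g * g) hgg
  -- Acting twice multiplies `z` by `μ²` modulo norms, whereas `g * g` centralises `C` and so fixes
  -- `z` modulo norms; `e` detects the difference modulo `l`.
  have hμ2 : (l : k) ∣ μ * μ - 1 := by
    have h1 : ω (g * g) z = (μ * μ) • z + nm (ω.comp C.subtype) (μ • y + y') := by
      rw [map_mul, Module.End.mul_apply, hy, map_add, map_smul, hy', hy, nm_add, nm_smul, smul_add,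
        smul_smul, add_assoc]
    rw [hc, LinearMap.add_apply, LinearMap.id_apply,
      tr_apply_of_invariant _ fun c : C => hz' c (hCS c.2)] at h1
    have h2 := congrArg e h1
    rw [map_add, map_add, heC.map_nm, heC.map_nm, nm_trivial, nm_trivial, hC, map_smul] at h2
    simp only [smul_eq_mul] at h2
    refine (hl.dvd_or_dvd (a := μ * μ - 1) (b := e z)
      ⟨e (c z) - e (μ • y + y'), ?_⟩).resolve_right hez'
    linear_combination -h2
  obtain ⟨t, ht⟩ := hμ2
  -- On the tensor square the factor is `μ² = 1 + l t`, and `l • z ⊗ z` is the norm from `C` of the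
  -- invariant vector `z ⊗ z`.
  have h3 : ω.tprod ω g (z ⊗ₜ z) = z ⊗ₜ z +
      nm ((ω.tprod ω).comp C.subtype) (t • z ⊗ₜ z + μ • (z ⊗ₜ y) + y ⊗ₜ ω g z) := by
    have e₀ : (ω.tprod ω).comp C.subtype =
        Representation.tprod (ω.comp C.subtype) (ω.comp C.subtype) := rfl
    have e₁ : nm ((ω.tprod ω).comp C.subtype) (z ⊗ₜ z) = (l : k) • z ⊗ₜ z := by
      rw [← hC]; exact nm_of_invariant fun c : C => hzz c (hCS c.2)
    have e₂ : nm ((ω.tprod ω).comp C.subtype) (z ⊗ₜ y) = z ⊗ₜ nm (ω.comp C.subtype) y := by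
      rw [e₀, nm_tmul_right (fun c : C => hz' c (hCS c.2))]
    have e₃ : nm ((ω.tprod ω).comp C.subtype) (y ⊗ₜ ω g z) =
        nm (ω.comp C.subtype) y ⊗ₜ ω g z := by
      rw [e₀, nm_tmul_left _ hinv]
    have e₄ : μ * μ = l * t + 1 := by linear_combination ht
    rw [nm_add, nm_add, nm_smul, nm_smul, e₁, e₂, e₃, tprod_apply, TensorProduct.map_tmul]
    nth_rw 1 [hy]
    rw [TensorProduct.add_tmul]
    nth_rw 1 [hy]
    rw [TensorProduct.tmul_add, TensorProduct.tmul_smul]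
    simp only [← TensorProduct.smul_tmul', smul_smul, e₄, add_smul, one_smul, mul_comm t]
    abel
  exact ⟨_, h3⟩

/-! ### Combining primes; non-norms as local generators. -/

variable {k G W : Type*} [CommRing k] [Group G] [Finite G] [AddCommMonoid W] [Module k W]

/-- Invariant non-norms for several primes can be combined. -/
theorem exists_forall_notMem_range {ω : Representation k G W} {L : Finset ℕ}
    (hL : ∀ l ∈ L, l.Prime) {C : ℕ → Subgroup G} (hC : ∀ l ∈ L, Nat.card (C l) = l)
    (h : ∀ l ∈ L, ∃ ζ, (∀ g, ω g ζ = ζ) ∧ ζ ∉ LinearMap.range (nmLin (ω.comp (C l).subtype))) :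
    ∃ ζ, (∀ g, ω g ζ = ζ) ∧ ∀ l ∈ L, ζ ∉ LinearMap.range (nmLin (ω.comp (C l).subtype)) := by
  classical
  let _ := Module.addCommMonoidToAddCommGroup k (M := W)
  choose! z hz hzn using h
  have hmem : ∀ l ∈ L, ∀ l' ∈ L, (l : k) • z l' ∈ LinearMap.range (nmLin (ω.comp (C l).subtype)) :=
    fun l hl l' hl' => ⟨z l', by
      rw [nmLin_apply, nm_of_invariant fun c : C l => hz l' hl' c, hC l hl]⟩
  -- The coefficient of `z l` is prime to `l`, and all other coefficients are divisible by `l`;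
  -- since `l` times an invariant vector is a norm from `C l`, only the term of `l` matters modulo
  -- such norms.
  refine ⟨∑ l ∈ L, ((∏ i ∈ L.erase l, i : ℕ) : k) • z l, fun g => ?_, fun l hl hmem' => ?_⟩
  · rw [map_sum]
    exact Finset.sum_congr rfl fun l hl => by rw [map_smul, hz l hl]
  · rw [← Finset.add_sum_erase _ _ hl] at hmem'
    have h1 := (Submodule.add_mem_iff_left _ (sum_mem fun l' hl' => ?_)).1 hmem'
    · have h2 : Nat.Coprime (∏ i ∈ L.erase l, i) l := Nat.Coprime.prod_left fun i hi =>
        (Nat.coprime_primes (hL i (Finset.mem_of_mem_erase hi)) (hL l hl)).2 (Finset.ne_of_mem_erase hi)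
      obtain ⟨u, v, huv⟩ := (Nat.isCoprime_iff_coprime.2 h2).map (Int.castRingHom k)
      simp only [map_natCast] at huv
      refine hzn l hl ?_
      rw [← one_smul k (z l), ← huv, add_smul, mul_smul, mul_smul]
      exact add_mem (Submodule.smul_mem _ _ h1) (Submodule.smul_mem _ _ (hmem l hl l hl))
    · obtain ⟨c, hc⟩ := Finset.dvd_prod_of_mem (fun i => i)
        (Finset.mem_erase.2 ⟨(Finset.ne_of_mem_erase hl').symm, hl⟩)
      rw [hc, Nat.cast_mul, mul_comm, mul_smul]
      exact Submodule.smul_mem _ _ (hmem l hl l' (Finset.mem_of_mem_erase hl'))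

/-- An invariant vector that is not a norm from a subgroup of prime order is a local generator. -/
theorem StablyEquiv.exists_section_of_notMem_range {ω : Representation k G W} {S C : Subgroup G}
    {l n : ℕ} [IsDomain k] [IsPrincipalIdealRing k] (hl : Prime (l : k)) (hC : Nat.card C = l) (hCS : C ≤ S)
    (hS : Nat.card S = l ^ n) (h : StablyEquiv (trivial k S k) (ω.comp S.subtype)) {ζ : W}
    (hζ : ∀ g, ω g ζ = ζ) (hζn : ζ ∉ LinearMap.range (nmLin (ω.comp C.subtype))) :
    ∃ (e : W →ₗ[k] k) (b : W →ₗ[k] W) (v : k),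
      IsEquivariant (ω.comp S.subtype) (trivial k S k) e ∧
      (∀ w, e w • ζ = w + tr (ω.comp S.subtype) (ω.comp S.subtype) b w) ∧
      e ζ = 1 + Nat.card S * v := by
  let _ := Module.addCommMonoidToAddCommGroup k (M := W)
  obtain ⟨z, e, b, a, hz, he, hez, heb⟩ := h.exists_section
  have h1 : e ζ • z = ζ + nm (ω.comp S.subtype) (b ζ) := by
    rw [heb, tr_apply_of_invariant _ fun s : S => hζ s]
  -- If `e ζ = l c`, then `e ζ • z` is the norm of `c • z` from `C`, and so `ζ` would itself be a
  -- norm from `C`.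
  have h2 : ¬ (l : k) ∣ e ζ := fun ⟨c, hc⟩ => by
    refine hζn ?_
    obtain ⟨y, hy⟩ := exists_nm_eq_nm_comp (ρ := ω.comp S.subtype)
      (Subgroup.inclusion_injective hCS) (b ζ)
    have h3 : nm (ω.comp C.subtype) (c • z) = (l : k) • c • z := by
      rw [← hC]
      exact nm_of_invariant fun s : C => by rw [map_smul]; exact congrArg _ (hz ⟨s, hCS s.2⟩)
    have h4 : ζ = nm (ω.comp C.subtype) (c • z - y) := by
      rw [nm_sub, h3, smul_smul, ← hc, h1, hy]
      exact (add_sub_cancel_right _ _).symm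
    rw [h4]
    exact nm_mem_range _ _
  have h5 : IsCoprime (e ζ) (Nat.card S : k) := by
    rw [hS, Nat.cast_pow]
    exact (hl.irreducible.coprime_iff_not_dvd.2 h2).symm.pow_right
  obtain ⟨u, v, huv⟩ := h5
  have hnm : ∀ (y w : W), tr (ω.comp S.subtype) (ω.comp S.subtype)
      (e.smulRight y) w = e w • nm (ω.comp S.subtype) y := fun y w => by
    rw [tr_apply, nm, Finset.smul_sum]
    refine Finset.sum_congr rfl fun s _ => ?_
    rw [LinearMap.smulRight_apply, map_smul, he]
    rfl
  -- `u` inverts `e ζ` modulo the order of `S`. By `hnm` the correction terms, multiples of norms by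
  -- values of `e`, are traces.
  refine ⟨u • e, b - v • e.smulRight z - u • e.smulRight (b ζ), -v, he.smul u, fun w => ?_, ?_⟩
  · simp only [tr_sub, tr_smul, LinearMap.sub_apply, LinearMap.smul_apply, hnm,
      nm_of_invariant hz]
    have h6 : ζ = e ζ • z - nm (ω.comp S.subtype) (b ζ) := by rw [h1]; abel
    have h7 := heb w
    rw [← sub_eq_iff_eq_add'] at h7
    rw [← h7]
    nth_rw 1 [h6]
    have h8 : u * e ζ = 1 - v * Nat.card S := by linear_combination huv
    rw [smul_eq_mul, smul_sub, smul_smul, mul_right_comm, h8]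
    module
  · rw [LinearMap.smul_apply, smul_eq_mul]
    linear_combination huv

theorem add_neg_one_smul (v : W) : v + (-1 : k) • v = 0 := by
  nth_rw 1 [← one_smul k v]
  rw [← add_smul, add_neg_cancel, zero_smul]

/-! ### Isomorphisms on invariants modulo norms, and the local-to-global criterion. -/

section TateIso

variable {U V : Type*} [AddCommMonoid V] [Module k V] [AddCommMonoid U] [Module k U]

/-- An equivariant map induces a bijection on invariants modulo norms. -/
def TateIso (ρ : Representation k G V) (σ : Representation k G W) : Prop :=
  ∃ f : V →ₗ[k] W, IsEquivariant ρ σ f ∧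
    (∀ v, (∀ g, ρ g v = v) → (∃ w, f v = nm σ w) → ∃ v', v = nm ρ v') ∧
    ∀ w, (∀ g, σ g w = w) → ∃ v, (∀ g, ρ g v = v) ∧ ∃ w', w = f v + nm σ w'

variable {ρ : Representation k G V} {σ : Representation k G W} {τ : Representation k G U}

theorem TateIso.of_equiv (e : V ≃ₗ[k] W) (he : IsEquivariant ρ σ e.toLinearMap) : TateIso ρ σ := by
  refine ⟨e, he, fun v _ ⟨w, hw⟩ => ⟨e.symm w, e.injective ?_⟩, fun w hw =>
    ⟨e.symm w, fun g => ?_, 0, ?_⟩⟩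
  · exact hw.trans ((congrArg (nm σ) (e.apply_symm_apply w).symm).trans (he.map_nm _).symm)
  · exact (he.symm g w).symm.trans (congrArg e.symm (hw g))
  · simp [nm]

theorem TateIso.trans (h : TateIso ρ σ) (h' : TateIso σ τ) : TateIso ρ τ := by
  obtain ⟨f, ef, hf, hf'⟩ := h
  obtain ⟨g, eg, hg, hg'⟩ := h'
  refine ⟨g ∘ₗ f, eg.comp ef, fun v hv hw => hf v hv (hg _ (fun a => ?_) hw), fun u hu => ?_⟩
  · rw [← ef, hv]
  · obtain ⟨w, hw, u', rfl⟩ := hg' u hu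
    obtain ⟨v, hv, w', rfl⟩ := hf' w hw
    exact ⟨v, hv, g w' + u', by rw [map_add, eg.map_nm, nm_add, add_assoc]; rfl⟩

/-- The contraction of `J` to `ℤ` is generated by a nonzero integer which no prime other than `p`
divides, hence by a power of `p` up to sign. -/
theorem exists_pow_mem_of_forall {J : Ideal k} {p N : ℕ} (hN : N ≠ 0) (hNJ : (N : k) ∈ J)
    (h : ∀ l : ℕ, l.Prime → l ≠ p → ∃ n : ℕ, ¬ l ∣ n ∧ (n : k) ∈ J) : ∃ n : ℕ, (p : k) ^ n ∈ J := by
  obtain ⟨d, hd⟩ := IsPrincipalIdealRing.principal (J.comap (Int.castRingHom k))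
  have hmem : ∀ n : ℕ, (n : k) ∈ J ↔ d.natAbs ∣ n := fun n => by
    rw [← Int.natCast_dvd_natCast, Int.dvd_natCast, Int.natAbs_natCast, ← Int.natCast_dvd_natCast,
      Int.natAbs_dvd, ← Ideal.mem_span_singleton]
    change _ ↔ (n : ℤ) ∈ Submodule.span ℤ {d}
    rw [← hd, Ideal.mem_comap]
    simp
  have h1 := Nat.eq_prime_pow_of_unique_prime_dvd (n := d.natAbs) (p := p)
    (fun h0 => hN (by simpa [h0] using (hmem N).1 hNJ)) fun {l} hl hld => by
      by_contra hlp
      obtain ⟨n, hn, hnJ⟩ := h l hl hlp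
      exact hn (hld.trans ((hmem n).1 hnJ))
  exact ⟨_, by rw [← Nat.cast_pow, ← h1, hmem]⟩

/-- Multiplication by a local generator is bijective on invariants modulo norms. -/
theorem TateIso.of_local {M : Type*} [AddCommMonoid M] [Module k M] {ω : Representation k G W}
    {τ : Representation k G M} {p : ℕ} {φ : M →ₗ[k] M} (eφ : IsEquivariant τ τ φ)
    (hφ : ∀ m, (p : k) • φ m = m) {ζ : W} (hζ : ∀ g, ω g ζ = ζ)
    (hloc : ∀ l : ℕ, l.Prime → l ≠ p → ∃ S : Subgroup G, ¬ l ∣ S.index ∧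
      ∃ (e : W →ₗ[k] k) (b : W →ₗ[k] W) (v : k),
        IsEquivariant (ω.comp S.subtype) (trivial k S k) e ∧
        (∀ w, e w • ζ = w + tr (ω.comp S.subtype) (ω.comp S.subtype) b w) ∧
        e ζ = 1 + Nat.card S * v) : TateIso τ (ω.tprod τ) := by
  have hψ : ∀ n : ℕ, ∃ ψ : M →ₗ[k] M, IsEquivariant τ τ ψ ∧ ∀ m, (p : k) ^ n • ψ m = m := by
    intro n
    induction n with
    | zero => exact ⟨.id, .id, fun m => by simp⟩
    | succ n ih =>
      obtain ⟨ψ, eψ, hψ⟩ := ih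
      exact ⟨φ ∘ₗ ψ, eφ.comp eψ, fun m => by
        rw [pow_succ, mul_smul, LinearMap.comp_apply, hφ, hψ]⟩
  let f : M →ₗ[k] W ⊗[k] M := TensorProduct.mk k W M ζ
  have ef : IsEquivariant τ (ω.tprod τ) f := fun g m => by simp [f, hζ]
  have key : ∀ l : ℕ, l.Prime → l ≠ p → ∃ n : ℕ, ¬ l ∣ n ∧
      (∀ x, (∀ g, ω.tprod τ g x = x) → ∃ v, (∀ g, τ g v = v) ∧
        ∃ w, (n : k) • x = f v + nm (ω.tprod τ) w) ∧
      ∀ m, (∀ g, τ g m = m) → (∃ y, f m = nm (ω.tprod τ) y) →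
        ∃ m', (n : k) • m = nm τ m' := fun l hl hlp => by
    obtain ⟨S, hS, e, b, v, he, heb, hev⟩ := hloc l hl hlp
    -- Over `S`, contraction with `e` inverts multiplication by `ζ` modulo traces. Summing over the
    -- cosets of `S` brings this back to `G` at the cost of the factor `S.index`.
    let E : W ⊗[k] M →ₗ[k] M := (_root_.TensorProduct.lid k M).toLinearMap ∘ₗ
      TensorProduct.map e LinearMap.id
    have hE : ∀ w m, E (w ⊗ₜ m) = e w • m := fun w m => by simp [E]
    have eE : IsEquivariant ((ω.tprod τ).comp S.subtype) (τ.comp S.subtype) E := fun s x => by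
      have h1 : ∀ w, e (ω s w) = e w := he s
      induction x with
      | zero => simp
      | tmul w m => simp [hE, h1]
      | add x y hx hy => simp only [map_add, hx, hy]
    have e₀ : (ω.tprod τ).comp S.subtype =
        Representation.tprod (ω.comp S.subtype) (τ.comp S.subtype) := rfl
    have hid : IsEquivariant (τ.comp S.subtype) (τ.comp S.subtype) LinearMap.id := .id
    have h1 : ∀ x, f (E x) = x + tr ((ω.tprod τ).comp S.subtype) ((ω.tprod τ).comp S.subtype)
        (TensorProduct.map b LinearMap.id) x := fun x => by
      rw [e₀, ← tr_map_left (ρ := ω.comp S.subtype) (σ := ω.comp S.subtype) b hid]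
      induction x with
      | zero => simp
      | tmul w m =>
        rw [hE, TensorProduct.map_tmul, LinearMap.id_apply, ← TensorProduct.add_tmul, ← heb,
          TensorProduct.smul_tmul]
        rfl
      | add x y hx hy =>
        rw [map_add, map_add, map_add, hx, hy]
        abel
    refine ⟨S.index, hS, fun x hx => ?_, fun m hm ⟨y, hy⟩ => ?_⟩
    · have hEx : ∀ s ∈ S, τ s (E x) = E x := fun s hs =>
        (eE ⟨s, hs⟩ x).symm.trans (congrArg E (hx s))
      have h2 := congrArg (relNm (ω.tprod τ) S) (h1 x)
      rw [tr_apply_of_invariant _ fun s : S => hx s, relNm_add, relNm_nm,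
        relNm_of_invariant hx] at h2
      have h3 : relNm (ω.tprod τ) S (f (E x)) = f (relNm τ S (E x)) := by
        simp only [relNm, map_sum, ef _ _]
      rw [h3] at h2
      refine ⟨_, apply_relNm hEx, (-1 : k) • TensorProduct.map b LinearMap.id x, ?_⟩
      rw [h2, nm_smul, add_assoc, add_neg_one_smul, add_zero]
    · obtain ⟨y', hy'⟩ := exists_nm_eq_nm_comp (ρ := ω.tprod τ) S.subtype_injective y
      have h2 : m + ((Nat.card S : k) * v) • m = nm (τ.comp S.subtype) (E y') := by
        rw [← eE.map_nm, ← hy', ← hy]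
        change _ = E (ζ ⊗ₜ m)
        rw [hE, hev, add_smul, one_smul]
      have h3 : m = nm (τ.comp S.subtype) (E y' + (-1 : k) • v • m) := by
        have h4 : nm (τ.comp S.subtype) m = (Nat.card S : k) • m :=
          nm_of_invariant fun s : S => hm s
        rw [nm_add, nm_smul, nm_smul, h4, ← h2, smul_smul v,
          mul_comm v, add_assoc, add_neg_one_smul, add_zero]
      refine ⟨E y' + (-1 : k) • v • m, ?_⟩
      rw [← relNm_nm (S := S), ← h3, relNm_of_invariant hm]
  have hG : (Nat.card G : ℕ) ≠ 0 := Nat.card_pos.ne'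
  refine ⟨f, ef, fun m hm ⟨y, hy⟩ => ?_, fun x hx => ?_⟩
  -- `J` annihilates the kernel on invariants modulo norms. It contains the order of `G` and an
  -- integer prime to `l` for each `l ≠ p`, hence a power of `p`, which is invertible on `M`. The
  -- cokernel is treated in the same way.
  · let J : Ideal k :=
      { carrier := {r | ∀ m, (∀ g, τ g m = m) → (∃ y, f m = nm (ω.tprod τ) y) →
          ∃ m', r • m = nm τ m'}
        add_mem' := fun {r s} hr hs m hm hy => by
          obtain ⟨a, ha⟩ := hr m hm hy
          obtain ⟨b, hb⟩ := hs m hm hy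
          exact ⟨a + b, by rw [add_smul, ha, hb, nm_add]⟩
        zero_mem' := fun m _ _ => ⟨0, by simp [nm]⟩
        smul_mem' := fun c r hr m hm hy => by
          obtain ⟨a, ha⟩ := hr m hm hy
          exact ⟨c • a, by rw [smul_assoc, ha, nm_smul]⟩ }
    obtain ⟨n, hn⟩ := exists_pow_mem_of_forall (J := J) (p := p) hG
      (fun m hm _ => ⟨m, (nm_of_invariant hm).symm⟩) fun l hl hlp => by
        obtain ⟨n, hn, -, h⟩ := key l hl hlp
        exact ⟨n, hn, h⟩
    obtain ⟨ψ, eψ, hψ⟩ := hψ n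
    obtain ⟨m', hm'⟩ := hn (ψ m) (fun g => by rw [← eψ, hm])
      ⟨TensorProduct.map LinearMap.id ψ y, by
        rw [← (IsEquivariant.id.map eψ).map_nm, ← hy]; rfl⟩
    exact ⟨m', by rw [← hm', hψ]⟩
  · let J : Ideal k :=
      { carrier := {r | ∀ x, (∀ g, ω.tprod τ g x = x) → ∃ v, (∀ g, τ g v = v) ∧
          ∃ w, r • x = f v + nm (ω.tprod τ) w}
        add_mem' := fun {r s} hr hs x hx => by
          obtain ⟨a, ha, a', ha'⟩ := hr x hx
          obtain ⟨b, hb, b', hb'⟩ := hs x hx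
          exact ⟨a + b, fun g => by rw [map_add, ha, hb], a' + b', by
            rw [add_smul, ha', hb', nm_add, map_add]; abel⟩
        zero_mem' := fun x _ => ⟨0, by simp, 0, by simp [nm]⟩
        smul_mem' := fun c r hr x hx => by
          obtain ⟨a, ha, a', ha'⟩ := hr x hx
          exact ⟨c • a, fun g => by rw [map_smul, ha], c • a', by
            rw [smul_assoc, ha', nm_smul, map_smul, smul_add]⟩ }
    obtain ⟨n, hn⟩ := exists_pow_mem_of_forall (J := J) (p := p) hG
      (fun x hx => ⟨0, by simp, x, by rw [nm_of_invariant hx, map_zero, zero_add]⟩)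
      fun l hl hlp => by
        obtain ⟨n, hn, h, -⟩ := key l hl hlp
        exact ⟨n, hn, h⟩
    obtain ⟨ψ, eψ, hψ⟩ := hψ n
    have h1 : ∀ x : W ⊗[k] M, (p : k) ^ n • TensorProduct.map LinearMap.id ψ x = x := fun x => by
      induction x with
      | zero => simp
      | tmul w m => rw [TensorProduct.map_tmul, ← TensorProduct.tmul_smul, hψ]; rfl
      | add x y hx hy => rw [map_add, smul_add, hx, hy]
    obtain ⟨v, hv, w, hw⟩ := hn (TensorProduct.map LinearMap.id ψ x) fun g => by
      rw [← IsEquivariant.id.map eψ, hx]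
    exact ⟨v, hv, w, by rw [← hw, h1]⟩

end TateIso

/-! ### Comparison with group homology: acyclic modules. -/

variable {k G : Type u} [CommRing k] [Group G]

section Morphisms

variable {V W X : Type u} [AddCommGroup V] [Module k V] [AddCommGroup W] [Module k W]
  [AddCommGroup X] [Module k X]
  {ρ : Representation k G V} {σ : Representation k G W} {τ : Representation k G X}

/-- The morphism of `Rep k G` given by an equivariant map. -/
def IsEquivariant.repHom {f : V →ₗ[k] W} (hf : IsEquivariant ρ σ f) : Rep.of ρ ⟶ Rep.of σ :=
  Rep.ofHom (f.intertwiningMap_of_isIntertwiningMap ρ σ hf)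

theorem IsEquivariant.shortExact {i : V →ₗ[k] W} {π : W →ₗ[k] X} (hi : IsEquivariant ρ σ i)
    (hπ : IsEquivariant σ τ π) (inj : Function.Injective i) (surj : Function.Surjective π)
    (hex : LinearMap.range i = LinearMap.ker π) :
    ∃ h : hi.repHom ≫ hπ.repHom = 0, (ShortComplex.mk hi.repHom hπ.repHom h).ShortExact := by
  have h0 : ∀ v, π (i v) = 0 := fun v => by
    have : i v ∈ LinearMap.ker π := hex ▸ LinearMap.mem_range_self i v
    simpa using this
  refine ⟨Rep.hom_ext (IntertwiningMap.ext (LinearMap.ext h0)), ?_⟩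
  refine { exact := ?_, mono_f := (Rep.mono_iff_injective _).2 inj,
           epi_g := (Rep.epi_iff_surjective _).2 surj }
  rw [← ShortComplex.exact_map_iff_of_faithful _ (forget₂ (Rep.{u} k G) (ModuleCat.{u} k)),
    ShortComplex.moduleCat_exact_iff_range_eq_ker]
  exact hex

end Morphisms

variable [Finite G]

/-- Function representations have no higher homology. -/
theorem isZero_groupHomology_funRep {V : Type u} [AddCommGroup V] [Module k V]
    (ρ : Representation k G V) (n : ℕ) :
    IsZero (groupHomology (Rep.of (funRep ρ G)) (n + 1)) := by
  classical
  let A : Rep k (⊥ : Subgroup G) := Rep.trivial k (⊥ : Subgroup G) V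
  let s : (G → V) →ₗ[k] IndV (⊥ : Subgroup G).subtype A.ρ :=
    -- Untwisting by `ρ` makes the function representation a retract of the induction of `V` from
    -- the trivial subgroup, whose higher homology vanishes by Shapiro's lemma.
    ∑ x : G, IndV.mk (⊥ : Subgroup G).subtype A.ρ x⁻¹ ∘ₗ ρ x⁻¹ ∘ₗ LinearMap.proj x
  have es : IsEquivariant (funRep ρ G) (ind (⊥ : Subgroup G).subtype A.ρ) s := fun g f => by
    simp only [s, LinearMap.sum_apply, map_sum]
    refine (Fintype.sum_equiv (Equiv.mulLeft g) _ _ fun x => ?_).symm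
    rw [LinearMap.comp_apply, ind_mk]
    simp only [Equiv.coe_mulLeft, mul_inv_rev, LinearMap.comp_apply, LinearMap.proj_apply, funRep_apply]
    simp
  let r : Rep.ind (⊥ : Subgroup G).subtype A ⟶ Rep.of (funRep ρ G) :=
    (Rep.indResHomEquiv (⊥ : Subgroup G).subtype A (Rep.of (funRep ρ G))).symm
      (Rep.ofHom ⟨LinearMap.single k (fun _ : G => V) 1, fun g => by
        obtain rfl : g = 1 := Subsingleton.elim _ _
        ext; simp⟩)
  have hsr : es.repHom ≫ r = 𝟙 (Rep.of (funRep ρ G)) := by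
    have hr : ∀ (h : G) (a : V), r.hom (IndV.mk (⊥ : Subgroup G).subtype A.ρ h a) =
        funRep ρ G h⁻¹ (Pi.single 1 a) := fun h a => by
      simp [r, A]
    refine Rep.hom_ext (IntertwiningMap.ext (LinearMap.ext fun f => funext fun y => ?_))
    change r.hom (s f) y = f y
    simp only [s, LinearMap.sum_apply, map_sum, LinearMap.comp_apply _ (_ ∘ₗ _), hr]
    rw [Finset.sum_apply, Finset.sum_eq_single y]
    · simp
    · intro x _ hxy
      simp [inv_mul_eq_one, hxy]
    · simp
  have : IsZero (groupHomology (Rep.ind (⊥ : Subgroup G).subtype A) (n + 1)) :=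
    (_root_.isZero_groupHomology_succ_of_subsingleton A n).of_iso
      (groupHomology.indIso _ A (n + 1))
  rw [IsZero.iff_id_eq_zero]
  have h2 := congrArg (groupHomology.functor k G (n + 1)).map hsr
  rw [CategoryTheory.Functor.map_comp, CategoryTheory.Functor.map_id] at h2
  refine h2.symm.trans ?_
  have h3 : (groupHomology.functor k G (n + 1)).map r = 0 := this.eq_zero_of_src _
  rw [h3, comp_zero]
  rfl

/-! ### Invariants modulo norms, and dimension shifting. -/

section TateZero

variable {V W : Type u} [AddCommGroup V] [Module k V] [AddCommGroup W] [Module k W]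
  {ρ : Representation k G V} {σ : Representation k G W}

theorem nm_mem_invariants (ρ : Representation k G V) (v : V) : nm ρ v ∈ ρ.invariants :=
  fun g => apply_nm g v

variable (ρ) in
/-- The invariants modulo norms. -/
abbrev TateZero : Type u := ρ.invariants ⧸ LinearMap.range
  ((nmLin ρ).codRestrict ρ.invariants fun v => nmLin_apply ρ v ▸ nm_mem_invariants ρ v)

theorem mem_range_nm_iff (v : ρ.invariants) : v ∈ LinearMap.range ((nmLin ρ).codRestrict
    ρ.invariants fun v => nmLin_apply ρ v ▸ nm_mem_invariants ρ v) ↔ ∃ w, v.1 = nm ρ w := by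
  constructor
  · rintro ⟨w, rfl⟩
    exact ⟨w, nmLin_apply ρ w⟩
  · rintro ⟨w, hw⟩
    exact ⟨w, Subtype.ext ((nmLin_apply ρ w).trans hw.symm)⟩

theorem TateIso.nonempty_addEquiv (h : TateIso ρ σ) : Nonempty (TateZero ρ ≃+ TateZero σ) := by
  obtain ⟨f, ef, hf, hf'⟩ := h
  let f' : ρ.invariants →ₗ[k] σ.invariants := (f ∘ₗ ρ.invariants.subtype).codRestrict _
    fun v g => by rw [LinearMap.comp_apply, ← ef]; exact congrArg f (v.2 g)
  let q := Submodule.mapQ _ (LinearMap.range ((nmLin σ).codRestrict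
    σ.invariants fun v => nmLin_apply σ v ▸ nm_mem_invariants σ v)) f' (fun v hv => by
      obtain ⟨w, hw⟩ := (mem_range_nm_iff v).1 hv
      exact (mem_range_nm_iff (f' v)).2 ⟨f w, by rw [← ef.map_nm, ← hw]; rfl⟩)
  refine ⟨(LinearEquiv.ofBijective q ⟨(injective_iff_map_eq_zero q).2 fun x hx => ?_,
    fun y => ?_⟩).toAddEquiv⟩
  · obtain ⟨v, rfl⟩ := Submodule.Quotient.mk_surjective _ x
    rw [Submodule.mapQ_apply, Submodule.Quotient.mk_eq_zero, mem_range_nm_iff] at hx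
    rw [Submodule.Quotient.mk_eq_zero, mem_range_nm_iff]
    exact hf v.1 v.2 hx
  · obtain ⟨w, rfl⟩ := Submodule.Quotient.mk_surjective _ y
    obtain ⟨v, hv, w', hw'⟩ := hf' w.1 w.2
    refine ⟨Submodule.Quotient.mk ⟨v, hv⟩, ?_⟩
    rw [Submodule.mapQ_apply, eq_comm, Submodule.Quotient.eq, mem_range_nm_iff]
    exact ⟨w', by
      change w.1 - f v = _
      rw [hw', add_sub_cancel_left]⟩

/-- The norm vanishes on the kernel of the map to the coinvariants. -/
theorem nm_eq_zero_of_mem_ker {v : V} (hv : v ∈ Coinvariants.ker ρ) : nm ρ v = 0 := by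
  have : Coinvariants.ker ρ ≤ LinearMap.ker (nmLin ρ) := by
    rw [Coinvariants.ker, Submodule.span_le]
    rintro _ ⟨⟨g, x⟩, rfl⟩
    simp [nmLin_apply, nm_sub, nm_apply]
  simpa [nmLin_apply] using this hv

/-- For a relatively projective representation, the norm is injective on coinvariants. -/
theorem mem_ker_of_nm_eq_zero {θ : V →ₗ[k] V} (hθ : tr ρ ρ θ = LinearMap.id) {v : V}
    (hv : nm ρ v = 0) : v ∈ Coinvariants.ker ρ := by
  have h1 : v = ∑ g, (ρ g (θ (ρ g⁻¹ v)) - θ (ρ g⁻¹ v)) := by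
    have h2 : ∑ g, θ (ρ g⁻¹ v) = 0 := by
      rw [← map_sum]
      exact (congrArg θ ((Equiv.sum_comp (Equiv.inv G) fun g => ρ g v).trans hv)).trans (map_zero θ)
    rw [Finset.sum_sub_distrib, h2, sub_zero, ← tr_apply, hθ]
    rfl
  rw [h1]
  exact sum_mem fun g _ => Submodule.subset_span ⟨(g, _), rfl⟩

theorem H0π_eq_zero_iff {v : V} :
    groupHomology.H0π (Rep.of ρ) v = 0 ↔ v ∈ Coinvariants.ker ρ := by
  have h1 : (groupHomology.H0Iso (Rep.of ρ)).hom (groupHomology.H0π (Rep.of ρ) v) =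
      Coinvariants.mk ρ v :=
    congr($(groupHomology.H0π_comp_H0Iso_hom (Rep.of ρ)) v)
  rw [← Coinvariants.mk_eq_zero, ← h1]
  refine ⟨fun h => by rw [h, map_zero], fun h => ?_⟩
  have := congrArg (groupHomology.H0Iso (Rep.of ρ)).inv h
  simpa using this

variable {T : Type u} [AddCommGroup T] [Module k T] {τ : Representation k G T} {i : T →ₗ[k] (G → V)}

theorem apply_eq_of_invariant (ei : IsEquivariant τ (funRep ρ G) i) {w : T}
    (hw : ∀ g, τ g w = w) (x : G) : i w x = ρ x (i w 1) := by
  have := congrFun (ei x w) x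
  rwa [hw, funRep_apply, inv_smul_eq_iff.2 (by simp : x = x • 1)] at this

theorem nm_apply_one (ei : IsEquivariant τ (funRep ρ G) i) (y : T) :
    i (nm τ y) 1 = ∑ h, ρ h (i y h⁻¹) := by
  rw [ei.map_nm, nm, Finset.sum_apply]
  simp

/-- For the kernel of the summation map of a function representation, the invariants modulo norms
are a submodule of the coinvariants. -/
theorem exists_tateZero_linearMap (ei : IsEquivariant τ (funRep ρ G) i)
    (inj : Function.Injective i) (hex : LinearMap.range i = LinearMap.ker (sumMap k G V)) :
    ∃ a : TateZero τ →ₗ[k] groupHomology (Rep.of ρ) 0,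
      Function.Injective a ∧ ∀ x, x ∈ LinearMap.range a ↔
        ∃ v, groupHomology.H0π (Rep.of ρ) v = x ∧ nm ρ v = 0 := by
  classical
  have hsum : ∀ w, ∑ x, i w x = 0 := fun w => by
    have h1 : i w ∈ LinearMap.ker (sumMap k G V) := hex ▸ LinearMap.mem_range_self _ _
    rwa [LinearMap.mem_ker, sumMap_apply] at h1
  have hlift : ∀ f : G → V, ∑ x, f x = 0 → ∃ w, i w = f := fun f hf => by
    have h1 : f ∈ LinearMap.range i := hex ▸ (by rwa [LinearMap.mem_ker, sumMap_apply])
    exact h1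
  have hinv : ∀ w : τ.invariants, ∑ x, ρ x (i w.1 1) = 0 := fun w => by
    rw [← hsum w.1]
    exact Finset.sum_congr rfl fun x _ => (apply_eq_of_invariant ei w.2 x).symm
  -- An invariant `w` satisfies `i w x = ρ x (i w 1)`, so it is determined by its value at `1`; that
  -- value has norm zero because the values of `i w` sum to zero.
  let a₀ : τ.invariants →ₗ[k] groupHomology (Rep.of ρ) 0 :=
    (groupHomology.H0π (Rep.of ρ)).hom ∘ₗ LinearMap.proj 1 ∘ₗ i ∘ₗ τ.invariants.subtype
  have ha₀ : ∀ w, a₀ w = groupHomology.H0π (Rep.of ρ) (i w.1 1) := fun w => rfl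
  have hker : LinearMap.range ((nmLin τ).codRestrict τ.invariants
      fun v => nmLin_apply τ v ▸ nm_mem_invariants τ v) = LinearMap.ker a₀ := by
    ext w
    rw [mem_range_nm_iff, LinearMap.mem_ker, ha₀, H0π_eq_zero_iff]
    constructor
    · rintro ⟨y, hy⟩
      rw [hy, nm_apply_one ei]
      have h1 : ∑ h : G, i y h⁻¹ = 0 := (Equiv.sum_comp (Equiv.inv G) (i y)).trans (hsum y)
      rw [← sub_zero (∑ h : G, _), ← h1, ← Finset.sum_sub_distrib]
      exact sum_mem fun g _ => Submodule.subset_span ⟨(g, _), rfl⟩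
    · intro h
      have key : Coinvariants.ker ρ ≤ LinearMap.range (LinearMap.proj 1 ∘ₗ i ∘ₗ nmLin τ) := by
        rw [Coinvariants.ker, Submodule.span_le]
        rintro _ ⟨⟨g, x⟩, rfl⟩
        -- The norm of this `y` takes the value `ρ g x - x` at `1`.
        obtain ⟨y, hy⟩ := hlift (Pi.single g⁻¹ x - Pi.single 1 x) (by simp)
        refine ⟨y, ?_⟩
        simp only [LinearMap.comp_apply, nmLin_apply, LinearMap.proj_apply]
        rw [nm_apply_one ei, hy]
        simp only [Pi.sub_apply, map_sub, Finset.sum_sub_distrib]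
        rw [Finset.sum_eq_single g, Finset.sum_eq_single 1]
        · simp
        · intro b _ hb
          simp [hb]
        · simp
        · intro b _ hb
          simp [hb]
        · simp
      obtain ⟨y, hy⟩ := key h
      have hy : i (nm τ y) 1 = i w.1 1 := by rw [← hy, ← nmLin_apply]; rfl
      refine ⟨y, inj (funext fun x => ?_)⟩
      rw [apply_eq_of_invariant ei w.2, apply_eq_of_invariant ei (nm_mem_invariants τ y), hy]
  refine ⟨Submodule.liftQ _ a₀ hker.le, ?_, fun x => ?_⟩
  · rw [← LinearMap.ker_eq_bot, Submodule.ker_liftQ, ← hker, Submodule.mkQ_map_self]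
  · rw [Submodule.range_liftQ]
    constructor
    · rintro ⟨w, rfl⟩
      exact ⟨_, rfl, hinv w⟩
    · rintro ⟨v, rfl, hv⟩
      obtain ⟨w, hw⟩ := hlift (fun x => ρ x v) hv
      refine ⟨⟨w, fun g => inj ?_⟩, ?_⟩
      · rw [ei, hw]
        ext x
        simp [← Module.End.mul_apply, ← map_mul]
      · rw [ha₀, hw]
        simp

/-- The norm is injective on the coinvariants of a function representation, and it commutes with the
injection `j`. -/
theorem map_H0π_eq_zero_iff {U : Type u} [AddCommGroup U] [Module k U]
    {υ : Representation k G U} {j : U →ₗ[k] (G → W)}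
    (ej : IsEquivariant υ (funRep σ G) j) (jnj : Function.Injective j) (u : U) :
    (groupHomology.map (A := Rep.of υ) (B := Rep.of (funRep σ G)) (MonoidHom.id G) ej.repHom 0).hom
      (groupHomology.H0π (Rep.of υ) u) = 0 ↔ nm υ u = 0 := by
  have h1 : (groupHomology.map (A := Rep.of υ) (B := Rep.of (funRep σ G))
      (MonoidHom.id G) ej.repHom 0).hom
      (groupHomology.H0π (Rep.of υ) u) = groupHomology.H0π (Rep.of (funRep σ G)) (j u) :=
    congr($(groupHomology.H0π_comp_map (A := Rep.of υ)
        (B := Rep.of (funRep σ G)) (MonoidHom.id G) ej.repHom) u)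
  rw [h1, H0π_eq_zero_iff]
  constructor
  · intro h
    have h2 := nm_eq_zero_of_mem_ker h
    rw [← ej.map_nm] at h2
    exact jnj (h2.trans (map_zero _).symm)
  · intro h
    obtain ⟨θ, hθ⟩ := tr_funRep_comp σ (φ := MonoidHom.id G) Function.injective_id
    refine mem_ker_of_nm_eq_zero (ρ := funRep σ G) (θ := θ) hθ ?_
    rw [← ej.map_nm, h, map_zero]

/-- The map is the connecting homomorphism. It is injective because functions are acyclic, and its
image is the kernel of the norm on `H₀`, the same submodule as in `exists_tateZero_linearMap`. -/
theorem exists_groupHomology_one_linearMap {U : Type u} [AddCommGroup U] [Module k U]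
    {υ : Representation k G U} {j : U →ₗ[k] (G → W)}
    (ej : IsEquivariant υ (funRep σ G) j) (jnj : Function.Injective j)
    (jex : LinearMap.range j = LinearMap.ker (sumMap k G W)) :
    ∃ b : groupHomology (Rep.of σ) 1 →ₗ[k] groupHomology (Rep.of υ) 0,
      Function.Injective b ∧ ∀ x, x ∈ LinearMap.range b ↔
        ∃ u, groupHomology.H0π (Rep.of υ) u = x ∧ nm υ u = 0 := by
  obtain ⟨h0, hX⟩ := ej.shortExact (isEquivariant_sumMap (B := G) σ) jnj sumMap_surjective jex
  refine ⟨(groupHomology.δ hX 1 0 rfl).hom, (ModuleCat.mono_iff_injective _).1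
    (groupHomology.mono_δ_of_isZero hX 0 (isZero_groupHomology_funRep σ 0)), fun x => ?_⟩
  have hS := groupHomology.mapShortComplex₁_exact hX (i := 1) (j := 0) rfl
  have h2 := SetLike.ext_iff.1 hS.moduleCat_range_eq_ker x
  refine h2.trans ⟨fun hx => ?_, ?_⟩
  · obtain ⟨u, rfl⟩ := (ModuleCat.epi_iff_surjective (groupHomology.H0π (Rep.of υ))).1
      inferInstance x
    exact ⟨u, rfl, (map_H0π_eq_zero_iff ej jnj u).1 hx⟩
  · rintro ⟨u, rfl, hu⟩
    exact (map_H0π_eq_zero_iff ej jnj u).2 hu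

theorem nonempty_linearEquiv_of_range_eq {A B C : Type*} [AddCommGroup A] [AddCommGroup B]
    [AddCommGroup C] [Module k A] [Module k B] [Module k C] {a : A →ₗ[k] C} {b : B →ₗ[k] C}
    (ha : Function.Injective a) (hb : Function.Injective b)
    (h : LinearMap.range b = LinearMap.range a) : Nonempty (B ≃ₗ[k] A) :=
  ⟨(LinearEquiv.ofInjective b hb).trans ((LinearEquiv.ofEq _ _ h).trans
    (LinearEquiv.ofInjective a ha).symm)⟩

/-- Dimension shifting from the first homology. -/
theorem nonempty_groupHomology_one_addEquiv {U : Type u} [AddCommGroup U] [Module k U]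
    {υ : Representation k G U} {j : U →ₗ[k] (G → W)} {i : T →ₗ[k] (G → U)}
    (ei : IsEquivariant τ (funRep υ G) i) (inj : Function.Injective i)
    (hex : LinearMap.range i = LinearMap.ker (sumMap k G U))
    (ej : IsEquivariant υ (funRep σ G) j) (jnj : Function.Injective j)
    (jex : LinearMap.range j = LinearMap.ker (sumMap k G W)) :
    Nonempty (groupHomology (Rep.of σ) 1 ≃+ TateZero τ) := by
  obtain ⟨a, ha, har⟩ := exists_tateZero_linearMap ei inj hex
  obtain ⟨b, hb, hbr⟩ := exists_groupHomology_one_linearMap ej jnj jex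
  obtain ⟨e⟩ := nonempty_linearEquiv_of_range_eq ha hb
    (Submodule.ext fun x => (hbr x).trans (har x).symm)
  exact ⟨e.toAddEquiv⟩

/-- Dimension shifting along a short exact sequence with acyclic middle term. -/
theorem nonempty_groupHomology_succ_addEquiv {X : Type u} [AddCommGroup X] [Module k X]
    {τ : Representation k G X} {i : V →ₗ[k] (G → W)} {π : (G → W) →ₗ[k] X}
    (hi : IsEquivariant ρ (funRep σ G) i) (hπ : IsEquivariant (funRep σ G) τ π)
    (inj : Function.Injective i) (surj : Function.Surjective π)
    (hex : LinearMap.range i = LinearMap.ker π) (n : ℕ) :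
    Nonempty (groupHomology (Rep.of τ) (n + 2) ≃+ groupHomology (Rep.of ρ) (n + 1)) := by
  obtain ⟨h0, hX⟩ := hi.shortExact hπ inj surj hex
  have := groupHomology.isIso_δ_of_isZero hX (n + 1) (isZero_groupHomology_funRep σ (n + 1))
    (isZero_groupHomology_funRep σ n)
  exact ⟨(asIso (groupHomology.δ hX (n + 2) (n + 1) rfl)).toLinearEquiv.toAddEquiv⟩

end TateZero

/-! ### Iterated shifts, periodicity, and the four groups for trivial coefficients. -/

section Shift

variable {k G : Type u} [CommRing k] [Group G] [Finite G]

/-- The tensor product with the augmentation ideal. -/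
def shift (A : Rep.{u} k G) : Rep.{u} k G :=
  Rep.of (X := aug k G ⊗[k] A.V) (tprod (augRep k G) A.ρ)

theorem nonempty_groupHomology_shift_addEquiv (A : Rep.{u} k G) (n : ℕ) :
    Nonempty (groupHomology A (n + 2) ≃+ groupHomology (shift A) (n + 1)) :=
  nonempty_groupHomology_succ_addEquiv (V := (shift A).V) (σ := A.ρ) (isEquivariant_augEmb A.ρ)
    (isEquivariant_sumMap (B := G) A.ρ) augEmb_injective sumMap_surjective range_augEmb n

/-- Homology in degree `n + 1` is Tate cohomology in degree `-(n + 2)`, and each shift raises the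
degree by one. -/
theorem nonempty_groupHomology_addEquiv_tateZero (A : Rep.{u} k G) (n : ℕ) :
    Nonempty (groupHomology A (n + 1) ≃+ TateZero (shift^[n + 2] A).ρ) := by
  induction n generalizing A with
  | zero =>
    exact nonempty_groupHomology_one_addEquiv (U := (shift A).V)
      (T := (shift (shift A)).V) (isEquivariant_augEmb (shift A).ρ) augEmb_injective range_augEmb
      (isEquivariant_augEmb A.ρ) augEmb_injective range_augEmb
  | succ n ih =>
    obtain ⟨e⟩ := nonempty_groupHomology_shift_addEquiv A n
    obtain ⟨e'⟩ := ih (shift A)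
    exact ⟨e.trans e'⟩

/-- Multiplication by `p` is invertible on the representation. -/
def IsDivisibleBy (p : ℕ) (A : Rep.{u} k G) : Prop :=
  ∃ φ : A.V →ₗ[k] A.V, IsEquivariant A.ρ A.ρ φ ∧ ∀ v, (p : k) • φ v = v

theorem IsDivisibleBy.shift {p : ℕ} {A : Rep.{u} k G} (h : IsDivisibleBy p A) :
    IsDivisibleBy p (shift A) := by
  obtain ⟨φ, eφ, hφ⟩ := h
  refine ⟨TensorProduct.map LinearMap.id φ, IsEquivariant.id.map eφ,
    fun v : aug k G ⊗[k] A.V => ?_⟩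
  change (p : k) • TensorProduct.map LinearMap.id φ v = v
  induction v with
  | zero => simp
  | tmul x y => rw [TensorProduct.map_tmul, ← TensorProduct.tmul_smul, hφ, LinearMap.id_apply]
  | add x y hx hy => rw [map_add, smul_add, hx, hy]

theorem IsDivisibleBy.iterate_shift {p : ℕ} {A : Rep.{u} k G} (h : IsDivisibleBy p A) (n : ℕ) :
    IsDivisibleBy p (Representation.shift^[n] A) := by
  induction n with
  | zero => exact h
  | succ n ih => rw [Function.iterate_succ_apply']; exact ih.shift

theorem TateIso.iterate_shift {A : Rep.{u} k G} (h : TateIso A.ρ ((augFour k G).tprod A.ρ)) :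
    TateIso A.ρ (shift^[4] A).ρ := by
  let τ₂ : Representation k G (aug k G ⊗[k] (aug k G ⊗[k] A.V)) :=
    tprod (augRep k G) (tprod (augRep k G) A.ρ)
  have h₁ : TateIso ((augFour k G).tprod A.ρ) ((augSq k G).tprod ((augSq k G).tprod A.ρ)) :=
    .of_equiv _ isEquivariant_assoc
  have h₂ : TateIso ((augSq k G).tprod ((augSq k G).tprod A.ρ)) ((augSq k G).tprod τ₂) :=
    .of_equiv (TensorProduct.congr (.refl _ _) (_root_.TensorProduct.assoc k _ _ _))
      (IsEquivariant.id.map isEquivariant_assoc)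
  have h₃ : TateIso ((augSq k G).tprod τ₂) (tprod (augRep k G) (tprod (augRep k G) τ₂)) :=
    .of_equiv _ isEquivariant_assoc
  exact h.trans (h₁.trans (h₂.trans h₃))

variable (k G) in
/-- Tate cohomology with coefficients in which `p` is invertible has period four. -/
def IsPeriodic (p : ℕ) : Prop :=
  ∀ A : Rep.{u} k G, IsDivisibleBy p A → TateIso A.ρ ((augFour k G).tprod A.ρ)

variable {p : ℕ}

theorem IsPeriodic.nonempty_tateZero_addEquiv (h : IsPeriodic k G p) {A : Rep.{u} k G}
    (hA : IsDivisibleBy p A) (m : ℕ) :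
    Nonempty (TateZero (shift^[4 * m] A).ρ ≃+ TateZero A.ρ) := by
  induction m with
  | zero => exact ⟨.refl _⟩
  | succ m ih =>
    obtain ⟨e⟩ := ih
    obtain ⟨e'⟩ := (h _ (hA.iterate_shift (4 * m))).iterate_shift.nonempty_addEquiv
    rw [Nat.mul_succ, add_comm, Function.iterate_add_apply]
    exact ⟨e'.symm.trans e⟩

theorem IsPeriodic.nonempty_groupHomology_addEquiv (h : IsPeriodic k G p) {A : Rep.{u} k G}
    (hA : IsDivisibleBy p A) {n m r : ℕ} (hn : n + 1 = 4 * m + r) (hn0 : n ≠ 0) :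
    Nonempty (groupHomology A n ≃+ TateZero (shift^[r] A).ρ) := by
  obtain ⟨n, rfl⟩ := Nat.exists_eq_succ_of_ne_zero hn0
  obtain ⟨e⟩ := nonempty_groupHomology_addEquiv_tateZero A n
  obtain ⟨e'⟩ := h.nonempty_tateZero_addEquiv (hA.iterate_shift r) m
  rw [← Function.iterate_add_apply, ← hn] at e'
  exact ⟨e.trans e'⟩

variable {M : Type u} [AddCommGroup M] [Module k M]

/-- An invariant element is a constant function with sum zero, so its value is killed by the order
of `G`. -/
theorem subsingleton_tateZero_shift_trivial (hM : ∀ m : M, (Nat.card G : k) • m = 0 → m = 0) :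
    Subsingleton (TateZero (shift (Rep.trivial k G M)).ρ) := by
  refine subsingleton_of_forall_eq 0 fun x => ?_
  obtain ⟨⟨w, hw⟩, rfl⟩ := Submodule.Quotient.mk_surjective _ x
  have h1 : ∀ x, augEmb k G M w x = augEmb k G M w 1 := fun x =>
    apply_eq_of_invariant (T := (shift (Rep.trivial k G M)).V)
      (isEquivariant_augEmb (trivial k G M)) hw x
  have h2 : augEmb k G M w ∈ LinearMap.ker (sumMap k G M) :=
    range_augEmb (k := k) (G := G) (V := M) ▸ LinearMap.mem_range_self _ _
  rw [LinearMap.mem_ker, sumMap_apply, Finset.sum_congr rfl fun x _ => h1 x, Finset.sum_const,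
    Finset.card_univ, Fintype.card_eq_nat_card, ← Nat.cast_smul_eq_nsmul k] at h2
  have h3 : w = (0 : aug k G ⊗[k] M) := augEmb_injective (funext fun x => by
    rw [h1, hM _ h2, map_zero]; rfl)
  subst h3
  exact Submodule.Quotient.mk_zero _

/-- `H₁` is `Gᵃᵇ ⊗ M`, where `p` kills the first factor and divides every element of the second. -/
theorem subsingleton_H1_trivial {φ : M →ₗ[k] M} (hφ : ∀ m, (p : k) • φ m = m)
    (hG : ∀ x : Abelianization G, x ^ p = 1) :
    Subsingleton (groupHomology (Rep.trivial k G M) 1) := by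
  refine (groupHomology.H1AddEquivOfIsTrivial (Rep.trivial k G M)).toEquiv.subsingleton_congr.2 ?_
  refine subsingleton_of_forall_eq 0 fun x => ?_
  induction x with
  | zero => rfl
  | tmul a m =>
    have h1 : m = (p : ℤ) • φ m := by
      rw [natCast_zsmul, ← Nat.cast_smul_eq_nsmul k, hφ]
    have h2 : (p : ℤ) • a = 0 := (natCast_zsmul a p).trans (hG a)
    rw [h1, ← TensorProduct.smul_tmul, h2, TensorProduct.zero_tmul]
  | add x y hx hy => rw [hx, hy, add_zero]

theorem nonempty_tateZero_trivial_addEquiv {Z : Type*} [AddCommGroup Z] (f : M →+ Z)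
    (hf : Function.Surjective f) (hker : ∀ m, f m = 0 ↔ ∃ m', m = (Nat.card G : k) • m') :
    Nonempty (TateZero (trivial k G M) ≃+ Z) := by
  let f' : (trivial k G M).invariants →+ Z := f.comp (Submodule.subtype _).toAddMonoidHom
  refine ⟨(QuotientAddGroup.quotientAddEquivOfEq (AddSubgroup.ext fun x => ?_)).trans
    (QuotientAddGroup.quotientKerEquivOfSurjective f' fun z => ?_)⟩
  · refine (mem_range_nm_iff x).trans (Iff.symm ((hker x.1).trans ?_))
    simp only [nm_trivial]
  · obtain ⟨m, rfl⟩ := hf z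
    exact ⟨⟨m, fun _ => rfl⟩, rfl⟩

/-- The diagonal embedding. -/
def constMap (k G M : Type*) [CommRing k] [AddCommGroup M] [Module k M] : M →ₗ[k] (G → M) :=
  LinearMap.pi fun _ => LinearMap.id

theorem isEquivariant_constMap : IsEquivariant (trivial k G M) (funRep (trivial k G M) G)
    (constMap k G M) := fun _ _ => rfl

/-- Functions modulo constant functions. -/
def funModConst (k G M : Type u) [CommRing k] [Group G] [Finite G] [AddCommGroup M] [Module k M] :
    Representation k G ((G → M) ⧸ LinearMap.range (constMap k G M)) where
  toFun g := Submodule.mapQ _ _ (funRep (trivial k G M) G g) (by rintro _ ⟨m, rfl⟩; exact ⟨m, rfl⟩)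
  map_one' := by ext; simp
  map_mul' g h := by
    refine Submodule.linearMap_qext _ (LinearMap.ext fun x => ?_)
    simp [map_mul]

/-- This is the vanishing of `H¹(G, M) = Hom(G, M)`. A translate of a representative `y` differs
from `y` by a constant, which the order of the group element kills; so `y` is invariant, hence
constant. -/
theorem subsingleton_tateZero_funModConst (hM : ∀ n : ℕ, n ≠ 0 → ∀ m : M, (n : k) • m = 0 → m = 0) :
    Subsingleton (TateZero (funModConst k G M)) := by
  refine subsingleton_of_forall_eq 0 fun x => ?_
  obtain ⟨⟨w, hw⟩, rfl⟩ := Submodule.Quotient.mk_surjective _ x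
  obtain ⟨y, rfl⟩ := Submodule.Quotient.mk_surjective _ w
  have h1 : ∀ g, funRep (trivial k G M) G g y = y := fun g => by
    obtain ⟨c, hc⟩ := (Submodule.Quotient.eq _).1 (hw g)
    have h2 : ∀ n : ℕ, funRep (trivial k G M) G (g ^ n) y = y + constMap k G M ((n : k) • c) := fun n => by
      induction n with
      | zero => simp
      | succ n ih =>
        rw [pow_succ', map_mul, Module.End.mul_apply, ih, map_add, ← isEquivariant_constMap,
          eq_add_of_sub_eq hc.symm, Nat.cast_succ, add_smul, one_smul, map_add]
        simp only [trivial_apply]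
        abel
    have h3 := h2 (orderOf g)
    rw [pow_orderOf_eq_one, map_one, Module.End.one_apply, left_eq_add] at h3
    have h4 := hM _ (orderOf_pos g).ne' c (congrFun h3 1)
    rw [eq_add_of_sub_eq hc.symm, h4, map_zero, zero_add]
  have h2 : (Submodule.Quotient.mk y : (G → M) ⧸ LinearMap.range (constMap k G M)) = 0 := by
    rw [Submodule.Quotient.mk_eq_zero]
    refine ⟨y 1, funext fun g => ?_⟩
    have := congrFun (h1 g) g
    simp only [funRep_apply, smul_eq_mul, inv_mul_cancel, trivial_apply] at this
    exact this
  rw [Submodule.Quotient.mk_eq_zero, mem_range_nm_iff]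
  exact ⟨0, h2.trans (by simp [nm])⟩

theorem isDivisibleBy_funModConst {φ : M →ₗ[k] M} (hφ : ∀ m, (p : k) • φ m = m) :
    IsDivisibleBy p (Rep.of (funModConst k G M)) := by
  refine ⟨Submodule.mapQ _ _ (LinearMap.pi fun x => φ ∘ₗ LinearMap.proj x)
    (by rintro _ ⟨m, rfl⟩; exact ⟨φ m, rfl⟩), fun g v => ?_, fun v => ?_⟩
  · obtain ⟨y, rfl⟩ := Submodule.Quotient.mk_surjective _ v
    rfl
  · obtain ⟨y, rfl⟩ := Submodule.Quotient.mk_surjective _ v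
    change Submodule.Quotient.mk ((p : k) • fun x => φ (y x)) = _
    exact congrArg _ (funext fun x => hφ _)

theorem nonempty_groupHomology_funModConst_addEquiv (n : ℕ) :
    Nonempty (groupHomology (Rep.of (funModConst k G M)) (n + 2) ≃+
      groupHomology (Rep.trivial k G M) (n + 1)) :=
  nonempty_groupHomology_succ_addEquiv (π := Submodule.mkQ _) isEquivariant_constMap
    (fun _ _ => rfl) (fun _ _ h => congrFun h 1) (Submodule.mkQ_surjective _)
    (Submodule.ker_mkQ _).symm n

/-- The homology of a group with periodic Tate cohomology. -/
theorem IsPeriodic.groupHomology_trivial (h : IsPeriodic k G p) {φ : M →ₗ[k] M}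
    (hφ : ∀ m, (p : k) • φ m = m) (hM : ∀ n : ℕ, n ≠ 0 → ∀ m : M, (n : k) • m = 0 → m = 0)
    (hG : ∀ x : Abelianization G, x ^ p = 1) {Z : Type*} [AddCommGroup Z] (f : M →+ Z)
    (hf : Function.Surjective f) (hker : ∀ m, f m = 0 ↔ ∃ m', m = (Nat.card G : k) • m')
    {n : ℕ} (hn : 1 ≤ n) :
    (n ≡ 3 [MOD 4] → Nonempty (groupHomology (Rep.trivial k G M) n ≃+ Z)) ∧
    (¬ n ≡ 3 [MOD 4] → Subsingleton (groupHomology (Rep.trivial k G M) n)) := by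
  have hdiv : IsDivisibleBy p (Rep.trivial k G M) := ⟨φ, fun _ _ => rfl, hφ⟩
  constructor
  · intro hn3
    obtain ⟨e⟩ := h.nonempty_groupHomology_addEquiv hdiv (n := n) (m := (n + 1) / 4) (r := 0)
      (by have : n % 4 = 3 := hn3; lia) (by lia)
    obtain ⟨e'⟩ := nonempty_tateZero_trivial_addEquiv f hf hker
    exact ⟨e.trans e'⟩
  · intro hn3
    have hn3 : n % 4 ≠ 3 := hn3
    obtain hr | hr | hr : n % 4 = 0 ∨ n % 4 = 1 ∨ n % 4 = 2 := by lia
    · obtain ⟨e⟩ := h.nonempty_groupHomology_addEquiv hdiv (n := n) (m := n / 4) (r := 1)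
        (by lia) (by lia)
      have : Subsingleton (TateZero (shift^[1] (Rep.trivial k G M)).ρ) :=
        subsingleton_tateZero_shift_trivial (k := k) (G := G) (hM _ Nat.card_pos.ne')
      exact e.toEquiv.subsingleton
    · obtain ⟨e⟩ := h.nonempty_groupHomology_addEquiv hdiv (n := n) (m := n / 4) (r := 2)
        (by lia) (by lia)
      obtain ⟨e'⟩ := nonempty_groupHomology_addEquiv_tateZero (Rep.trivial k G M) 0
      have := subsingleton_H1_trivial hφ hG
      exact (e.trans e'.symm).toEquiv.subsingleton
    -- This case would require three shifts. Embedding `M` in the functions on `G` moves one degree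
    -- the other way, so the quotient is needed with no shift at all.
    · obtain ⟨m, rfl⟩ : ∃ m, n = m + 1 := ⟨n - 1, by lia⟩
      obtain ⟨e⟩ := nonempty_groupHomology_funModConst_addEquiv (k := k) (G := G) (M := M) m
      obtain ⟨e'⟩ := h.nonempty_groupHomology_addEquiv (isDivisibleBy_funModConst hφ)
        (n := m + 2) (m := (m + 3) / 4) (r := 0) (by lia) (by lia)
      have : Subsingleton (TateZero (shift^[0] (Rep.of (funModConst k G M))).ρ) :=
        subsingleton_tateZero_funModConst (G := G) hM
      exact (e.symm.trans e').toEquiv.subsingleton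

end Shift

/-! ### From local generators to global periodicity. -/

section LocalGenerator

variable {k G : Type u} [CommRing k] [Group G] [Finite G] {l : ℕ}

variable (k G l) in
/-- A Sylow `l`-subgroup is stably four-periodic, and there is an invariant vector which is not a
norm from a subgroup of order `l`. -/
def HasLocalGenerator : Prop :=
  ∃ (S C : Subgroup G) (n : ℕ), Nat.card C = l ∧ C ≤ S ∧ Nat.card S = l ^ n ∧ ¬ l ∣ S.index ∧
    StablyEquiv (trivial k S k) ((augFour k G).comp S.subtype) ∧
    ∃ ζ, (∀ g, augFour k G g ζ = ζ) ∧ ζ ∉ LinearMap.range (nmLin ((augFour k G).comp C.subtype))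

theorem tr_of_subsingleton {H V : Type*} [Group H] [Finite H] [Subsingleton H] [AddCommMonoid V]
    [Module k V] {ρ : Representation k H V} (b : V →ₗ[k] V) : tr ρ ρ b = b := by
  ext v
  rw [tr_apply, Fintype.sum_subsingleton _ 1]
  simp

theorem isPeriodic_of_hasLocalGenerator [IsDomain k] [IsPrincipalIdealRing k]
    (hk : ∀ l : ℕ, l.Prime → Prime (l : k)) {p : ℕ}
    (h : ∀ l : ℕ, l.Prime → l ≠ p → l ∣ Nat.card G → HasLocalGenerator k G l) :
    IsPeriodic k G p := by
  intro A ⟨φ, eφ, hφ⟩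
  choose! S C n hC hCS hS hSi hst hζ using h
  let L := (Nat.card G).primeFactors.erase p
  have hL : ∀ l ∈ L, l.Prime ∧ l ≠ p ∧ l ∣ Nat.card G := fun l hl =>
    ⟨Nat.prime_of_mem_primeFactors (Finset.mem_of_mem_erase hl), Finset.ne_of_mem_erase hl,
      Nat.dvd_of_mem_primeFactors (Finset.mem_of_mem_erase hl)⟩
  obtain ⟨ζ, hζ, hζn⟩ := exists_forall_notMem_range (ω := augFour k G) (L := L) (C := C)
    (fun l hl => (hL l hl).1) (fun l hl => hC l (hL l hl).1 (hL l hl).2.1 (hL l hl).2.2)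
    fun l hl => hζ l (hL l hl).1 (hL l hl).2.1 (hL l hl).2.2
  refine TateIso.of_local eφ hφ hζ fun l hl hlp => ?_
  by_cases hlG : l ∣ Nat.card G
  · exact ⟨S l, hSi l hl hlp hlG, (hst l hl hlp hlG).exists_section_of_notMem_range (hk l hl)
      (hC l hl hlp hlG) (hCS l hl hlp hlG) (hS l hl hlp hlG) hζ
      (hζn l (Finset.mem_erase.2 ⟨hlp, Nat.mem_primeFactors.2 ⟨hl, hlG, Nat.card_pos.ne'⟩⟩))⟩
  -- At primes not dividing the order of `G` the trivial subgroup suffices: every map is its own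
  -- trace there, so `e = 0` and `b = -1` satisfy the conditions.
  · refine ⟨⊥, by rwa [Subgroup.index_bot], 0, (-1 : k) • LinearMap.id, -1, fun _ _ => rfl,
      fun w => ?_, by simp⟩
    rw [tr_smul, LinearMap.smul_apply, tr_of_subsingleton, LinearMap.id_apply, add_neg_one_smul,
      LinearMap.zero_apply, zero_smul]

/-- Tensoring the hypothesis with the square itself gives the chain `k ~ I² ~ I² ⊗ k ~ I² ⊗ I²`. -/
theorem StablyEquiv.augFour_of_augSq {S : Subgroup G}
    (h : StablyEquiv (trivial k S k) ((augSq k G).comp S.subtype)) :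
    StablyEquiv (trivial k S k) ((augFour k G).comp S.subtype) := by
  have e₀ : (augFour k G).comp S.subtype =
    Representation.tprod ((augSq k G).comp S.subtype) ((augSq k G).comp S.subtype) := rfl
  rw [e₀]
  have h₁ : StablyEquiv (Representation.tprod ((augSq k G).comp S.subtype) (trivial k S k))
      ((augSq k G).comp S.subtype) := .of_equiv _ isEquivariant_rid
  exact h.trans (h₁.symm.trans h.tprod_left)

theorem hasLocalGenerator_of_isCyclic {S C : Subgroup G} {n : ℕ} (hl : l.Prime)
    (hk : Prime (l : k)) (hC : Nat.card C = l) (hCS : C ≤ S) (hS : Nat.card S = l ^ n)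
    (hSi : ¬ l ∣ S.index) [IsCyclic S]
    (hfus : ∀ g, (∀ c ∈ C, g⁻¹ * c * g ∈ S) →
      (∀ c ∈ C, g⁻¹ * c * g ∈ C) ∧ ∀ c ∈ C, Commute (g * g) c) :
    HasLocalGenerator k G l := by
  have := Fact.mk hl
  have h : StablyEquiv (trivial k S k) ((augSq k G).comp S.subtype) :=
    (stablyEquiv_of_isCyclic S.subtype_injective).trans
      (stablyEquiv_augSq.comp S.subtype_injective)
  exact ⟨S, C, n, hC, hCS, hS, hSi, h.augFour_of_augSq,
    exists_notMem_range_of_normalizer hk hC hCS hSi hfus (fun _ hg => exists_augSq_eq_id_add_tr hg) h⟩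

theorem hasLocalGenerator_of_commute {S C : Subgroup G} {n : ℕ} (hl : l.Prime)
    (hk : Prime (l : k)) (hC : Nat.card C = l) (hCS : C ≤ S) (hS : Nat.card S = l ^ n)
    (hSi : ¬ l ∣ S.index) (hcomm : ∀ g : G, ∀ c ∈ C, Commute g c)
    (h : StablyEquiv (trivial k S k) ((tprod (augRep k G) (tprod (augRep k G)
      (tprod (augRep k G) (tprod (augRep k G) (trivial k G k))))).comp S.subtype)) :
    HasLocalGenerator k G l := by
  have := Fact.mk hl
  have h' : StablyEquiv (trivial k S k) ((augFour k G).comp S.subtype) :=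
    h.trans (stablyEquiv_augFour.comp S.subtype_injective)
  exact ⟨S, C, n, hC, hCS, hS, hSi, h', exists_notMem_range_of_commute hk hC hCS hSi
    (fun g => exists_tprod_eq_id_add_tr (ρ := augSq k G) (σ := augSq k G)
      (φ := C.subtype) (fun c => hcomm g c c.2)
      (exists_augSq_eq_id_add_tr (hcomm g)) (exists_augSq_eq_id_add_tr (hcomm g))) h'⟩

end LocalGenerator

/-! ### Groups acting freely on the nonzero vectors of a plane. -/

section PlaneAction

open scoped LinearAlgebra.Projectivization Pointwise

variable {S K V : Type*} [Group S] [Finite S] [Field K] [Finite K] [AddCommGroup V] [Module K V]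
  [DistribMulAction S V] [SMulCommClass S K V]

/-- An `l`-group acting freely on the nonzero vectors of a plane with a fixed line is cyclic. -/
theorem isCyclic_of_free_action (hV : Module.finrank K V = 2) {l : ℕ} [Fact l.Prime]
    (hS : IsPGroup l S) (hK : ¬ l ∣ Nat.card K + 1)
    (hfree : ∀ (s : S) (v : V), v ≠ 0 → s • v = v → s = 1) : IsCyclic S := by
  have : Module.Finite K V := Module.finite_of_finrank_pos (by lia)
  have : Finite V := Module.finite_of_finite K
  -- The projective line has `|K| + 1` points, a number prime to `l`, so some line is preserved. The
  -- character of `S` on it is injective by freeness.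
  obtain ⟨L, hL⟩ := hS.nonempty_fixed_point_of_prime_not_dvd_card (ℙ K V)
    (by rwa [Projectivization.card_of_finrank_two _ _ hV])
  induction L with | h v hv =>
  have h1 : ∀ s : S, ∃ a : Kˣ, a • v = s • v := fun s =>
    (Projectivization.mk_eq_mk_iff _ _ _ _ _).1 (hL s)
  choose χ hχ using h1
  have hinj : Function.Injective fun a : K => a • v := smul_left_injective K hv
  have hχ' : ∀ s : S, (χ s : K) • v = s • v := hχ
  let f : S →* K :=
    { toFun := fun s => χ s
      map_one' := hinj (by simp [hχ'])
      map_mul' := fun s t => hinj (by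
        simp only [hχ', mul_smul]
        rw [← hχ' t, smul_comm, ← hχ' s, smul_comm]) }
  refine isCyclic_of_injective_ringHom f ((injective_iff_map_eq_one f).2 fun s hs => ?_)
  refine hfree s v hv ?_
  rw [← hχ' s]
  change f s • v = v
  rw [hs, one_smul]

theorem not_two_dvd_choose {n : ℕ} (hn : n % 4 = 1) : ¬ 2 ∣ (n + 1).choose 2 := by
  obtain ⟨m, rfl⟩ : ∃ m, n = 4 * m + 1 := ⟨n / 4, by lia⟩
  have h : (4 * m + 1 + 1).choose 2 = 2 * (4 * m * m + 3 * m) + 1 := by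
    rw [Nat.choose_two_right]
    exact Nat.div_eq_of_eq_mul_left two_pos (by simp; ring)
  lia

/-- A `2`-group acting freely on the nonzero vectors of a plane, whose involutions act as `-1`, is
stably four-periodic. -/
theorem stablyEquiv_of_free_action (hV : Module.finrank K V = 2) (hS : IsPGroup 2 S)
    (hK : Nat.card K % 4 = 1) (hfree : ∀ (s : S) (v : V), v ≠ 0 → s • v = v → s = 1)
    (hinv : ∀ s : S, s * s = 1 → s = 1 ∨ ∀ v : V, s • v = -v)
    {k G : Type*} [CommRing k] [IsDomain k] [CharZero k] [IsPrincipalIdealRing k] [Group G]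
    [Finite G] {φ : S →* G} (hφ : Function.Injective φ) :
    StablyEquiv (trivial k S k) ((tprod (augRep k G) (tprod (augRep k G)
      (tprod (augRep k G) (tprod (augRep k G) (trivial k G k))))).comp φ) := by
  classical
  have : Module.Finite K V := Module.finite_of_finrank_pos (by lia)
  have : Finite V := Module.finite_of_finite K
  have : Fact (Nat.Prime 2) := ⟨Nat.prime_two⟩
  -- The number of unordered pairs of lines is odd because `|K| ≡ 1` modulo `4`, so `S` preserves
  -- one pair, possibly exchanging its lines.
  obtain ⟨P, hP⟩ := hS.nonempty_fixed_point_of_prime_not_dvd_card (Set.powersetCard (ℙ K V) 2) (by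
    rw [Set.powersetCard.card, Projectivization.card_of_finrank_two _ _ hV]
    exact not_two_dvd_choose hK)
  obtain ⟨L₁, L₂, hL, hPL⟩ := Finset.card_eq_two.1 P.2
  have hPg : ∀ (g : S) (L : ℙ K V), L ∈ P.1 → g • L ∈ P.1 := fun g L h => by
    have h1 : g • P.1 = P.1 := congrArg Subtype.val (hP g)
    rw [← h1]
    exact Finset.smul_mem_smul_finset h
  let Y := {v : V // ∃ h : v ≠ 0, Projectivization.mk K v h ∈ P.1}
  let line : Y → ℙ K V := fun y => Projectivization.mk K y.1 y.2.1
  let _ : MulAction S Y :=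
    { smul := fun s y => ⟨s • y.1, (smul_ne_zero_iff_ne s).2 y.2.1, hPg s _ y.2.2⟩
      one_smul := fun y => Subtype.ext (one_smul S y.1)
      mul_smul := fun s t y => Subtype.ext (mul_smul s t y.1) }
  have hline : ∀ (s : S) (y : Y), line (s • y) = s • line y := fun _ _ => rfl
  have hmk : ∀ (a : Kˣ) (v : V) (h : v ≠ 0) (h' : a • v ≠ 0),
      Projectivization.mk K (a • v) h' = Projectivization.mk K v h := fun a v h h' =>
    (Projectivization.mk_eq_mk_iff _ _ _ _ _).2 ⟨a, rfl⟩
  have hmem : ∀ (a : Kˣ) (y : Y), ∃ h : a • y.1 ≠ 0, Projectivization.mk K (a • y.1) h ∈ P.1 :=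
    fun a y => ⟨(smul_ne_zero_iff_ne a).2 y.2.1, by rw [hmk]; exact y.2.2⟩
  obtain ⟨u, hu⟩ := IsCyclic.exists_monoid_generator (α := Kˣ)
  let σ : Equiv.Perm Y :=
    { toFun := fun y => ⟨u • y.1, hmem u y⟩
      invFun := fun y => ⟨u⁻¹ • y.1, hmem u⁻¹ y⟩
      left_inv := fun y => Subtype.ext (inv_smul_smul u y.1)
      right_inv := fun y => Subtype.ext (smul_inv_smul u y.1) }
  have hσn : ∀ (n : ℕ) (y : Y), ((σ ^ n) y).1 = u ^ n • y.1 := fun n y => by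
    induction n with
    | zero => simp
    | succ n ih =>
      rw [pow_succ', Equiv.Perm.mul_apply, pow_succ', mul_smul, ← ih]
      rfl
  let π : Y → Bool := fun y => decide (line y = L₁)
  have hPmem : ∀ y : Y, line y = L₁ ∨ line y = L₂ := fun y => by
    have h1 : ∀ L, L ∈ P.1 → L = L₁ ∨ L = L₂ := by simp [hPL]
    exact h1 _ y.2.2
  have hπ : ∀ x y, π x = π y ↔ line x = line y := fun x y => by
    refine ⟨fun h => ?_, fun h => by simp [π, h]⟩
    have h1 : line x = L₁ ↔ line y = L₁ := by simpa [π] using h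
    rcases hPmem x with hx | hx
    · rw [hx, h1.1 hx]
    · rcases hPmem y with hy | hy
      · exact (h1.2 hy).trans hy.symm
      · exact hx.trans hy.symm
  have hex : ∀ L ∈ P.1, ∃ y : Y, line y = L := fun L hLP => by
    induction L with | h v hv => exact ⟨⟨v, hv, hLP⟩, rfl⟩
  obtain ⟨x₀, hx₀⟩ := hex L₁ (by simp [hPL])
  obtain ⟨y₀, hy₀⟩ := hex L₂ (by simp [hPL])
  refine Join.stablyEquiv (Y := Y) (π := π) (σ := σ) hφ (fun x => (hπ _ _).2 (hmk u _ _ _))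
    (fun x y hxy => ?_) (fun s y => Subtype.ext ?_) (fun s x y hxy => ?_) (fun s x hx => ?_)
    (fun s x y hxy hyx hne => ?_) (x₀ := x₀) (y₀ := y₀) (by simp [π, hx₀])
    (by simp [π, hy₀, hL.symm])
  · obtain ⟨a, ha⟩ := (Projectivization.mk_eq_mk_iff _ _ _ _ _).1 ((hπ x y).1 hxy).symm
    obtain ⟨n, hn⟩ := hu a
    exact ⟨n, Subtype.ext ((hσn n x).trans (by rw [← ha, ← hn]))⟩
  · exact (smul_comm s (u : K) y.1).symm
  · rw [hπ, hline, hline, (hπ x y).1 hxy]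
  · exact hfree s x.1 x.2.1 (congrArg Subtype.val hx)
  -- An element exchanging two vectors has square fixing a nonzero vector, so it is an involution;
  -- were it `-1`, it would preserve each line.
  · have h1 : s * s = 1 := by
      refine hfree _ x.1 x.2.1 ?_
      rw [mul_smul]
      exact congrArg Subtype.val ((congrArg (s • ·) hxy).trans hyx)
    refine (hinv s h1).resolve_right fun h2 => hne ((hπ x y).2 ?_)
    have h3 : y.1 = -x.1 := (congrArg Subtype.val hxy).symm.trans (h2 x.1)
    exact (Projectivization.mk_eq_mk_iff _ _ _ _ _).2 ⟨-1, by rw [h3]; simp⟩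

end PlaneAction

end

noncomputable section

/-! ### Traces, unipotents and the order of `SL₂`. -/

section SpecialLinear

open Matrix

open scoped MatrixGroups

variable {F : Type*} [Field F] {p : ℕ}

theorem add_adjugate_eq_trace (A : Matrix (Fin 2) (Fin 2) F) :
    A + A.adjugate = algebraMap F _ A.trace := by
  ext i j
  fin_cases i <;> fin_cases j <;> simp [Matrix.trace_fin_two, Matrix.adjugate_fin_two,
    Matrix.algebraMap_matrix_apply, add_comm]

theorem coe_add_inv_eq_trace (A : SL(2, F)) :
    A.1 + (A⁻¹).1 = algebraMap F _ A.1.trace := by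
  rw [← add_adjugate_eq_trace, Matrix.SpecialLinearGroup.coe_inv]

/-- A nontrivial element of order prime to the characteristic does not have the eigenvalue `1`. -/
theorem det_sub_one_ne_zero [Fact p.Prime] [CharP F p] {A : SL(2, F)} {m : ℕ} (hm : ¬ p ∣ m)
    (hA : A ^ m = 1) (h1 : A ≠ 1) : (A.1 - 1).det ≠ 0 := by
  intro h
  -- `det (A - 1) = 2 - tr A`. Trace two makes `A` unipotent, and the Frobenius identity then gives
  -- `A ^ p = 1`.
  have htr : A.1.trace = 2 := by
    have := A.2
    rw [Matrix.det_fin_two] at h this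
    simp at h
    rw [Matrix.trace_fin_two]
    linear_combination this - h
  have h2 : (A.1 - 1) ^ 2 = 0 := by
    have h3 := congrArg (A.1 * ·) (coe_add_inv_eq_trace A)
    simp only [mul_add, ← Matrix.SpecialLinearGroup.coe_mul, mul_inv_cancel, htr,
      Matrix.SpecialLinearGroup.coe_one, map_ofNat] at h3
    rw [Matrix.SpecialLinearGroup.coe_mul] at h3
    have : (A.1 - 1) ^ 2 = A.1 * A.1 + 1 - A.1 * 2 := by noncomm_ring
    rw [this, h3, sub_self]
  have h3 : A.1 ^ p = 1 := by
    have h4 := sub_pow_char_of_commute (R := Matrix (Fin 2) (Fin 2) F) p (Commute.one_right A.1)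
    rw [one_pow, ← Nat.add_sub_cancel' (Fact.out : p.Prime).two_le, pow_add, h2, zero_mul,
      Nat.add_sub_cancel' (Fact.out : p.Prime).two_le] at h4
    exact (sub_eq_zero.1 h4.symm)
  have h4 : A ^ p = 1 := Subtype.ext (by rw [Matrix.SpecialLinearGroup.coe_pow, h3]; rfl)
  rcases (Nat.dvd_prime Fact.out).1 (orderOf_dvd_of_pow_eq_one h4) with h5 | h5
  · exact h1 (orderOf_eq_one_iff.1 h5)
  · exact hm (h5 ▸ orderOf_dvd_of_pow_eq_one hA)

theorem eq_or_eq_neg_of_mul_self [Fact p.Prime] [CharP F p] (hp : p ≠ 2) {A : SL(2, F)}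
    (hA : A * A = 1) : A = 1 ∨ A.1 = -1 := by
  by_cases h1 : A = 1
  · exact .inl h1
  have h2 := det_sub_one_ne_zero (p := p) (m := 2)
    (fun h => hp ((Nat.prime_dvd_prime_iff_eq Fact.out Nat.prime_two).1 h)) (by rw [pow_two, hA]) h1
  have h3 : (A.1 - 1) * (A.1 + 1) = 0 := by
    have h4 : A.1 * A.1 = 1 := by rw [← Matrix.SpecialLinearGroup.coe_mul, hA]; rfl
    have : (A.1 - 1) * (A.1 + 1) = A.1 * A.1 - 1 := by noncomm_ring
    rw [this, h4, sub_self]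
  have h4 : IsUnit (A.1 - 1) := (Matrix.isUnit_iff_isUnit_det _).2 h2.isUnit
  exact .inr (eq_neg_of_add_eq_zero_left (h4.mul_right_eq_zero.1 h3))

/-- Commuting elements of the same trace are equal or inverse to each other. -/
theorem eq_or_eq_inv_of_trace_eq [Fact p.Prime] [CharP F p] {A B : SL(2, F)} {m : ℕ} (hm : ¬ p ∣ m)
    (hAB : (B * A⁻¹) ^ m = 1) (hc : Commute A B) (ht : A.1.trace = B.1.trace) :
    B = A ∨ B = A⁻¹ := by
  by_cases h1 : B * A⁻¹ = 1
  · exact .inl (mul_inv_eq_one.1 h1)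
  have h2 := det_sub_one_ne_zero hm hAB h1
  have h3 : (B.1 - A.1).det ≠ 0 := by
    have : B.1 - A.1 = ((B * A⁻¹).1 - 1) * A.1 := by
      rw [sub_mul, ← Matrix.SpecialLinearGroup.coe_mul, inv_mul_cancel_right, one_mul]
    rwa [this, Matrix.det_mul, A.2, mul_one]
  -- Since `A + A⁻¹` and `B + B⁻¹` are the same scalar, `B` is a root of the quadratic polynomial
  -- with roots `A` and `A⁻¹`.
  have h4 : (B.1 - A.1) * (B.1 - (A⁻¹).1) = 0 := by
    have e₁ := congrArg (B.1 * ·) ((coe_add_inv_eq_trace A).trans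
      (ht ▸ (coe_add_inv_eq_trace B).symm))
    simp only [mul_add, ← Matrix.SpecialLinearGroup.coe_mul, mul_inv_cancel] at e₁
    simp only [sub_mul, mul_sub, ← Matrix.SpecialLinearGroup.coe_mul, mul_inv_cancel, hc.eq]
    rw [eq_comm, ← sub_eq_zero] at e₁
    rw [← e₁]
    abel
  have h5 : IsUnit (B.1 - A.1) := (Matrix.isUnit_iff_isUnit_det _).2 h3.isUnit
  exact .inr (Subtype.ext (sub_eq_zero.1 (h5.mul_right_eq_zero.1 h4)))

/-- The upper unitriangular matrices. -/
def upperUni (x : F) : SL(2, F) := ⟨!![1, x; 0, 1], by simp⟩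

/-- The lower unitriangular matrices. -/
def lowerUni (x : F) : SL(2, F) := ⟨!![1, 0; x, 1], by simp⟩

@[simp] theorem coe_upperUni (x : F) :
    (upperUni x : Matrix (Fin 2) (Fin 2) F) = !![1, x; 0, 1] := rfl

@[simp] theorem coe_lowerUni (x : F) :
    (lowerUni x : Matrix (Fin 2) (Fin 2) F) = !![1, 0; x, 1] := rfl

theorem upperUni_zero : upperUni (0 : F) = 1 := by
  ext i j
  fin_cases i <;> fin_cases j <;> simp

theorem lowerUni_zero : lowerUni (0 : F) = 1 := by
  ext i j
  fin_cases i <;> fin_cases j <;> simp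

theorem upperUni_mul (x y : F) : upperUni x * upperUni y = upperUni (x + y) := by
  ext i j
  fin_cases i <;> fin_cases j <;> simp [add_comm]

theorem lowerUni_mul (x y : F) : lowerUni x * lowerUni y = lowerUni (x + y) := by
  ext i j
  fin_cases i <;> fin_cases j <;> simp

theorem upperUni_pow (x : F) (n : ℕ) : upperUni x ^ n = upperUni (n * x) := by
  induction n with
  | zero => simp [upperUni_zero]
  | succ n ih => rw [pow_succ, ih, upperUni_mul]; congr 1; push_cast; ring

theorem lowerUni_pow (x : F) (n : ℕ) : lowerUni x ^ n = lowerUni (n * x) := by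
  induction n with
  | zero => simp [lowerUni_zero]
  | succ n ih => rw [pow_succ, ih, lowerUni_mul]; congr 1; push_cast; ring

theorem eq_upper_mul_lower_mul_upper {A : SL(2, F)} (h : A.1 1 0 ≠ 0) :
    ∃ x y z, A = upperUni x * lowerUni y * upperUni z := by
  refine ⟨(A.1 0 0 - 1) / A.1 1 0, A.1 1 0, (A.1 1 1 - 1) / A.1 1 0, ?_⟩
  have hd := A.2
  rw [Matrix.det_fin_two] at hd
  ext i j
  fin_cases i <;> fin_cases j <;>
    simp [Matrix.mul_apply, Fin.sum_univ_two] <;> field_simp <;>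
    first | ring1 | linear_combination -hd

/-- The unitriangular matrices generate the group and have order dividing `p`. A matrix with zero
lower left entry is first multiplied by `lowerUni 1`. -/
theorem abelianization_pow_eq_one [CharP F p] (x : Abelianization (SL(2, F))) : x ^ p = 1 := by
  have hu : ∀ x : F, (Abelianization.of (upperUni x)) ^ p = 1 := fun x => by
    rw [← map_pow, upperUni_pow, CharP.cast_eq_zero, zero_mul, upperUni_zero, map_one]
  have hl : ∀ x : F, (Abelianization.of (lowerUni x)) ^ p = 1 := fun x => by
    rw [← map_pow, lowerUni_pow, CharP.cast_eq_zero, zero_mul, lowerUni_zero, map_one]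
  have h1 : ∀ A : SL(2, F), A.1 1 0 ≠ 0 → (Abelianization.of A) ^ p = 1 := fun A hA => by
    obtain ⟨x, y, z, rfl⟩ := eq_upper_mul_lower_mul_upper hA
    simp only [map_mul, mul_pow, hu, hl, mul_one]
  obtain ⟨A, rfl⟩ := QuotientGroup.mk_surjective x
  change Abelianization.of A ^ p = 1
  by_cases hA : A.1 1 0 = 0
  · have hd := A.2
    rw [Matrix.det_fin_two, hA, mul_zero, sub_zero] at hd
    have h2 := h1 (lowerUni 1 * A) (by
      simpa [Matrix.mul_apply, Fin.sum_univ_two, hA] using left_ne_zero_of_mul_eq_one hd)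
    rwa [map_mul, mul_pow, hl, one_mul] at h2
  · exact h1 A hA

theorem card_SL_fin_two [Finite F] :
    Nat.card (SL(2, F)) = Nat.card F * (Nat.card F ^ 2 - 1) := by
  have := Fintype.ofFinite F
  have h1 := Matrix.card_GL_field (𝔽 := F) 2
  have h2 : (GeneralLinearGroup.det (n := Fin 2) (R := F)).ker.index = Nat.card Fˣ := by
    rw [Subgroup.index_ker, MonoidHom.range_eq_top.2 GeneralLinearGroup.det_surjective,
      Subgroup.card_top]
  have h3 : Nat.card (GeneralLinearGroup.det (n := Fin 2) (R := F)).ker = Nat.card (SL(2, F)) := by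
    refine Nat.card_congr ⟨fun A => ⟨A.1.1, congrArg Units.val A.2⟩, fun A => ⟨A, Units.ext A.2⟩,
      fun A => Subtype.ext (Units.ext rfl), fun A => rfl⟩
  have h4 := (GeneralLinearGroup.det (n := Fin 2) (R := F)).ker.card_mul_index
  rw [h1, h2, h3, Nat.card_units, Fin.prod_univ_two] at h4
  have hq : 1 < Nat.card F := Finite.one_lt_card
  obtain ⟨q, hq'⟩ : ∃ q, Nat.card F = q + 2 := ⟨_, (Nat.sub_add_cancel hq).symm⟩
  rw [Fintype.card_eq_nat_card, hq'] at h4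
  rw [hq']
  refine Nat.eq_of_mul_eq_mul_right (m := q + 1) (by lia) (h4.trans ?_)
  have e₁ : (q + 2) ^ 2 - 1 = (q + 1) * (q + 3) := by
    rw [Nat.sub_eq_iff_eq_add (Nat.one_le_pow _ _ (by lia))]; ring
  have e₂ : (q + 2) ^ 2 - (q + 2) = (q + 1) * (q + 2) := by
    rw [Nat.sub_eq_iff_eq_add (Nat.le_self_pow two_ne_zero _)]; ring
  simp [e₁, e₂]
  ring

end SpecialLinear

/-! ### Sylow subgroups and fusion in `SL₂` of a finite field. -/

section SpecialLinearPeriodic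

open Matrix

open scoped MatrixGroups

/-- In a cyclic group the equation `a ^ n = 1` has at most `n` solutions, and the powers of `x`
already provide `orderOf x` of them. -/
theorem mem_zpowers_of_pow_orderOf_eq_one {H : Type*} [Group H] [Finite H] [IsCyclic H] {x s : H}
    (hs : s ^ orderOf x = 1) : s ∈ Subgroup.zpowers x := by
  classical
  have := Fintype.ofFinite H
  have h1 := IsCyclic.card_pow_eq_one_le (α := H) (orderOf_pos x)
  have h2 : (Subgroup.zpowers x : Set H).toFinset ⊆
      ({a : H | a ^ orderOf x = 1} : Finset H) := fun a ha => by
    obtain ⟨m, rfl⟩ := Subgroup.mem_zpowers_iff.1 (Set.mem_toFinset.1 ha)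
    rw [Finset.mem_filter, ← zpow_natCast, zpow_comm, zpow_natCast, pow_orderOf_eq_one, _root_.one_zpow]
    exact ⟨Finset.mem_univ _, rfl⟩
  have h3 := Finset.eq_of_subset_of_card_le h2 (h1.trans (by
    rw [Set.toFinset_card, ← Fintype.card_zpowers]
    exact le_rfl))
  exact Set.mem_toFinset.1 (h3 ▸ Finset.mem_filter.2 ⟨Finset.mem_univ _, hs⟩)

variable {F : Type u} [Field F] [Finite F] {p : ℕ} [Fact p.Prime] [CharP F p]

theorem eq_one_of_map_smul_eq {K : Type*} [Field K] [Algebra F K] {A : SL(2, F)} {m : ℕ}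
    (hm : ¬ p ∣ m) (hA : A ^ m = 1) {v : Fin 2 → K} (hv : v ≠ 0)
    (h : Matrix.SpecialLinearGroup.map (algebraMap F K) A • v = v) : A = 1 := by
  by_contra h1
  refine det_sub_one_ne_zero hm hA h1 ((algebraMap F K).injective ?_)
  rw [map_zero, RingHom.map_det, map_sub, map_one]
  refine Matrix.exists_mulVec_eq_zero_iff.1 ⟨v, hv, ?_⟩
  rw [Matrix.sub_mulVec, Matrix.one_mulVec]
  exact sub_eq_zero.2 h

/-- A subgroup of `SL₂` acts on the plane over an extension field. -/
abbrev planeAction (S : Subgroup (SL(2, F))) (K : Type*) [Field K] [Algebra F K] :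
    DistribMulAction S (Fin 2 → K) :=
  DistribMulAction.compHom _ ((Matrix.SpecialLinearGroup.map (algebraMap F K)).comp S.subtype)

theorem planeAction_smulCommClass (S : Subgroup (SL(2, F))) (K : Type*) [Field K] [Algebra F K] :
    letI := planeAction S K
    SMulCommClass S K (Fin 2 → K) :=
  letI := planeAction S K
  ⟨fun s a v => smul_comm (Matrix.SpecialLinearGroup.map (algebraMap F K) s.1) a v⟩

theorem finrank_plane (K : Type*) [Field K] : Module.finrank K (Fin 2 → K) = 2 := by simp

theorem dvd_card_sq_sub_one {f l : ℕ} (hF : Nat.card F = p ^ f) (hl : l.Prime) (hlp : l ≠ p)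
    (hlG : l ∣ Nat.card (SL(2, F))) : l ∣ Nat.card F ^ 2 - 1 := by
  rw [card_SL_fin_two] at hlG
  refine (hl.dvd_mul.1 hlG).resolve_left fun h => hlp ?_
  rw [hF] at h
  exact (Nat.prime_dvd_prime_iff_eq hl Fact.out).1 (hl.dvd_of_dvd_pow h)

theorem not_dvd_card_of_isPGroup {l n : ℕ} (hl : l.Prime) (hlp : l ≠ p) : ¬ p ∣ l ^ n :=
  fun h => hlp ((Nat.prime_dvd_prime_iff_eq Fact.out hl).1
    ((Fact.out : p.Prime).dvd_of_dvd_pow h)).symm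

theorem eq_one_of_planeAction {S : Subgroup (SL(2, F))} {l n : ℕ} (hl : l.Prime) (hlp : l ≠ p)
    (hS : Nat.card S = l ^ n) (K : Type*) [Field K] [Algebra F K] :
    letI := planeAction S K
    ∀ (s : S) (v : Fin 2 → K), v ≠ 0 → s • v = v → s = 1 := fun s v hv h =>
  Subtype.ext (eq_one_of_map_smul_eq (p := p) (not_dvd_card_of_isPGroup (n := n) hl hlp)
    (by rw [← hS, ← Subgroup.coe_pow, pow_card_eq_one', Subgroup.coe_one]) hv h)

/-- Over the quadratic extension the projective line has `q² + 1` points. As `l` divides `q² - 1`,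
dividing `q² + 1` as well would force `l = 2`. -/
theorem isCyclic_of_odd {f l n : ℕ} (hF : Nat.card F = p ^ f) (hl : l.Prime) (hlp : l ≠ p)
    (hl2 : l ≠ 2) (hlG : l ∣ Nat.card (SL(2, F))) {S : Subgroup (SL(2, F))} (hS : Nat.card S = l ^ n) :
    IsCyclic S := by
  have := Fact.mk hl
  let K := FiniteField.Extension F p 2
  let := planeAction S K
  have := planeAction_smulCommClass S K
  refine isCyclic_of_free_action (finrank_plane K) (IsPGroup.of_card hS) (fun h => ?_)
    (eq_one_of_planeAction hl hlp hS K)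
  rw [FiniteField.natCard_extension] at h
  have h1 := dvd_card_sq_sub_one hF hl hlp hlG
  have h2 : 0 < Nat.card F ^ 2 := pow_pos Nat.card_pos 2
  have h3 := (Nat.dvd_sub h h1)
  rw [show Nat.card F ^ 2 + 1 - (Nat.card F ^ 2 - 1) = 2 by lia] at h3
  exact hl2 ((Nat.prime_dvd_prime_iff_eq hl Nat.prime_two).1 h3)

variable {k : Type u} [CommRing k]

theorem hasLocalGenerator_odd {f l : ℕ} (hF : Nat.card F = p ^ f) (hl : l.Prime) (hlp : l ≠ p)
    (hl2 : l ≠ 2) (hlG : l ∣ Nat.card (SL(2, F))) (hk : Prime (l : k)) :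
    HasLocalGenerator k (SL(2, F)) l := by
  classical
  have := Fact.mk hl
  obtain ⟨x, hx⟩ := exists_prime_orderOf_dvd_card' (G := SL(2, F)) l hlG
  have hC : Nat.card (Subgroup.zpowers x) = l := by rw [Nat.card_zpowers, hx]
  obtain ⟨S, hCS⟩ := (IsPGroup.of_card (n := 1) (by rw [hC, pow_one])).exists_le_sylow
  obtain ⟨n, hn⟩ := IsPGroup.iff_card.1 S.2
  have : IsCyclic S.1 := isCyclic_of_odd hF hl hlp hl2 hlG hn
  have hpow : ∀ s ∈ S.1, s ^ l ^ n = 1 := fun s hs => by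
    have h1 : (⟨s, hs⟩ : S.1) ^ l ^ n = 1 := by rw [← hn, pow_card_eq_one']
    exact congrArg Subtype.val h1
  have hmem : ∀ s ∈ S.1, s ^ l = 1 → s ∈ Subgroup.zpowers x := fun s hs hsl => by
    have hxS := hCS (Subgroup.mem_zpowers x)
    obtain ⟨m, hm⟩ := Subgroup.mem_zpowers_iff.1 (mem_zpowers_of_pow_orderOf_eq_one
      (x := (⟨x, hxS⟩ : S.1)) (s := ⟨s, hs⟩) (Subtype.ext (by
        rw [Subgroup.orderOf_mk, hx]
        exact hsl)))
    exact Subgroup.mem_zpowers_iff.2 ⟨m, congrArg Subtype.val hm⟩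
  have hxl : ∀ c ∈ Subgroup.zpowers x, c ^ l = 1 := fun c hc => by
    obtain ⟨m, rfl⟩ := Subgroup.mem_zpowers_iff.1 hc
    rw [← zpow_natCast, zpow_comm, zpow_natCast, ← hx, pow_orderOf_eq_one, _root_.one_zpow]
  have hcomm : ∀ c ∈ S.1, ∀ d ∈ S.1, Commute c d := fun c hc d hd =>
    congrArg Subtype.val (mul_comm' (⟨c, hc⟩ : S.1) ⟨d, hd⟩)
  refine hasLocalGenerator_of_isCyclic hl hk hC hCS hn S.not_dvd_index fun g hg => ?_
  have h1 : ∀ c ∈ Subgroup.zpowers x, g⁻¹ * c * g ∈ Subgroup.zpowers x := fun c hc =>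
    hmem _ (hg c hc) (by
      have : g⁻¹ * c * g = MulAut.conj g⁻¹ c := by simp
      rw [this, ← map_pow, hxl c hc, map_one])
  refine ⟨h1, fun c hc => ?_⟩
  -- `c` and its conjugate both lie in the abelian group `S` and have the same trace, so conjugation
  -- by `g` fixes or inverts `c`; in both cases `g * g` commutes with `c`.
  have h2 := eq_or_eq_inv_of_trace_eq (p := p) (A := c) (B := g⁻¹ * c * g) (m := l ^ n)
    (not_dvd_card_of_isPGroup hl hlp)
    (hpow _ (S.1.mul_mem (hg c hc) (S.1.inv_mem (hCS hc)))) (hcomm _ (hCS hc) _ (hg c hc)) (by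
      rw [Matrix.SpecialLinearGroup.coe_mul, Matrix.trace_mul_comm,
        ← Matrix.SpecialLinearGroup.coe_mul, mul_inv_cancel_left])
  rcases h2 with h2 | h2
  · have h3 : Commute g c := by
      have := congrArg (g * ·) h2
      simp only [mul_assoc, mul_inv_cancel_left] at this
      exact this.symm
    exact h3.mul_left h3
  · have h3 : c * g = g * c⁻¹ := by
      have := congrArg (g * ·) h2
      simpa only [mul_assoc, mul_inv_cancel_left] using this
    have h4 : c⁻¹ * g = g * c := by
      rw [inv_mul_eq_iff_eq_mul, ← mul_assoc, h3, inv_mul_cancel_right]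
    change g * g * c = c * (g * g)
    rw [← mul_assoc, h3, mul_assoc g c⁻¹, h4, mul_assoc]

/-- `C` is generated by the central element `-1`, so no fusion condition arises. The quadratic
extension has `q²` elements, and `q² ≡ 1` modulo `4` even when `q ≡ 3`. -/
theorem hasLocalGenerator_two [IsDomain k] [CharZero k] [IsPrincipalIdealRing k] {f : ℕ}
    (hF : Nat.card F = p ^ f) (hp : p ≠ 2) (hk : Prime ((2 : ℕ) : k)) :
    HasLocalGenerator k (SL(2, F)) 2 := by
  have := Fact.mk Nat.prime_two
  have h2 : (2 : F) ≠ 0 := fun h => by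
    have h1 := (CharP.cast_eq_zero_iff F p 2).1 (by exact_mod_cast h)
    exact hp ((Nat.prime_dvd_prime_iff_eq Fact.out Nat.prime_two).1 h1)
  have hx : orderOf (-1 : SL(2, F)) = 2 := by
    refine orderOf_eq_prime (by simp) fun h => ?_
    have h1 := congrFun (congrFun (congrArg Subtype.val h) 0) 0
    simp at h1
    exact h2 (by linear_combination -h1)
  have hC : Nat.card (Subgroup.zpowers (-1 : SL(2, F))) = 2 := by rw [Nat.card_zpowers, hx]
  obtain ⟨S, hCS⟩ := (IsPGroup.of_card (n := 1) (by rw [hC, pow_one])).exists_le_sylow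
  obtain ⟨n, hn⟩ := IsPGroup.iff_card.1 S.2
  refine hasLocalGenerator_of_commute Nat.prime_two hk hC hCS hn S.not_dvd_index (fun g c hc => ?_) ?_
  · obtain ⟨m, rfl⟩ := Subgroup.mem_zpowers_iff.1 hc
    exact Commute.zpow_right (Commute.neg_one_right g) m
  let K := FiniteField.Extension F p 2
  let := planeAction S.1 K
  have := planeAction_smulCommClass S.1 K
  refine stablyEquiv_of_free_action (finrank_plane K) S.2 ?_
    (eq_one_of_planeAction Nat.prime_two hp.symm hn K) (fun s hs => ?_) S.1.subtype_injective
  · rw [FiniteField.natCard_extension, hF]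
    have h1 : (p ^ f) % 2 = 1 := Nat.odd_iff.1 (((Fact.out : p.Prime).odd_of_ne_two hp).pow)
    obtain ⟨m, hm⟩ : ∃ m, p ^ f = 2 * m + 1 := ⟨p ^ f / 2, by lia⟩
    rw [hm, show (2 * m + 1) ^ 2 = 4 * (m * m + m) + 1 by ring]
    lia
  · refine (eq_or_eq_neg_of_mul_self (p := p) hp (congrArg Subtype.val hs)).imp Subtype.ext
      fun h v => ?_
    change (s.1.1.map (algebraMap F K)) *ᵥ v = -v
    rw [h]
    have : ((-1 : Matrix (Fin 2) (Fin 2) F).map (algebraMap F K)) = -1 := by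
      rw [← RingHom.mapMatrix_apply, map_neg, map_one]
    rw [this, Matrix.neg_mulVec, Matrix.one_mulVec]

theorem isPeriodic_SL_fin_two [IsDomain k] [CharZero k] [IsPrincipalIdealRing k]
    (hk : ∀ l : ℕ, l.Prime → Prime (l : k)) {f : ℕ} (hF : Nat.card F = p ^ f) :
    IsPeriodic k (SL(2, F)) p :=
  isPeriodic_of_hasLocalGenerator hk fun l hl hlp hlG => by
    by_cases hl2 : l = 2
    · subst hl2
      exact hasLocalGenerator_two hF hlp.symm (hk 2 Nat.prime_two)
    · exact hasLocalGenerator_odd hF hl hlp hl2 hlG (hk l hl)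

end SpecialLinearPeriodic

/-! ### The quotient of `ℤ[1/p]` by the order of the group. -/

/-- The homology of `SL₂` over a field with `q` elements, with the characteristic inverted. -/
theorem groupHomology_SL_fin_two {p f : ℕ} (hp : p.Prime) (hf : 1 ≤ f)
    {F : Type} [Field F] [Finite F] (hF : Nat.card F = p ^ f)
    {M : Type} [CommRing M] [Algebra ℤ M] [IsLocalization.Away (p : ℤ) M] {k : ℕ} (hk : 1 ≤ k) :
    (k ≡ 3 [MOD 4] → Nonempty (groupHomology
        (Rep.trivial ℤ (Matrix.SpecialLinearGroup (Fin 2) F) M) k ≃+ ZMod ((p ^ f) ^ 2 - 1))) ∧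
    (¬ k ≡ 3 [MOD 4] → Subsingleton
        (groupHomology (Rep.trivial ℤ (Matrix.SpecialLinearGroup (Fin 2) F) M) k)) := by
  have := Fact.mk hp
  have : CharP F p := by
    have := Fintype.ofFinite F
    exact charP_of_card_eq_prime_pow (f := f) (by rw [Fintype.card_eq_nat_card, hF])
  let r : M := IsLocalization.Away.invSelf (p : ℤ)
  have hpr : (p : M) * r = 1 := by
    have := IsLocalization.Away.mul_invSelf (S := M) (p : ℤ)
    rwa [map_natCast] at this
  have hp0 : (p : ℤ) ≠ 0 := by exact_mod_cast hp.ne_zero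
  have hinj : Function.Injective (algebraMap ℤ M) :=
    IsLocalization.injective M (powers_le_nonZeroDivisors_of_noZeroDivisors hp0)
  have : IsDomain M :=
    IsLocalization.isDomain_of_le_nonZeroDivisors M (powers_le_nonZeroDivisors_of_noZeroDivisors hp0)
  have hN : 1 ≤ (p ^ f) ^ 2 := Nat.one_le_pow _ _ (pow_pos hp.pos _)
  have hcard : Nat.card (Matrix.SpecialLinearGroup (Fin 2) F) = p ^ f * ((p ^ f) ^ 2 - 1) := by
    rw [card_SL_fin_two, hF]
  generalize hNe : (p ^ f) ^ 2 - 1 = N at hcard ⊢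
  have hpN : IsUnit ((p : ℤ) : ZMod N) := by
    -- `p ^ (2 * f) = 1` modulo `N`, since `N` is `q² - 1`.
    refine IsUnit.of_mul_eq_one ((p : ZMod N) ^ (2 * f - 1)) ?_
    rw [Int.cast_natCast, ← pow_succ', Nat.sub_add_cancel (by lia), mul_comm 2, pow_mul]
    have : (((p ^ f) ^ 2 - 1 : ℕ) : ZMod N) = 0 := by rw [hNe, ZMod.natCast_self]
    rw [Nat.cast_sub hN, sub_eq_zero] at this
    exact_mod_cast this
  let L : M →+* ZMod N := IsLocalization.Away.lift (p : ℤ) (g := Int.castRingHom (ZMod N)) hpN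
  have hL : ∀ a : ℤ, L (algebraMap ℤ M a) = a := fun a =>
    IsLocalization.Away.lift_eq (p : ℤ) (g := Int.castRingHom (ZMod N)) hpN a
  have hsmul : ∀ (n : ℕ) (m : M), (n : ℤ) • m = n * m := fun n m => by
    rw [Nat.cast_smul_eq_nsmul, nsmul_eq_mul]
  refine (isPeriodic_SL_fin_two (k := ℤ) (fun l hl => Nat.prime_iff_prime_int.1 hl)
    hF).groupHomology_trivial (M := M) (φ := LinearMap.mulLeft ℤ r) (fun m => ?_)
    (fun n hn m hm => ?_) abelianization_pow_eq_one L.toAddMonoidHom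
    (fun z => ?_) (fun m => ⟨fun hm => ?_, ?_⟩) hk
  · rw [hsmul, LinearMap.mulLeft_apply, ← mul_assoc, hpr, one_mul]
  · rw [hsmul] at hm
    refine (mul_eq_zero.1 hm).resolve_left fun h => hn ?_
    rw [← map_natCast (algebraMap ℤ M), map_eq_zero_iff _ hinj] at h
    exact_mod_cast h
  · obtain ⟨a, rfl⟩ := ZMod.intCast_surjective z
    exact ⟨algebraMap ℤ M a, hL a⟩
  · obtain ⟨n, a, ha⟩ := IsLocalization.Away.surj (p : ℤ) m
    have h1 : ((a : ℤ) : ZMod N) = 0 := by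
      rw [← hL, ← ha, map_mul]
      rw [show L m = 0 from hm, zero_mul]
    obtain ⟨b, rfl⟩ := (ZMod.intCast_zmod_eq_zero_iff_dvd _ _).1 h1
    -- Here `m * pⁿ = N * b` and the group has order `p ^ f * N`, so dividing `m` by that order
    -- leaves `b` over `p ^ (n + f)`.
    refine ⟨algebraMap ℤ M b * r ^ n * r ^ f, ?_⟩
    rw [map_mul, map_natCast, map_natCast] at ha
    rw [hsmul, hcard]
    have e₁ : ∀ j : ℕ, (p : M) ^ j * r ^ j = 1 := fun j => by rw [← mul_pow, hpr, one_pow]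
    push_cast
    linear_combination (-m) * e₁ n + r ^ n * ha - (N * algebraMap ℤ M b * r ^ n) * e₁ f
  · rintro ⟨m', rfl⟩
    rw [hsmul, hcard]
    change L _ = 0
    rw [map_mul, map_natCast, Nat.cast_mul, ZMod.natCast_self, mul_zero, zero_mul]

end

end Representation

theorem corollary3 (p f : ℕ) (hp : p.Prime) (hf : 1 ≤ f)
    (F : Type) [Field F] [Finite F] (hF : Nat.card F = p ^ f)
    (k : ℕ) (hk : 1 ≤ k) :
    (k ≡ 3 [MOD 4] →
      Nonempty
        (groupHomology
            (Rep.trivial ℤ (Matrix.SpecialLinearGroup (Fin 2) F) (Localization.Away (p : ℤ))) k ≃+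
          ZMod ((p ^ f) ^ 2 - 1))) ∧
    (¬ k ≡ 3 [MOD 4] →
      Subsingleton
        (groupHomology
            (Rep.trivial ℤ (Matrix.SpecialLinearGroup (Fin 2) F) (Localization.Away (p : ℤ))) k)) :=
  Representation.groupHomology_SL_fin_two hp hf hF hk
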